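/- **Setting.** Let $Y_3$ be the blow-up of $\mathbb P^1\times\mathbb P^1$ over $\mathbb Q$, with coordinates $[x:y]\times[s:t]$, in the three points $[1:0]\times[1:0]$, $[0:1]\times[1:0]$, $[1:0]\times[0:1]$, and let $Q=[1:1]\times[1:1]$. Let $H$ be the anticanonical height, $H(P)=\max_f|f(P)|/\gcd_f(f(P))$, where $f$ runs over the basis $x^2st,\,y^2st,\,t^2xy,\,s^2xy,\,xyst,\,y^2t^2$ of $H^0(Y_3,\omega_{Y_3}^{-1})$ (integral values). On the chart $yt\neq0$ put $\varrho=(w,z)=(\frac xy-1,\frac st-1)\in\mathbb R^2=(T_QY_3)_{\mathbb R}$, with the norm $\max(|w|,|z|)$; let $\chi(\varepsilon)$ be the characteristic function of the closed ball of radius $\varepsilon$ about $0$, and let $d(Q,\cdot)$ be the distance $\max(|w|,|z|)$ near $Q$ (truncated at $1$ away from $Q$). For $W\subseteq Y_3(\mathbb Q)$, $B>0$ and $r>0$ the zoom measure on $\mathbb R^2$ is $$\delta_{W,Q,B,r}=\sum_{P\in W,\ P \text{ in the chart},\ H(P)\le B}\delta_{B^{1/r}\varrho(P)} .$$ For coprime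 integers $a,b$ with $ab(a+b)\ne0$ let $R_{a,b}\subset Y_3$ be the cuspidal curve $$b^2(y-x)^2st+a^2(t-s)^2xy-2ab\,yt(y-x)(t-s)=0,$$ that is, $(az-bw)^2+zw(a^2z+b^2w)=0$ in the chart; its cusp is $Q$. Let $M$ be the set of rational points $P\neq Q$ of $Y_3$ lying on at least one of these cuspidal curves. For $V\subseteq Y_3(\mathbb Q)$ let $\alpha(Q,V)\in[0,\infty]$ be the supremum of the $\delta>0$ for which there is $C>0$ with $d(Q,P)^{\delta}H(P)>C$ for all $P\in V\setminus\{Q\}$. For $W\subseteq Y_3(\mathbb Q)$ let $\alpha_{\mathrm{ess}}(Q,W)$ be the supremum of $\alpha(Q,V)$ over the subsets $V$ of $W$ that are constructible and dense in $W$ for the topology induced by the Zariski topology, and let $\alpha_{\mathrm{ess}}(Q)=\alpha_{\mathrm{ess}}(Q,Y_3(\mathbb Q))$. The set $W$ is *locally weakly accumulating* if $\alpha_{\mathrm{ess}}(Q)<\infty$, $\alpha_{\mathrm{ess}}(Q,W)=\alpha_{\mathrm{ess}}(Q)$, and there is a dense Zariski open $U$ with $\alpha(Q,U)=\alpha_{\mathrm{ess}}(Q)$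 such that, for every $V\subseteq W$ constructible and dense in $W$ (for the induced topology) with $\alpha(Q,V)=\alpha_{\mathrm{ess}}(Q)$ and for all sufficiently large $\varepsilon$, $$\delta_{U\setminus W,Q,B,\alpha_{\mathrm{ess}}(Q)}(\chi(\varepsilon))=o\big(\delta_{V,Q,B,\alpha_{\mathrm{ess}}(Q)}(\chi(\varepsilon))\big),\qquad B\to\infty .$$ **Theorem.** (0) A rational point $(w,z)$ of the chart with $wz(1+w)(1+z)\ne0$ lies in $M$ if and only if $-w-z-wz$ is the square of a nonzero rational number. (1) There is an absolute constant $c>0$ such that for every cuspidal curve $\mathcal C=R_{a,b}$ as above the following holds. The measures $B^{-1/5}\,\delta_{\mathcal C(\mathbb Q),Q,B,5/2}$ converge vaguely, as $B\to\infty$, to a nonzero locally finite measure $\delta_{\mathcal C}$ on $\mathbb R^2$. This measure is of Hausdorff dimension $1$ (it is carried by a set of dimension at most $1$, and every set of positive measure has dimension at least $1$) and is concentrated on the tangent half-line $\{az=bw,\ w+z\le0\}$ of $\mathcal C$ at its cusp $Q$. For every $\varepsilon>0$ and every $B\ge B_0(\mathcal C,\varepsilon)$, $$\delta_{M,Q,B,5/2}(\chi(\varepsilon))\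 \ge\ c\,B^{1/5}\,\delta_{\mathcal C}(\chi(\varepsilon)).$$ (2) There is $\varepsilon_0>0$ such that for every $\varepsilon\ge\varepsilon_0$ there are $c_\varepsilon,C_\varepsilon>0$ with $$c_\varepsilon\,B^{1/5}\log B\ \le\ \delta_{M,Q,B,5/2}(\chi(\varepsilon))\ \le\ C_\varepsilon\,B^{1/5}\log B$$ for all sufficiently large $B$. (3) The set $M$ is locally weakly accumulating. -/

import Mathlib

open MeasureTheory Filter Topology
open scoped ENNReal

noncomputable section

namespace ToricY3

/-! ### The surface: the blow-up of `ℙ¹ × ℙ¹` in three torus-fixed points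

`Y₃` is the smooth complete toric surface whose rays are, in cyclic order,
`(-1,0), (-1,-1), (0,-1), (1,-1), (1,0), (0,1), (-1,1)`.
With the coordinates `[x:y] × [s:t]` on `ℙ¹ × ℙ¹` it is the blow-up in
`P₁ = [1:0] × [1:0]`, `P₂ = [0:1] × [1:0]`, `P₃ = [1:0] × [0:1]`.
Its rational points are described by homogeneous (Cox) coordinates `η₀, …, η₆`, one for each ray,
modulo the torus `Hom(Pic Y₃, 𝔾_m)`. The divisors `η₁ = 0`, `η₃ = 0`, `η₆ = 0` are the exceptional
curves over `P₁`, `P₂`, `P₃`, and the blow-down is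
`x = η₄ η₃`, `y = η₀ η₁ η₆`, `s = η₅ η₆`, `t = η₂ η₁ η₃`. -/

/-- Homogeneous coordinates over `ℚ`: two coordinates that are not neighbours in the cyclic order
do not vanish simultaneously. -/
structure CoxPoint where
  coord : Fin 7 → ℚ
  nonvanishing : ∀ i j : Fin 7, coord i = 0 → coord j = 0 → j = i ∨ j = i + 1 ∨ i = j + 1

/-- The Zariski topology on the rational points of the open subset of `𝔸⁷` formed by the admissible
homogeneous coordinates. -/
instance : TopologicalSpace CoxPoint :=
  TopologicalSpace.generateFrom
    {D | ∃ f : MvPolynomial (Fin 7) ℚ, D = {η | MvPolynomial.eval η.coord f ≠ 0}}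

/-- Two systems of homogeneous coordinates define the same point if they differ by an element of
the torus `{τ | ∏ τᵢ ^ ⟨m, ρᵢ⟩ = 1 for all characters m}`, where the `ρᵢ` are the rays. -/
def torusSetoid : Setoid CoxPoint where
  r η η' := ∃ τ : Fin 7 → ℚˣ, τ 4 * τ 3 = τ 0 * τ 1 * τ 6 ∧ τ 5 * τ 6 = τ 2 * τ 1 * τ 3 ∧
    ∀ i, η'.coord i = τ i * η.coord i
  iseqv :=
    { refl := fun η => ⟨1, by simp⟩
      symm := by
        rintro η η' ⟨τ, h₁, h₂, h⟩
        refine ⟨τ⁻¹, ?_, ?_, fun i => ?_⟩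
        · simp only [Pi.inv_apply, ← mul_inv, h₁]
        · simp only [Pi.inv_apply, ← mul_inv, h₂]
        · simp [h i]
      trans := by
        rintro η η' η'' ⟨τ, h₁, h₂, h⟩ ⟨σ, k₁, k₂, k⟩
        refine ⟨σ * τ, ?_, ?_, fun i => ?_⟩
        · simp only [Pi.mul_apply]
          rw [mul_mul_mul_comm, h₁, k₁]
          ac_rfl
        · simp only [Pi.mul_apply]
          rw [mul_mul_mul_comm, h₂, k₂]
          ac_rfl
        · simp [h i, k i, mul_assoc] }

/-- The set `Y₃(ℚ)` of rational points of `Y₃`. -/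
def Y3 : Type := Quotient torusSetoid

/-- The Zariski topology on `Y₃(ℚ)`. -/
instance : TopologicalSpace Y3 := inferInstanceAs (TopologicalSpace (Quotient torusSetoid))

/-- The basis `x²st, y²st, t²xy, s²xy, xyst, y²t²` of the global sections of the anticanonical
bundle `𝒪(2,2) - E₁ - E₂ - E₃`, in homogeneous coordinates: each bihomogeneous form is divided by
the equation `η₁ η₃ η₆` of `E₁ + E₂ + E₃`. -/
def anticanonical (η : Fin 7 → ℚ) : Fin 6 → ℚ :=
  ![η 3 ^ 2 * η 4 ^ 2 * η 5 * η 2,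
    η 1 ^ 2 * η 6 ^ 2 * η 0 ^ 2 * η 5 * η 2,
    η 1 ^ 2 * η 3 ^ 2 * η 2 ^ 2 * η 4 * η 0,
    η 6 ^ 2 * η 5 ^ 2 * η 4 * η 0,
    η 0 * η 1 * η 2 * η 3 * η 4 * η 5 * η 6,
    η 1 ^ 3 * η 3 * η 6 * η 0 ^ 2 * η 2 ^ 2]

theorem anticanonical_torus (η η' : Fin 7 → ℚ) (τ : Fin 7 → ℚˣ)
    (h₁ : τ 4 * τ 3 = τ 0 * τ 1 * τ 6) (h₂ : τ 5 * τ 6 = τ 2 * τ 1 * τ 3)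
    (h : ∀ i, η' i = τ i * η i) :
    anticanonical η' =
      ((τ 0 * τ 1 * τ 2 * τ 3 * τ 4 * τ 5 * τ 6 : ℚˣ) : ℚ) • anticanonical η := by
  have e₁ : (τ 4 : ℚ) * τ 3 = τ 0 * τ 1 * τ 6 := by exact_mod_cast congrArg Units.val h₁
  have e₂ : (τ 5 : ℚ) * τ 6 = τ 2 * τ 1 * τ 3 := by exact_mod_cast congrArg Units.val h₂
  simp only [anticanonical, h, Matrix.smul_cons, Matrix.smul_empty, smul_eq_mul, Units.val_mul]
  congr 1
  · linear_combination
      (τ 3 * τ 4 * τ 5 * τ 2 : ℚ) * (η 3 ^ 2 * η 4 ^ 2 * η 5 * η 2) * e₁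
  congr 1
  · linear_combination
      -(τ 1 * τ 6 * τ 0 * τ 5 * τ 2 : ℚ) * (η 1 ^ 2 * η 6 ^ 2 * η 0 ^ 2 * η 5 * η 2) * e₁
  congr 1
  · linear_combination
      -(τ 1 * τ 3 * τ 2 * τ 4 * τ 0 : ℚ) * (η 1 ^ 2 * η 3 ^ 2 * η 2 ^ 2 * η 4 * η 0) * e₂
  congr 1
  · linear_combination
      (τ 6 * τ 5 * τ 4 * τ 0 : ℚ) * (η 6 ^ 2 * η 5 ^ 2 * η 4 * η 0) * e₂
  congr 1
  · ring
  congr 1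
  · linear_combination
      -(τ 0 * τ 1 * τ 2 : ℚ) * (η 1 ^ 3 * η 3 * η 6 * η 0 ^ 2 * η 2 ^ 2) *
        ((τ 5 * τ 6) * e₁ + (τ 0 * τ 1 * τ 6) * e₂)

/-- The anticanonical height: the height over `ℚ` of the point of `ℙ⁵` with homogeneous coordinates
`anticanonical η`, i.e. `max |fᵢ| / gcd fᵢ` when the `fᵢ` are integers. -/
def height : Y3 → ℝ :=
  Quotient.lift (s := torusSetoid) (fun η => Height.mulHeight (anticanonical η.coord)) (by
    rintro η η' ⟨τ, h₁, h₂, h⟩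
    rw [anticanonical_torus _ _ τ h₁ h₂ h, Height.mulHeight_smul_eq_mulHeight _ (Units.ne_zero _)])

/-- The central point `Q = [1:1] × [1:1]`. -/
def Q : Y3 := Quotient.mk torusSetoid ⟨fun _ => 1, fun _ _ h => absurd h one_ne_zero⟩

/-- The affine chart `{y ≠ 0} ∩ {t ≠ 0}` around `Q`. -/
def chart : Set Y3 :=
  {P | ∃ η : CoxPoint, P = Quotient.mk torusSetoid η ∧
    η.coord 0 * η.coord 1 * η.coord 6 ≠ 0 ∧ η.coord 2 * η.coord 1 * η.coord 3 ≠ 0}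

/-- The coordinate `w = x / y - 1` (meaningful on `chart`). -/
def wCoord : Y3 → ℚ :=
  Quotient.lift (s := torusSetoid)
    (fun η => η.coord 4 * η.coord 3 / (η.coord 0 * η.coord 1 * η.coord 6) - 1) (by
    rintro η η' ⟨τ, h₁, -, h⟩
    have e₁ : (τ 4 : ℚ) * τ 3 = τ 0 * τ 1 * τ 6 := by exact_mod_cast congrArg Units.val h₁
    have e₂ : (τ 0 : ℚ) * τ 1 * τ 6 ≠ 0 := by simp
    simp only [h]
    rw [show (τ 4 : ℚ) * η.coord 4 * (τ 3 * η.coord 3) =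
        τ 0 * τ 1 * τ 6 * (η.coord 4 * η.coord 3) by rw [← e₁]; ring,
      show (τ 0 : ℚ) * η.coord 0 * (τ 1 * η.coord 1) * (τ 6 * η.coord 6) =
        τ 0 * τ 1 * τ 6 * (η.coord 0 * η.coord 1 * η.coord 6) by ring,
      mul_div_mul_left _ _ e₂])

/-- The coordinate `z = s / t - 1` (meaningful on `chart`). -/
def zCoord : Y3 → ℚ :=
  Quotient.lift (s := torusSetoid)
    (fun η => η.coord 5 * η.coord 6 / (η.coord 2 * η.coord 1 * η.coord 3) - 1) (by
    rintro η η' ⟨τ, -, h₁, h⟩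
    have e₁ : (τ 5 : ℚ) * τ 6 = τ 2 * τ 1 * τ 3 := by exact_mod_cast congrArg Units.val h₁
    have e₂ : (τ 2 : ℚ) * τ 1 * τ 3 ≠ 0 := by simp
    simp only [h]
    rw [show (τ 5 : ℚ) * η.coord 5 * (τ 6 * η.coord 6) =
        τ 2 * τ 1 * τ 3 * (η.coord 5 * η.coord 6) by rw [← e₁]; ring,
      show (τ 2 : ℚ) * η.coord 2 * (τ 1 * η.coord 1) * (τ 3 * η.coord 3) =
        τ 2 * τ 1 * τ 3 * (η.coord 2 * η.coord 1 * η.coord 3) by ring,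
      mul_div_mul_left _ _ e₂])

/-- The local diffeomorphism `ϱ` from the chart to the tangent plane `(T_Q Y₃)_ℝ = ℝ²`, which
carries the norm `max(|w|, |z|)`. -/
def toTangent (P : Y3) : ℝ × ℝ := ((wCoord P : ℝ), (zCoord P : ℝ))

open Classical in
/-- The archimedean distance to `Q`: `max(|w|, |z|)` near `Q`, and `1` away from `Q`. -/
def distQ (P : Y3) : ℝ := if P ∈ chart then min 1 ‖toTangent P‖ else 1

/-! ### Approximation constants -/

/-- The approximation constant `α(Q, V)`: the supremum of the `δ > 0` for which the Liouville-type
inequality `d(Q, P) ^ δ * H(P) > C > 0` holds for all `P ∈ V`, `P ≠ Q`. -/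
def approxConst (V : Set Y3) : ℝ≥0∞ :=
  ⨆ δ ∈ {δ : ℝ | 0 < δ ∧ ∃ C : ℝ, 0 < C ∧ ∀ P ∈ V, P ≠ Q → C < distQ P ^ δ * height P},
    ENNReal.ofReal δ

/-- `V` is a constructible subset of `W` which is dense in `W`, both for the topology on `W` induced
by the Zariski topology. -/
def IsDenseConstructible (V W : Set Y3) : Prop :=
  V ⊆ W ∧ Topology.IsConstructible (Subtype.val ⁻¹' V : Set W) ∧
    Dense (Subtype.val ⁻¹' V : Set W)

/-- The essential constant `α_ess(Q, W)`. -/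
def essConst (W : Set Y3) : ℝ≥0∞ :=
  ⨆ V ∈ {V : Set Y3 | IsDenseConstructible V W}, approxConst V

/-! ### Zoom measures -/

/-- The zoom measure `δ_{W,Q,B,r}` on the tangent plane: the sum of the Dirac masses at
`B ^ (1 / r) • ϱ(P)` over the rational points `P` of `W` (in the chart) with `H(P) ≤ B`. -/
def zoom (W : Set Y3) (B r : ℝ) : Measure (ℝ × ℝ) :=
  Measure.sum fun P : {P : Y3 // P ∈ W ∧ P ∈ chart ∧ height P ≤ B} =>
    Measure.dirac (B ^ (1 / r) • toTangent P.1)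

/-- `W ⊆ Y₃(ℚ)` is locally weakly accumulating (at `Q`). The last line says that
`δ_{U∖W,Q,B,α_ess(Q)}(χ(ε)) = o(δ_{V,Q,B,α_ess(Q)}(χ(ε)))` as `B → ∞`, where `χ(ε)` is the
characteristic function of the ball of radius `ε`. -/
def LocallyWeaklyAccumulating (W : Set Y3) : Prop :=
  essConst Set.univ ≠ ∞ ∧ essConst W = essConst Set.univ ∧
    ∃ U : Set Y3, IsOpen U ∧ Dense U ∧ approxConst U = essConst Set.univ ∧
      ∀ V : Set Y3, IsDenseConstructible V W → approxConst V = essConst Set.univ →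
        ∀ᶠ ε : ℝ in atTop, ∀ c : ℝ, 0 < c → ∀ᶠ B : ℝ in atTop,
          zoom (U \ W) B (essConst Set.univ).toReal (Metric.closedBall 0 ε) ≤
            ENNReal.ofReal c * zoom V B (essConst Set.univ).toReal (Metric.closedBall 0 ε)

/-- The measure `μ` has Hausdorff dimension `d`: it is nonzero, it is carried by a set of Hausdorff
dimension at most `d`, and every set of positive measure has Hausdorff dimension at least `d`. -/
def HasHausdorffDim (μ : Measure (ℝ × ℝ)) (d : ℝ≥0∞) : Prop :=
  μ ≠ 0 ∧ (∃ A, MeasurableSet A ∧ μ Aᶜ = 0 ∧ dimH A ≤ d) ∧ ∀ A, μ A ≠ 0 → d ≤ dimH A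

/-! ### Cuspidal curves and the thin set -/

/-- The coefficients of the anticanonical section
`b²(y-x)²st + a²(t-s)²xy - 2ab·yt(y-x)(t-s)` in the basis `anticanonical`. -/
def cuspCoeff (a b : ℤ) : Fin 6 → ℚ :=
  ![b ^ 2, b ^ 2 + 2 * a * b, a ^ 2 + 2 * a * b, a ^ 2, -2 * b ^ 2 - 2 * a ^ 2 - 2 * a * b,
    -2 * a * b]

/-- The rational points of the curve `R_{a,b}` on `Y₃`, the zero locus of the section
`b²(y-x)²st + a²(t-s)²xy - 2ab·yt(y-x)(t-s)`; in the chart it is the cubic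
`(az - bw)² + zw(a²z + b²w) = 0`. -/
def cuspCurve (a b : ℤ) : Set Y3 :=
  {P | ∃ η : CoxPoint, P = Quotient.mk torusSetoid η ∧
    ∑ i, cuspCoeff a b i * anticanonical η.coord i = 0}

/-- The parameters of the cuspidal curves: `a`, `b` are coprime and `R_{a,b}` is not one of the
reducible curves `R_{1,0}`, `R_{0,1}`, `R_{1,-1}`, i.e. `ab(a + b) ≠ 0`. -/
def IsCuspidal (a b : ℤ) : Prop := IsCoprime a b ∧ a ≠ 0 ∧ b ≠ 0 ∧ a + b ≠ 0

/-- The thin set `M`: the rational points other than `Q` that lie on some cuspidal curve. -/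
def M : Set Y3 := {P | P ≠ Q ∧ ∃ a b : ℤ, IsCuspidal a b ∧ P ∈ cuspCurve a b}

/-- The tangent half-line at `Q` of the real locus of `R_{a,b}`, directed towards the curve. -/
def tangentRay (a b : ℤ) : Set (ℝ × ℝ) := {v | (a : ℝ) * v.2 = b * v.1 ∧ v.1 + v.2 ≤ 0}

end ToricY3

end

/-! Near `Q` put u = x/y, v = s/t, d = max(|u - 1|, |v - 1|) and T = B^(1/5), so that the zoom
window of radius ε is H ≤ T^5, T^2 d ≤ ε.

Square condition. For a fixed point, the equation of R_{a,b} is a quadratic form in (a, b) with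
discriminant 4(u-1)²(v-1)²(1 - uv). Rational solutions exist exactly when 1 - uv = -w - z - wz is a
square (`pt_mem_M_iff`).

Exponent 5/2. A point of the torus near `Q` has primitive integral Cox coordinates with u =
mf/(aeg), v = ng/(cef) and H ≥ e³fga²c². Off u = 1, v = 1, uv = 1 the integers k₁ = mf - aeg, k₂ =
ng - cef, D = ace² - mn are nonzero, of sizes at most aeg·d, cef·d, 3ace²·d. The monomials fit
together so that d^5 H² is bounded below (`liouville_sq`).

Upper bounds. In the window the same inequality is almost an equality. So a, c, k₁, k₂, D are
bounded and e, m have the order of T; these seven integers determine the point. With N = ac one has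
m ∣ Ne² - D, so the count reduces to the average number of roots of Ne² ≡ D modulo m. Up to the
primes dividing 2ND this number is at most the divisor sum of the character (ND/·). The sum up to X
is O(X log X), and O(X) if ND is not a square, because then the character has bounded partial sums.
Since ND = (Ne)²(1 - uv), points off `M` are the nonsquare case: O(T) points outside `M`, O(T log T)
in `M`.

Lower bound. Taking a = c = 1, k₁ = k₂ = -1, D = 1 gives points of `M` for every factorization mn =
e² - 1, and explicit factorizations supply at least a constant times T log T of them. A fixed curve
contains boundedly many for each large e, hence O(T) in all (`exists_lower_bound`). A dense
constructible subset of `M` contains `M` minus a curve, so it keeps the order T log T. This yields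
the order of magnitude, the value 5/2 of the essential constants, and weak accumulation.

One cuspidal curve. Lines through the cusp parametrize R_{a,b} by [p : q], with sections of degree
5. In unimodular coordinates with k = ap - bq, the points in the window have bounded k and l = O(T),
and the gcd of the sections is periodic in l. For each k and each residue class of l the zoom
measure is therefore a Riemann sum in ξ = l/(|k|T). The limit is a sum of pushforwards of Lebesgue
measure to the tangent half-line (`tendsto_zoom_cuspCurve`), and the comparison with `M` holds
because all rational points of the curve except `Q` lie in `M`. -/

namespace ToricY3

/-! ### The affine chart around `Q` -/

/-- The point of the chart with `x / y = u` and `s / t = v`. -/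
def pt (u v : ℚ) : Y3 :=
  Quotient.mk torusSetoid ⟨![1, 1, 1, 1, u, v, 1], by
    intro i j; fin_cases i <;> fin_cases j <;> simp⟩

/-- On the chart the coordinates 0, 1, 2, 3, 6 are nonzero and can all be scaled to 1; the two torus
relations then fix the scaling of the coordinates 4 and 5, which become the quotients x/y and s/t.
-/
theorem mk_eq_pt (η : CoxPoint) (h₁ : η.coord 0 * η.coord 1 * η.coord 6 ≠ 0)
    (h₂ : η.coord 2 * η.coord 1 * η.coord 3 ≠ 0) :
    Quotient.mk torusSetoid η =
      pt (η.coord 4 * η.coord 3 / (η.coord 0 * η.coord 1 * η.coord 6))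
        (η.coord 5 * η.coord 6 / (η.coord 2 * η.coord 1 * η.coord 3)) := by
  have n0 : η.coord 0 ≠ 0 := fun h => h₁ (by simp [h])
  have n1 : η.coord 1 ≠ 0 := fun h => h₁ (by simp [h])
  have n6 : η.coord 6 ≠ 0 := fun h => h₁ (by simp [h])
  have n2 : η.coord 2 ≠ 0 := fun h => h₂ (by simp [h])
  have n3 : η.coord 3 ≠ 0 := fun h => h₂ (by simp [h])
  symm
  apply Quotient.sound
  refine ⟨![Units.mk0 _ n0, Units.mk0 _ n1, Units.mk0 _ n2, Units.mk0 _ n3,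
    Units.mk0 (η.coord 0 * η.coord 1 * η.coord 6 / η.coord 3) (div_ne_zero h₁ n3),
    Units.mk0 (η.coord 2 * η.coord 1 * η.coord 3 / η.coord 6) (div_ne_zero h₂ n6),
    Units.mk0 _ n6], ?_, ?_, ?_⟩
  · ext; simp [n3]
  · ext; simp [n6]
  · intro i
    fin_cases i <;> simp <;> field_simp

theorem mem_chart_iff (P : Y3) : P ∈ chart ↔ ∃ u v : ℚ, P = pt u v := by
  constructor
  · rintro ⟨η, rfl, h₁, h₂⟩
    exact ⟨_, _, mk_eq_pt η h₁ h₂⟩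
  · rintro ⟨u, v, rfl⟩
    exact ⟨_, rfl, by simp, by simp⟩

theorem pt_mem_chart (u v : ℚ) : pt u v ∈ chart := (mem_chart_iff _).2 ⟨u, v, rfl⟩

@[simp] theorem wCoord_pt (u v : ℚ) : wCoord (pt u v) = u - 1 := by
  simp [wCoord, pt]

@[simp] theorem zCoord_pt (u v : ℚ) : zCoord (pt u v) = v - 1 := by
  simp [zCoord, pt]

theorem pt_inj {u v u' v' : ℚ} : pt u v = pt u' v' ↔ u = u' ∧ v = v' := by
  constructor
  · intro h
    have h₁ := congrArg wCoord h
    have h₂ := congrArg zCoord h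
    simp only [wCoord_pt, zCoord_pt, sub_left_inj] at h₁ h₂
    exact ⟨h₁, h₂⟩
  · rintro ⟨rfl, rfl⟩; rfl

theorem Q_eq_pt : Q = pt 1 1 := by
  unfold Q pt
  congr 2
  ext i; fin_cases i <;> rfl

theorem toTangent_pt (u v : ℚ) : toTangent (pt u v) = ((u : ℝ) - 1, (v : ℝ) - 1) := by
  simp [toTangent]

theorem norm_toTangent_pt (u v : ℚ) :
    ‖toTangent (pt u v)‖ = max |(u : ℝ) - 1| |(v : ℝ) - 1| := by
  simp [toTangent_pt, Prod.norm_def]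

theorem distQ_pt (u v : ℚ) :
    distQ (pt u v) = min 1 (max |(u : ℝ) - 1| |(v : ℝ) - 1|) := by
  rw [distQ, if_pos (pt_mem_chart u v), norm_toTangent_pt]

/-- The anticanonical sections on the chart. -/
def chartSections (u v : ℚ) : Fin 6 → ℚ := ![u ^ 2 * v, v, u, v ^ 2 * u, u * v, 1]

theorem height_pt (u v : ℚ) : height (pt u v) = Height.mulHeight (chartSections u v) := by
  change Height.mulHeight _ = _
  congr 1
  ext i; fin_cases i <;> simp [anticanonical, chartSections]

theorem one_le_height (P : Y3) : 1 ≤ height P := by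
  induction P using Quotient.inductionOn with
  | _ η => exact Height.one_le_mulHeight _

/-! ### Heights of integral vectors -/

section IntegralHeight

variable {ι : Type*} [Fintype ι] [Nonempty ι]

theorem exists_primitive (x : ι → ℤ) (hx : x ≠ 0) :
    ∃ x' : ι → ℤ, Finset.univ.gcd x' = 1 ∧ 0 < Finset.univ.gcd x ∧
      ∀ i, x i = Finset.univ.gcd x * x' i := by
  have h0 : Finset.univ.gcd x ≠ 0 := by
    intro h
    rw [Finset.gcd_eq_zero_iff] at h
    exact hx (funext fun i => h i (Finset.mem_univ i))
  have hpos : 0 < Finset.univ.gcd x := by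
    have : 0 ≤ Finset.univ.gcd x := by
      rw [← Finset.normalize_gcd]; exact Int.nonneg_of_normalize_eq_self (by simp)
    omega
  obtain ⟨x', h1, h2⟩ := Finset.extract_gcd x (Finset.univ_nonempty)
  exact ⟨x', h2, hpos, fun i => h1 i (Finset.mem_univ i)⟩

/-- With `mulHeight_mul_gcd_le` this says that height times gcd is the maximum of the absolute
values. Two inequalities suffice for all uses and avoid carrying a supremum. -/
theorem abs_le_mulHeight_mul_gcd (x : ι → ℤ) (i : ι) :
    |(x i : ℝ)| ≤ Height.mulHeight (fun i => (x i : ℚ)) * (Finset.univ.gcd x : ℤ) := by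
  rcases eq_or_ne x 0 with rfl | hx
  · have : Finset.univ.gcd (0 : ι → ℤ) = 0 := Finset.gcd_eq_zero_iff.2 (by simp)
    simp [this]
  obtain ⟨x', h1, hpos, h2⟩ := exists_primitive x hx
  set g := Finset.univ.gcd x
  have e : (fun i => (x i : ℚ)) = (g : ℚ) • (((↑) : ℤ → ℚ) ∘ x') := by
    ext i; simp [h2 i]
  have hg : (g : ℚ) ≠ 0 := by exact_mod_cast hpos.ne'
  have hg' : (0 : ℝ) < g := by exact_mod_cast hpos
  rw [e, Height.mulHeight_smul_eq_mulHeight _ hg, Rat.mulHeight_eq_max_abs_of_gcd_eq_one h1, h2 i]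
  push_cast
  rw [abs_mul, abs_of_pos hg', mul_comm]
  gcongr
  have : |x' i| ≤ ⨆ j, |x' j| := Finite.le_ciSup_of_le i le_rfl
  exact_mod_cast this

theorem mulHeight_mul_gcd_le (x : ι → ℤ) (hx : x ≠ 0) (N : ℝ) (h : ∀ i, |(x i : ℝ)| ≤ N) :
    Height.mulHeight (fun i => (x i : ℚ)) * (Finset.univ.gcd x : ℤ) ≤ N := by
  obtain ⟨x', h1, hpos, h2⟩ := exists_primitive x hx
  set g := Finset.univ.gcd x
  have e : (fun i => (x i : ℚ)) = (g : ℚ) • (((↑) : ℤ → ℚ) ∘ x') := by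
    ext i; simp [h2 i]
  have hg : (g : ℚ) ≠ 0 := by exact_mod_cast hpos.ne'
  have hg' : (0 : ℝ) < g := by exact_mod_cast hpos
  rw [e, Height.mulHeight_smul_eq_mulHeight _ hg, Rat.mulHeight_eq_max_abs_of_gcd_eq_one h1]
  obtain ⟨i, hi⟩ := exists_eq_ciSup_of_finite (f := fun i ↦ |x' i|)
  rw [← hi]
  refine le_trans (le_of_eq ?_) (h i)
  rw [h2 i]
  push_cast
  rw [abs_mul, abs_of_pos hg', mul_comm]

theorem mulHeight_le_of_abs_le (x : ι → ℤ) (hx : x ≠ 0) (N : ℝ) (h : ∀ i, |(x i : ℝ)| ≤ N) :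
    Height.mulHeight (fun i => (x i : ℚ)) ≤ N := by
  obtain ⟨x', h1, hpos, h2⟩ := exists_primitive x hx
  refine le_trans ?_ (mulHeight_mul_gcd_le x hx N h)
  have : (1 : ℝ) ≤ (Finset.univ.gcd x : ℤ) := by exact_mod_cast hpos
  exact le_mul_of_one_le_right (Height.mulHeight_pos _).le this

end IntegralHeight

/-- The height of a point of the chart, from an integral vector proportional to its sections. -/
theorem height_pt_of_smul {u v c : ℚ} (hc : c ≠ 0) (x : Fin 6 → ℤ)
    (h : ∀ i, (x i : ℚ) = c * chartSections u v i) :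
    height (pt u v) = Height.mulHeight (fun i => (x i : ℚ)) := by
  rw [height_pt, ← Height.mulHeight_smul_eq_mulHeight _ hc]
  congr 1
  ext i; simp [h i]

/-! ### The cuspidal curves in the chart -/

theorem pt_mem_cuspCurve (a b : ℤ) (u v : ℚ) :
    pt u v ∈ cuspCurve a b ↔
      a ^ 2 * (v - 1) ^ 2 * u + b ^ 2 * (u - 1) ^ 2 * v - 2 * a * b * (u - 1) * (v - 1) = (0 : ℚ) := by
  have key : ∑ i, cuspCoeff a b i * anticanonical ![1, 1, 1, 1, u, v, 1] i =
      a ^ 2 * (v - 1) ^ 2 * u + b ^ 2 * (u - 1) ^ 2 * v - 2 * a * b * (u - 1) * (v - 1) := by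
    simp [Fin.sum_univ_six, cuspCoeff, anticanonical]
    ring
  constructor
  · rintro ⟨η, h, h0⟩
    obtain ⟨τ, h₁, h₂, h₃⟩ := Quotient.exact h
    rw [← key]
    -- The equation may hold for other homogeneous coordinates of the same point; all sections then
    -- change by one common unit.
    have e := anticanonical_torus _ _ τ h₁ h₂ h₃
    rw [e] at h0
    simp only [Pi.smul_apply, smul_eq_mul] at h0
    have : ∀ i, cuspCoeff a b i *
        (((τ 0 * τ 1 * τ 2 * τ 3 * τ 4 * τ 5 * τ 6 : ℚˣ) : ℚ) *
          anticanonical ![1, 1, 1, 1, u, v, 1] i) =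
        ((τ 0 * τ 1 * τ 2 * τ 3 * τ 4 * τ 5 * τ 6 : ℚˣ) : ℚ) *
          (cuspCoeff a b i * anticanonical ![1, 1, 1, 1, u, v, 1] i) := fun i => by ring
    simp_rw [this] at h0
    rw [← Finset.mul_sum] at h0
    exact (mul_eq_zero.1 h0).resolve_left (Units.ne_zero _)
  · intro h
    exact ⟨_, rfl, key.trans h⟩

/-- For fixed u, v the curve equation is quadratic in a/b, with roots (u-1)(1 ± q)/((v-1)u) where q²
= 1 - uv. The double root, at q = 0, is a/b = -1, which `IsCuspidal` excludes; hence q ≠ 0. -/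
theorem pt_mem_M_iff {u v : ℚ} (hu : u ≠ 0) (hv : v ≠ 0) (hu1 : u ≠ 1) (hv1 : v ≠ 1) :
    pt u v ∈ M ↔ ∃ q : ℚ, q ≠ 0 ∧ 1 - u * v = q ^ 2 := by
  have hu1' : u - 1 ≠ 0 := sub_ne_zero.2 hu1
  have hv1' : v - 1 ≠ 0 := sub_ne_zero.2 hv1
  constructor
  · rintro ⟨-, a, b, ⟨-, ha, hb, hab⟩, hP⟩
    rw [pt_mem_cuspCurve] at hP
    have ha' : (a : ℚ) ≠ 0 := by exact_mod_cast ha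
    have hb' : (b : ℚ) ≠ 0 := by exact_mod_cast hb
    have hab' : (a : ℚ) + b ≠ 0 := by exact_mod_cast hab
    refine ⟨(a * (v - 1) * u - b * (u - 1)) / (b * (u - 1)), ?_, ?_⟩
    · intro h0
      have h1 : a * (v - 1) * u - b * (u - 1) = 0 := by
        rcases div_eq_zero_iff.1 h0 with h | h
        · exact h
        · exact absurd h (mul_ne_zero hb' hu1')
      have h2 : b ^ 2 * (u - 1) ^ 2 * (1 - u * v) = 0 := by
        linear_combination (-u) * hP + (a * (v - 1) * u - b * (u - 1)) * h1
      have h3 : 1 - u * v = 0 := by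
        simpa [hb', hu1'] using h2
      have h4 : (a + b) * (1 - u) = 0 := by linear_combination h1 + a * h3
      rcases mul_eq_zero.1 h4 with h | h
      · exact hab' h
      · exact hu1' (by linarith)
    · rw [div_pow, eq_div_iff (pow_ne_zero 2 (mul_ne_zero hb' hu1'))]
      linear_combination (-u) * hP
  · rintro ⟨q, hq, h⟩
    -- The root formed with q equals the excluded value -1 only if q = 0 or q = u - 1. Since q ≠ 0,
    -- one of the two signs avoids this.
    obtain ⟨q, hq, h, hqw⟩ : ∃ q : ℚ, q ≠ 0 ∧ 1 - u * v = q ^ 2 ∧ q ≠ u - 1 := by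
      by_cases h' : q = u - 1
      · refine ⟨-q, neg_ne_zero.2 hq, by rw [h]; ring, fun h2 => hq ?_⟩
        linarith
      · exact ⟨q, hq, h, h'⟩
    -- `a / b = (u - 1) (1 + q) / ((v - 1) u)`
    set r : ℚ := (u - 1) * (1 + q) / ((v - 1) * u) with hr
    have hq1 : 1 + q ≠ 0 := by
      intro h1
      have : u * v = 0 := by linear_combination -h + (1 - q) * h1
      exact mul_ne_zero hu hv this
    have hr0 : r ≠ 0 := div_ne_zero (mul_ne_zero hu1' hq1) (mul_ne_zero hv1' hu)
    have hr1 : r * ((v - 1) * u) = (u - 1) * (1 + q) :=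
      div_mul_cancel₀ _ (mul_ne_zero hv1' hu)
    have hrd : (r.num : ℚ) = r * r.den := (Rat.mul_den_eq_num r).symm
    have hd : (r.den : ℚ) ≠ 0 := by exact_mod_cast r.den_nz
    refine ⟨fun hQ => ?_, r.num, r.den, ⟨Rat.isCoprime_num_den r, by simpa using hr0, ?_, ?_⟩, ?_⟩
    · rw [Q_eq_pt, pt_inj] at hQ
      exact hu1 hQ.1
    · exact_mod_cast r.den_nz
    · intro h0
      have h0' : (r.num : ℚ) + r.den = 0 := by exact_mod_cast h0
      rw [hrd] at h0'
      have h1 : (r + 1) * r.den = 0 := by linear_combination h0'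
      have h2 : r = -1 := by
        rcases mul_eq_zero.1 h1 with h | h
        · linarith
        · exact absurd h hd
      rw [h2] at hr1
      have : q * (u - 1 - q) = 0 := by linear_combination -hr1 + h
      rcases mul_eq_zero.1 this with h | h
      · exact hq h
      · exact hqw (by linarith)
    · rw [pt_mem_cuspCurve]
      push_cast
      rw [hrd]
      have h3 : u * (r ^ 2 * (v - 1) ^ 2 * u + (u - 1) ^ 2 * v - 2 * r * (u - 1) * (v - 1)) = 0 := by
        linear_combination (r * ((v - 1) * u) + (u - 1) * (1 + q) - 2 * (u - 1)) * hr1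
          - (u - 1) ^ 2 * h
      have h4 := (mul_eq_zero.1 h3).resolve_left hu
      linear_combination (r.den : ℚ) ^ 2 * h4

/-! ### Integral homogeneous coordinates -/

/-- The arithmetic form of base-point freeness: a prime dividing all the monomials would have to
divide two coordinates that the coprimality conditions separate. Once divisibility of products is
split up, this is propositional. -/
theorem cox_primitive {a c e f g m n : ℕ} (h₁ : (m * f).Coprime (a * e * g))
    (h₂ : (n * g).Coprime (c * e * f)) (hac : a.Coprime c) (han : a.Coprime n)
    (hmc : m.Coprime c) :
    Finset.univ.gcd (![f ^ 2 * m ^ 2 * n * c, e ^ 2 * g ^ 2 * a ^ 2 * n * c,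
      e ^ 2 * f ^ 2 * c ^ 2 * m * a, g ^ 2 * n ^ 2 * m * a, a * e * c * f * m * n * g,
      e ^ 3 * f * g * a ^ 2 * c ^ 2] : Fin 6 → ℤ) = 1 := by
  obtain ⟨x, hx⟩ : ∃ x : Fin 6 → ℤ, x = (![f ^ 2 * m ^ 2 * n * c, e ^ 2 * g ^ 2 * a ^ 2 * n * c,
      e ^ 2 * f ^ 2 * c ^ 2 * m * a, g ^ 2 * n ^ 2 * m * a, a * e * c * f * m * n * g,
      e ^ 3 * f * g * a ^ 2 * c ^ 2] : Fin 6 → ℤ) := ⟨_, rfl⟩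
  rw [← hx]
  by_contra hne
  have hnn : 0 ≤ Finset.univ.gcd x := by
    rw [← Finset.normalize_gcd]; exact Int.nonneg_of_normalize_eq_self (by simp)
  have hne' : (Finset.univ.gcd x).natAbs ≠ 1 := fun h => hne (by omega)
  obtain ⟨p, hp, hpd⟩ := Nat.exists_prime_and_dvd hne'
  have hall : ∀ i, (p : ℤ) ∣ x i := fun i =>
    (Int.natCast_dvd.2 hpd).trans (Finset.gcd_dvd (Finset.mem_univ i))
  have t1 : (p : ℤ) ∣ f ^ 2 * m ^ 2 * n * c := by have h := hall 0; rwa [hx] at h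
  have t2 : (p : ℤ) ∣ e ^ 2 * g ^ 2 * a ^ 2 * n * c := by have h := hall 1; rwa [hx] at h
  have t3 : (p : ℤ) ∣ e ^ 2 * f ^ 2 * c ^ 2 * m * a := by have h := hall 2; rwa [hx] at h
  have t4 : (p : ℤ) ∣ g ^ 2 * n ^ 2 * m * a := by have h := hall 3; rwa [hx] at h
  have t6 : (p : ℤ) ∣ e ^ 3 * f * g * a ^ 2 * c ^ 2 := by have h := hall 5; rwa [hx] at h
  clear hall hpd hnn hne' hne hx
  norm_cast at t1 t2 t3 t4 t6
  have N {i j : ℕ} (h : i.Coprime j) : ¬ (p ∣ i ∧ p ∣ j) := fun ⟨hi, hj⟩ =>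
    hp.one_lt.ne' (Nat.eq_one_of_dvd_coprimes h hi hj)
  have n1 := N h₁
  have n2 := N h₂
  have n3 := N hac
  have n4 := N han
  have n5 := N hmc
  clear N h₁ h₂ hac han hmc
  simp only [hp.dvd_mul, hp.prime.dvd_pow_iff_dvd (two_ne_zero),
    hp.prime.dvd_pow_iff_dvd (three_ne_zero)] at t1 t2 t3 t4 t6 n1 n2
  grind

/-- With u = x/y and v = s/t in lowest terms, the coordinates of the exceptional curves are e =
gcd(y, t), f = gcd(x, t), g = gcd(y, s), and x = mf, y = aeg, s = ng, t = cef. The six sections are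
then primitive integers, so each of them bounds the height from below; the one kept is y²t²/(efg).
-/
theorem exists_cox {u v : ℚ} (hu : 0 < u) (hv : 0 < v) :
    ∃ a c e f g m n : ℕ, 0 < a ∧ 0 < c ∧ 0 < e ∧ 0 < f ∧ 0 < g ∧ 0 < m ∧ 0 < n ∧
      u * (a * e * g) = m * f ∧ v * (c * e * f) = n * g ∧
      ((e ^ 3 * f * g * a ^ 2 * c ^ 2 : ℕ) : ℝ) ≤ height (pt u v) := by
  obtain ⟨x, hx⟩ : ∃ x : ℕ, u.num = x := Int.eq_ofNat_of_zero_le (Rat.num_nonneg.2 hu.le)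
  obtain ⟨s, hs⟩ : ∃ s : ℕ, v.num = s := Int.eq_ofNat_of_zero_le (Rat.num_nonneg.2 hv.le)
  obtain ⟨y, hy⟩ : ∃ y : ℕ, u.den = y := ⟨_, rfl⟩
  obtain ⟨t, ht⟩ : ∃ t : ℕ, v.den = t := ⟨_, rfl⟩
  have hxy : x.Coprime y := by have := u.reduced; rwa [hx, hy] at this
  have hst : s.Coprime t := by have := v.reduced; rwa [hs, ht] at this
  have hy0 : 0 < y := hy ▸ u.den_pos
  have ht0 : 0 < t := ht ▸ v.den_pos
  have hx0 : 0 < x := by have := Rat.num_pos.2 hu; omega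
  have hs0 : 0 < s := by have := Rat.num_pos.2 hv; omega
  have huxy : u * y = x := by
    have := Rat.mul_den_eq_num u; rw [hx, hy] at this; exact_mod_cast this
  have hvst : v * t = s := by
    have := Rat.mul_den_eq_num v; rw [hs, ht] at this; exact_mod_cast this
  have he0 : 0 < y.gcd t := Nat.gcd_pos_of_pos_left _ hy0
  have hf0 : 0 < x.gcd t := Nat.gcd_pos_of_pos_left _ hx0
  have hg0 : 0 < y.gcd s := Nat.gcd_pos_of_pos_left _ hy0
  have heg : (y.gcd t).Coprime (y.gcd s) :=
    Nat.Coprime.coprime_dvd_left (Nat.gcd_dvd_right y t)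
      (Nat.Coprime.coprime_dvd_right (Nat.gcd_dvd_right y s) hst.symm)
  have hef : (y.gcd t).Coprime (x.gcd t) :=
    Nat.Coprime.coprime_dvd_left (Nat.gcd_dvd_left y t)
      (Nat.Coprime.coprime_dvd_right (Nat.gcd_dvd_left x t) hxy.symm)
  obtain ⟨a, ha⟩ := heg.mul_dvd_of_dvd_of_dvd (Nat.gcd_dvd_left y t) (Nat.gcd_dvd_left y s)
  obtain ⟨c, hc⟩ := hef.mul_dvd_of_dvd_of_dvd (Nat.gcd_dvd_right y t) (Nat.gcd_dvd_right x t)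
  obtain ⟨m, hm⟩ := Nat.gcd_dvd_left x t
  obtain ⟨n, hn⟩ := Nat.gcd_dvd_right y s
  obtain ⟨e, he⟩ : ∃ e, y.gcd t = e := ⟨_, rfl⟩
  obtain ⟨f, hf⟩ : ∃ f, x.gcd t = f := ⟨_, rfl⟩
  obtain ⟨g, hg⟩ : ∃ g, y.gcd s = g := ⟨_, rfl⟩
  have ce := he
  have cf := hf
  have cg := hg
  rw [he] at ha hc he0
  rw [hf] at hc hf0 hm
  rw [hg] at ha hg0 hn
  have ha0 : 0 < a := Nat.pos_of_ne_zero (by rintro rfl; simp at ha; omega)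
  have hc0 : 0 < c := Nat.pos_of_ne_zero (by rintro rfl; simp at hc; omega)
  have hm0 : 0 < m := Nat.pos_of_ne_zero (by rintro rfl; simp at hm; omega)
  have hn0 : 0 < n := Nat.pos_of_ne_zero (by rintro rfl; simp at hn; omega)
  have q1 : (m * f).Coprime (a * e * g) := by
    rw [show m * f = x by rw [hm]; ring, show a * e * g = y by rw [ha]; ring]; exact hxy
  have q2 : (n * g).Coprime (c * e * f) := by
    rw [show n * g = s by rw [hn]; ring, show c * e * f = t by rw [hc]; ring]; exact hst
  have q3 : a.Coprime c := by
    have h : (e * (a * g)).gcd (e * (c * f)) = e := by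
      rw [show e * (a * g) = y by rw [ha]; ring, show e * (c * f) = t by rw [hc]; ring, ce]
    rw [Nat.gcd_mul_left] at h
    have h' : (a * g).Coprime (c * f) := Nat.eq_of_mul_eq_mul_left he0 (by rw [h, mul_one])
    exact (Nat.Coprime.coprime_mul_right h').coprime_mul_right_right
  have q4 : a.Coprime n := by
    have h : (g * (a * e)).gcd (g * n) = g := by
      rw [show g * (a * e) = y by rw [ha]; ring, ← hn, cg]
    rw [Nat.gcd_mul_left] at h
    have h' : (a * e).Coprime n := Nat.eq_of_mul_eq_mul_left hg0 (by rw [h, mul_one])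
    exact Nat.Coprime.coprime_mul_right h'
  have q5 : m.Coprime c := by
    have h : (f * m).gcd (f * (c * e)) = f := by
      rw [← hm, show f * (c * e) = t by rw [hc]; ring, cf]
    rw [Nat.gcd_mul_left] at h
    have h' : m.Coprime (c * e) := Nat.eq_of_mul_eq_mul_left hf0 (by rw [h, mul_one])
    exact Nat.Coprime.coprime_mul_right_right h'
  have hprim := cox_primitive q1 q2 q3 q4 q5
  set X : Fin 6 → ℤ := ![f ^ 2 * m ^ 2 * n * c, e ^ 2 * g ^ 2 * a ^ 2 * n * c,
      e ^ 2 * f ^ 2 * c ^ 2 * m * a, g ^ 2 * n ^ 2 * m * a, a * e * c * f * m * n * g,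
      e ^ 3 * f * g * a ^ 2 * c ^ 2] with hX
  have E1 : u * (a * e * g) = m * f := by
    rw [ha, hm] at huxy; push_cast at huxy; linear_combination huxy
  have E2 : v * (c * e * f) = n * g := by
    rw [hc, hn] at hvst; push_cast at hvst; linear_combination hvst
  refine ⟨a, c, e, f, g, m, n, ha0, hc0, he0, hf0, hg0, hm0, hn0, E1, E2, ?_⟩
  have hfQ : (f : ℚ) ≠ 0 := by exact_mod_cast hf0.ne'
  have hgQ : (g : ℚ) ≠ 0 := by exact_mod_cast hg0.ne'
  have haQ : (a : ℚ) ≠ 0 := by exact_mod_cast ha0.ne'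
  have hcQ : (c : ℚ) ≠ 0 := by exact_mod_cast hc0.ne'
  have heQ : (e : ℚ) ≠ 0 := by exact_mod_cast he0.ne'
  have hu' : u = m * f / (a * e * g) := by rw [eq_div_iff (by positivity)]; exact E1
  have hv' : v = n * g / (c * e * f) := by rw [eq_div_iff (by positivity)]; exact E2
  rw [height_pt_of_smul (c := (e ^ 3 * f * g * a ^ 2 * c ^ 2 : ℚ)) (by positivity) X]
  · have := abs_le_mulHeight_mul_gcd X 5
    rw [hprim, Int.cast_one, mul_one] at this
    refine le_trans (le_of_eq ?_) this
    rw [abs_of_nonneg]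
    · simp [hX]
    · simp only [hX, Matrix.cons_val]; positivity
  · intro i
    rw [hu', hv']
    fin_cases i <;> simp [hX, chartSections] <;> field_simp

/-! ### Distance to `Q`, the exponent 5/2, and bounded invariants in the zoom window -/

/-- The points of the torus near `Q` off the curves `u = 1`, `v = 1`, `u v = 1`, with the bounds for
the three nonzero integers measuring their distance to these curves. -/
theorem exists_cox_near {u v : ℚ} (hu : u ≠ 1) (hv : v ≠ 1) (huv : u * v ≠ 1)
    {d : ℝ} (hd : d = max |(u : ℝ) - 1| |(v : ℝ) - 1|) (hd1 : d < 1) :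
    ∃ (a c e f g m n : ℕ) (k₁ k₂ D : ℤ),
      (1 ≤ a ∧ 1 ≤ c ∧ 1 ≤ e ∧ 1 ≤ f ∧ 1 ≤ g ∧ 1 ≤ m ∧ 1 ≤ n) ∧
      u * (a * e * g) = m * f ∧ v * (c * e * f) = n * g ∧
      ((e : ℝ) ^ 3 * f * g * a ^ 2 * c ^ 2 ≤ height (pt u v)) ∧
      (m * f : ℤ) = a * e * g + k₁ ∧ (n * g : ℤ) = c * e * f + k₂ ∧
      (m * n : ℤ) = a * c * e ^ 2 - D ∧
      (D : ℚ) = a * c * e ^ 2 * (1 - u * v) ∧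
      (1 ≤ |(k₁ : ℝ)| ∧ |(k₁ : ℝ)| ≤ a * e * g * d) ∧
      (1 ≤ |(k₂ : ℝ)| ∧ |(k₂ : ℝ)| ≤ c * e * f * d) ∧
      (1 ≤ |(D : ℝ)| ∧ |(D : ℝ)| ≤ 3 * (a * c * e ^ 2) * d) := by
  have hw : |(u : ℝ) - 1| ≤ d := hd ▸ le_max_left _ _
  have hz : |(v : ℝ) - 1| ≤ d := hd ▸ le_max_right _ _
  have hu0 : 0 < u := by
    have : (0 : ℝ) < u := by have := (abs_le.1 hw).1; linarith
    exact_mod_cast this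
  have hv0 : 0 < v := by
    have : (0 : ℝ) < v := by have := (abs_le.1 hz).1; linarith
    exact_mod_cast this
  obtain ⟨a, c, e, f, g, m, n, ha, hc, he, hf, hg, hm, hn, E1, E2, hH⟩ := exists_cox hu0 hv0
  have haR : (0 : ℝ) < a := by exact_mod_cast ha
  have hcR : (0 : ℝ) < c := by exact_mod_cast hc
  have heR : (0 : ℝ) < e := by exact_mod_cast he
  have hfR : (0 : ℝ) < f := by exact_mod_cast hf
  have hgR : (0 : ℝ) < g := by exact_mod_cast hg
  have E1R : (u : ℝ) * (a * e * g) = m * f := by exact_mod_cast E1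
  have E2R : (v : ℝ) * (c * e * f) = n * g := by exact_mod_cast E2
  have E3 : (m * n : ℚ) = a * c * e ^ 2 * (u * v) := by
    have hfQ : (f : ℚ) ≠ 0 := by exact_mod_cast hf.ne'
    have hgQ : (g : ℚ) ≠ 0 := by exact_mod_cast hg.ne'
    have : (f * g : ℚ) * (m * n) = (f * g) * (a * c * e ^ 2 * (u * v)) := by
      linear_combination (-(n * g : ℚ)) * E1 - (u * (a * e * g)) * E2
    exact mul_left_cancel₀ (mul_ne_zero hfQ hgQ) this
  have E3R : (m * n : ℝ) = a * c * e ^ 2 * (u * v) := by exact_mod_cast E3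
  have one_le {k : ℤ} (hk : k ≠ 0) : 1 ≤ |(k : ℝ)| := by exact_mod_cast Int.one_le_abs hk
  refine ⟨a, c, e, f, g, m, n, m * f - a * e * g, n * g - c * e * f, a * c * e ^ 2 - m * n,
    ⟨ha, hc, he, hf, hg, hm, hn⟩, E1, E2, by push_cast at hH; exact hH, by ring, by ring, by ring,
    ?_, ⟨one_le ?_, ?_⟩, ⟨one_le ?_, ?_⟩, ⟨one_le ?_, ?_⟩⟩
  · push_cast; linear_combination -E3
  · intro h
    have h' : (m * f : ℚ) = a * e * g := by
      have : (m * f : ℤ) = a * e * g := by linarith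
      exact_mod_cast this
    have hne : (a * e * g : ℚ) ≠ 0 := by positivity
    exact hu (mul_right_cancel₀ hne (by rw [E1, h', one_mul]))
  · push_cast
    rw [← E1R, show (u : ℝ) * (a * e * g) - a * e * g = a * e * g * (u - 1) by ring, abs_mul,
      abs_of_pos (by positivity)]
    gcongr
  · intro h
    have h' : (n * g : ℚ) = c * e * f := by
      have : (n * g : ℤ) = c * e * f := by linarith
      exact_mod_cast this
    have hne : (c * e * f : ℚ) ≠ 0 := by positivity
    exact hv (mul_right_cancel₀ hne (by rw [E2, h', one_mul]))
  · push_cast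
    rw [← E2R, show (v : ℝ) * (c * e * f) - c * e * f = c * e * f * (v - 1) by ring, abs_mul,
      abs_of_pos (by positivity)]
    gcongr
  · intro h
    have h' : (m * n : ℚ) = a * c * e ^ 2 := by
      have : (m * n : ℤ) = a * c * e ^ 2 := by linarith
      exact_mod_cast this
    have hne : (a * c * e ^ 2 : ℚ) ≠ 0 := by positivity
    exact huv (mul_left_cancel₀ hne (by rw [← E3, h', mul_one]))
  · push_cast
    rw [E3R, show (a * c * e ^ 2 : ℝ) - a * c * e ^ 2 * (u * v) =
      a * c * e ^ 2 * (1 - u * v) by ring, abs_mul, abs_of_pos (by positivity),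
      mul_comm 3, mul_assoc (a * c * e ^ 2 : ℝ)]
    gcongr
    -- Each of the three terms is at most d, the product because d < 1; this is the constant 3.
    rw [show (1 : ℝ) - u * v = -((u - 1) + (v - 1) + (u - 1) * (v - 1)) by ring, abs_neg]
    have hd0 : 0 ≤ d := (abs_nonneg _).trans hw
    calc |((u : ℝ) - 1) + (v - 1) + (u - 1) * (v - 1)|
        ≤ |(u : ℝ) - 1| + |(v : ℝ) - 1| + |((u : ℝ) - 1) * (v - 1)| := abs_add_three _ _ _
      _ ≤ d + d + d * 1 := by
          rw [abs_mul]
          gcongr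
          exact hz.trans hd1.le
      _ = 3 * d := by ring

/-- The dense open subset of the torus on which the Liouville inequality has exponent `5 / 2`. -/
theorem liouville_sq {u v : ℚ} (hu : u ≠ 1) (hv : v ≠ 1) (huv : u * v ≠ 1)
    {d : ℝ} (hd : d = max |(u : ℝ) - 1| |(v : ℝ) - 1|) (hd1 : d < 1) :
    1 / 3 ≤ d ^ 5 * height (pt u v) ^ 2 := by
  obtain ⟨a, c, e, f, g, m, n, k₁, k₂, D, ⟨ha, hc, he, hf, hg, hm, hn⟩, -, -, hH, -, -, -, -,
    h1, h2, h3⟩ := exists_cox_near hu hv huv hd hd1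
  have haR : (1 : ℝ) ≤ a := by exact_mod_cast ha
  have hcR : (1 : ℝ) ≤ c := by exact_mod_cast hc
  have i1 := h1.1.trans h1.2
  have i2 := h2.1.trans h2.2
  have i3 := h3.1.trans h3.2
  have hd0 : 0 ≤ d := hd ▸ (abs_nonneg _).trans (le_max_left _ _)
  -- The exponent 5/2 comes from this identity: d^5 times the squared monomial is a product of the
  -- bounds for k₁², k₂², D (up to the factor 3) and of ac. These are bounds for nonzero integers.
  calc d ^ 5 * height (pt u v) ^ 2 ≥ d ^ 5 * ((e : ℝ) ^ 3 * f * g * a ^ 2 * c ^ 2) ^ 2 := by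
        gcongr
    _ = ((a * e * g * d) * (c * e * f * d)) ^ 2 * (a * c) * (a * c * e ^ 2 * d) := by ring
    _ ≥ (1 * 1) ^ 2 * (1 * 1) * (1 / 3) := by
        gcongr
        linarith
    _ = 1 / 3 := by norm_num

/-- The identity behind `liouville_sq` read backwards: in the window the product is at most 3ε^5
while every factor is at least 1, so each factor is at most 3ε^5. -/
theorem cox_bounds_of_near {a c e f g d T ε E : ℝ} (hE : E = 3 * ε ^ 5)
    (ha : 1 ≤ a) (hc : 1 ≤ c) (he : 1 ≤ e) (hf : 1 ≤ f) (hg : 1 ≤ g) (hd0 : 0 < d)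
    (hdT : T ^ 2 * d ≤ ε) (hT : 0 < T) (hH : e ^ 3 * f * g * a ^ 2 * c ^ 2 ≤ T ^ 5)
    (i1 : 1 ≤ a * e * g * d) (i2 : 1 ≤ c * e * f * d) (i3 : 1 ≤ 3 * (a * c * e ^ 2) * d) :
    a ≤ E ∧ c ≤ E ∧ a * c ≤ E ∧ a * e * g * d ≤ E ∧ c * e * f * d ≤ E ∧
      3 * (a * c * e ^ 2) * d ≤ E := by
  obtain ⟨α, hα⟩ : ∃ α : ℝ, α = a * e * g * d := ⟨_, rfl⟩
  obtain ⟨β, hβ⟩ : ∃ β : ℝ, β = c * e * f * d := ⟨_, rfl⟩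
  obtain ⟨γ, hγ⟩ : ∃ γ : ℝ, γ = 3 * (a * c * e ^ 2) * d := ⟨_, rfl⟩
  have hac1 : 1 ≤ a * c := one_le_mul_of_one_le_of_one_le ha hc
  have key : (α * β) ^ 2 * (a * c) * γ ≤ E := by
    calc (α * β) ^ 2 * (a * c) * γ = 3 * (d ^ 5 * (e ^ 3 * f * g * a ^ 2 * c ^ 2) ^ 2) := by
          rw [hα, hβ, hγ]; ring
      _ ≤ 3 * (d ^ 5 * (T ^ 5) ^ 2) := by gcongr
      _ = 3 * (T ^ 2 * d) ^ 5 := by ring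
      _ ≤ 3 * ε ^ 5 := by gcongr
      _ = E := hE.symm
  rw [← hα] at i1 ⊢
  rw [← hβ] at i2 ⊢
  rw [← hγ] at i3 ⊢
  clear hα hβ hγ hH hdT
  have hαβ : 1 ≤ α * β := one_le_mul_of_one_le_of_one_le i1 i2
  have hαβ2 : 1 ≤ (α * β) ^ 2 := one_le_pow₀ hαβ
  have hacE : a * c ≤ E := by
    refine le_trans ?_ key
    calc a * c = 1 * (a * c) * 1 := by ring
      _ ≤ _ := by gcongr
  have hγE : γ ≤ E := by
    refine le_trans ?_ key
    calc γ = 1 * 1 * γ := by ring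
      _ ≤ _ := by gcongr
  have hαβE : α * β ≤ E := by
    refine le_trans ?_ key
    calc α * β ≤ (α * β) ^ 2 := le_self_pow₀ hαβ (by norm_num)
      _ = (α * β) ^ 2 * 1 * 1 := by ring
      _ ≤ _ := by gcongr
  exact ⟨le_trans (le_mul_of_one_le_right (by linarith) hc) hacE,
    le_trans (le_mul_of_one_le_left (by linarith) ha) hacE, hacE,
    le_trans (le_mul_of_one_le_right (by linarith) i2) hαβE,
    le_trans (le_mul_of_one_le_left (by linarith) i1) hαβE, hγE⟩

/-- All three distance bounds lie between fixed positive constants, so their quotients show that e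
is O(f) and O(g), whence e^5 is O(e³fg) = O(T^5). Conversely D ≠ 0 forces 1 ≤ 3ace²d, and T²d ≤ ε
then gives T = O(e). Finally mf = u·aeg with u near 1 and aeg, cef comparable, so m has the order of
e. -/
theorem cox_sizes_of_near {a c e f g m u d T ε E : ℝ} (hε1 : 1 ≤ ε) (hE1 : 1 ≤ E)
    (ha : 1 ≤ a) (hc : 1 ≤ c) (he : 1 ≤ e) (hf : 1 ≤ f) (hg : 1 ≤ g) (hd0 : 0 < d)
    (hdT : T ^ 2 * d ≤ ε) (hT : 0 < T) (hH : e ^ 3 * f * g * a ^ 2 * c ^ 2 ≤ T ^ 5)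
    (hu : 1 / 2 ≤ u ∧ u ≤ 2) (hum : u * (a * e * g) = m * f) (hcE : c ≤ E) (hacE : a * c ≤ E)
    (i1 : 1 ≤ a * e * g * d) (i2 : 1 ≤ c * e * f * d) (i3 : 1 ≤ 3 * (a * c * e ^ 2) * d)
    (j1 : a * e * g * d ≤ E) (j2 : c * e * f * d ≤ E) (j3 : 3 * (a * c * e ^ 2) * d ≤ E) :
    e ≤ E * T ∧ m ≤ 2 * E ^ 3 * T ∧ T ≤ 6 * E ^ 2 * ε * m := by
  have hγ : a * c * e ^ 2 * d ≤ E := by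
    refine le_trans ?_ j3
    have : 0 ≤ a * c * e ^ 2 * d := by positivity
    linarith
  have hfe : e ≤ E * f := by
    calc e = 1 * 1 * e := by ring
      _ ≤ (c * e * f * d) * a * e := by gcongr
      _ = (a * c * e ^ 2 * d) * f := by ring
      _ ≤ E * f := by gcongr
  have hge : e ≤ E * g := by
    calc e = 1 * 1 * e := by ring
      _ ≤ (a * e * g * d) * c * e := by gcongr
      _ = (a * c * e ^ 2 * d) * g := by ring
      _ ≤ E * g := by gcongr
  have heT : e ≤ E * T := by
    have h5 : e ^ 5 ≤ (E * T) ^ 5 := by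
      calc e ^ 5 = e ^ 3 * e * e := by ring
        _ ≤ e ^ 3 * (E * f) * (E * g) := by gcongr
        _ = E ^ 2 * (e ^ 3 * f * g * 1 ^ 2 * 1 ^ 2) := by ring
        _ ≤ E ^ 2 * (e ^ 3 * f * g * a ^ 2 * c ^ 2) := by gcongr
        _ ≤ E ^ 5 * T ^ 5 := by
            gcongr
            norm_num
        _ = (E * T) ^ 5 := by ring
    exact le_of_pow_le_pow_left₀ (by norm_num) (by positivity) h5
  have hTe : T ≤ 3 * E * ε * e := by
    have h1 : 1 ≤ 3 * E * ε := by nlinarith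
    have : T ^ 2 ≤ (3 * E * ε * e) ^ 2 := by
      calc T ^ 2 ≤ T ^ 2 * (3 * (a * c * e ^ 2) * d) :=
            le_mul_of_one_le_right (by positivity) i3
        _ = 3 * (a * c) * e ^ 2 * (T ^ 2 * d) := by ring
        _ ≤ 3 * E * e ^ 2 * ε := by gcongr
        _ ≤ (3 * E * e ^ 2 * ε) * (3 * E * ε) := le_mul_of_one_le_right (by positivity) h1
        _ = (3 * E * ε * e) ^ 2 := by ring
    exact le_of_pow_le_pow_left₀ (by norm_num) (by positivity) this
  have hmT : m ≤ 2 * E * c * e := by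
    have : m * f ≤ (2 * E * c * e) * f := by
      rw [← hum]
      have : a * e * g ≤ E * (c * e * f) := by
        have : a * e * g * d ≤ E * (c * e * f * d) :=
          j1.trans (le_mul_of_one_le_right (by linarith) i2)
        rw [← mul_assoc] at this
        exact le_of_mul_le_mul_right this hd0
      calc u * (a * e * g) ≤ 2 * (a * e * g) := by gcongr; exact hu.2
        _ ≤ 2 * (E * (c * e * f)) := by gcongr
        _ = _ := by ring
    exact le_of_mul_le_mul_right this (by linarith)
  have hem : e ≤ 2 * E * m := by
    have : e * f ≤ (2 * E * m) * f := by
      have h0 : c * e * f ≤ E * (a * e * g) := by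
        have : c * e * f * d ≤ E * (a * e * g * d) :=
          j2.trans (le_mul_of_one_le_right (by linarith) i1)
        rw [← mul_assoc] at this
        exact le_of_mul_le_mul_right this hd0
      calc e * f = 1 * e * f := by ring
        _ ≤ c * e * f := by gcongr
        _ ≤ E * (a * e * g) := h0
        _ = 2 * E * ((1 / 2) * (a * e * g)) := by ring
        _ ≤ 2 * E * (u * (a * e * g)) := by gcongr; exact hu.1
        _ = 2 * E * m * f := by rw [hum]; ring
    exact le_of_mul_le_mul_right this (by linarith)
  refine ⟨heT, ?_, ?_⟩
  · calc m ≤ 2 * E * c * e := hmT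
      _ ≤ 2 * E * E * (E * T) := by gcongr
      _ = 2 * E ^ 3 * T := by ring
  · calc T ≤ 3 * E * ε * e := hTe
      _ ≤ 3 * E * ε * (2 * E * m) := by gcongr
      _ = 6 * E ^ 2 * ε * m := by ring

/-- A point close to `Q` in the zoom with factor `T ^ 2` and height at most `T ^ 5`. -/
theorem exists_bounded_cox (ε : ℝ) : ∃ K : ℕ, 1 ≤ K ∧ ∀ (T : ℝ) (u v : ℚ), 0 < T →
    u ≠ 1 → v ≠ 1 → u * v ≠ 1 → T ^ 2 * max |(u : ℝ) - 1| |(v : ℝ) - 1| ≤ ε →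
    max |(u : ℝ) - 1| |(v : ℝ) - 1| ≤ 1 / 2 → height (pt u v) ≤ T ^ 5 →
    ∃ (a c e f g m n : ℕ) (k₁ k₂ D : ℤ),
      (1 ≤ a ∧ 1 ≤ c ∧ 1 ≤ e ∧ 1 ≤ f ∧ 1 ≤ g ∧ 1 ≤ m ∧ 1 ≤ n) ∧
      u * (a * e * g) = m * f ∧ v * (c * e * f) = n * g ∧
      (m * f : ℤ) = a * e * g + k₁ ∧ (n * g : ℤ) = c * e * f + k₂ ∧
      (m * n : ℤ) = a * c * e ^ 2 - D ∧ D ≠ 0 ∧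
      (D : ℚ) = a * c * e ^ 2 * (1 - u * v) ∧
      (a ≤ K ∧ c ≤ K ∧ |k₁| ≤ K ∧ |k₂| ≤ K ∧ |D| ≤ K) ∧
      (e ≤ K * T ∧ m ≤ K * T ∧ T ≤ K * m) := by
  obtain ⟨ε', hε'⟩ : ∃ ε', ε' = max 1 ε := ⟨_, rfl⟩
  have hε1 : 1 ≤ ε' := hε' ▸ le_max_left _ _
  obtain ⟨E, hE⟩ : ∃ E, E = 3 * ε' ^ 5 := ⟨_, rfl⟩
  have hε5 : 1 ≤ ε' ^ 5 := one_le_pow₀ hε1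
  have hE1 : 1 ≤ E := by linarith
  -- Large enough to dominate all the constants met: E, 2E³ and 6E²ε'.
  obtain ⟨K, hK⟩ := exists_nat_ge (6 * E ^ 3 * ε')
  have hE3 : E ≤ E ^ 3 := le_self_pow₀ hE1 (by norm_num)
  have hE23 : E ^ 2 ≤ E ^ 3 := pow_le_pow_right₀ hE1 (by norm_num)
  have hE3' : E ^ 3 ≤ E ^ 3 * ε' := le_mul_of_one_le_right (by positivity) hε1
  have hKE : E ≤ K := by linarith
  refine ⟨K, by exact_mod_cast hE1.trans hKE, ?_⟩
  intro T u v hT hu hv huv hdT hd2 hHT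
  obtain ⟨d, hd⟩ : ∃ d, d = max |(u : ℝ) - 1| |(v : ℝ) - 1| := ⟨_, rfl⟩
  rw [← hd] at hdT hd2
  obtain ⟨a, c, e, f, g, m, n, k₁, k₂, D, hpos, E1, E2, hH, e1, e2, e3, e4,
    h1, h2, h3⟩ := exists_cox_near hu hv huv hd (by linarith)
  have hpos' := hpos
  obtain ⟨ha, hc, he, hf, hg, hm, hn⟩ := hpos'
  have haR : (1 : ℝ) ≤ a := by exact_mod_cast ha
  have hcR : (1 : ℝ) ≤ c := by exact_mod_cast hc
  have heR : (1 : ℝ) ≤ e := by exact_mod_cast he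
  have hfR : (1 : ℝ) ≤ f := by exact_mod_cast hf
  have hgR : (1 : ℝ) ≤ g := by exact_mod_cast hg
  have hd0 : 0 < d := by
    rw [hd]; exact lt_max_of_lt_left (abs_pos.2 (sub_ne_zero.2 (by exact_mod_cast hu)))
  have hdT' : T ^ 2 * d ≤ ε' := hdT.trans (hε' ▸ le_max_right _ _)
  have hw : |(u : ℝ) - 1| ≤ 1 / 2 := (hd ▸ le_max_left _ _ : _ ≤ d).trans hd2
  have E1R : (u : ℝ) * (a * e * g) = m * f := by exact_mod_cast E1
  obtain ⟨b1, b2, b3, b4, b5, b6⟩ := cox_bounds_of_near hE haR hcR heR hfR hgR hd0 hdT' hT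
    (hH.trans hHT) (h1.1.trans h1.2) (h2.1.trans h2.2) (h3.1.trans h3.2)
  obtain ⟨c1, c2, c3⟩ := cox_sizes_of_near hε1 hE1 haR hcR heR hfR hgR hd0 hdT' hT
    (hH.trans hHT) ⟨by linarith [(abs_le.1 hw).1], by linarith [(abs_le.1 hw).2]⟩ E1R b2 b3
    (h1.1.trans h1.2) (h2.1.trans h2.2) (h3.1.trans h3.2) b4 b5 b6
  refine ⟨a, c, e, f, g, m, n, k₁, k₂, D, hpos, E1, E2, e1, e2, e3, ?_,
    e4, ⟨?_, ?_, ?_, ?_, ?_⟩, ?_, ?_, ?_⟩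
  · intro h; rw [h] at h3; simp at h3; linarith [h3.1]
  · exact_mod_cast b1.trans hKE
  · exact_mod_cast b2.trans hKE
  · exact_mod_cast (h1.2.trans b4).trans hKE
  · exact_mod_cast (h2.2.trans b5).trans hKE
  · exact_mod_cast (h3.2.trans b6).trans hKE
  · exact c1.trans (by gcongr)
  · exact c2.trans (by gcongr; linarith)
  · refine c3.trans ?_
    gcongr
    refine le_trans ?_ hK
    gcongr

/-! ### The quadratic character attached to a nonsquare integer -/

open scoped NumberTheorySymbols in
-- Write Δ = σsk² with s squarefree. If an odd prime ℓ divides s, the Chinese remainder theorem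
-- gives b that is a nonresidue modulo ℓ and 1 modulo 8 and modulo the rest; reciprocity makes the
-- symbol -1. Otherwise σs is ±1 or ±2 and the class of b modulo 8 decides. No primality of b is
-- needed.
theorem exists_jacobiSym_eq_neg_one {Δ : ℤ} (h0 : Δ ≠ 0) (hsq : ¬ IsSquare Δ) :
    ∃ b : ℕ, Odd b ∧ jacobiSym Δ b = -1 := by
  obtain ⟨s, k, hks, hs⟩ := Nat.sq_mul_squarefree Δ.natAbs
  obtain ⟨σ, hσ, hΔ⟩ : ∃ σ : ℤ, σ.natAbs = 1 ∧ Δ = σ * s * k ^ 2 := by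
    refine ⟨Δ.sign, Int.natAbs_sign_of_ne_zero h0, ?_⟩
    have : Δ.sign * Δ.natAbs = Δ := Int.sign_mul_natAbs Δ
    have e : (Δ.natAbs : ℤ) = k ^ 2 * s := by rw [← hks]; push_cast; rfl
    linear_combination (-1 : ℤ) * this + Δ.sign * e
  have hk0 : k ≠ 0 := by rintro rfl; simp at hΔ; exact h0 hΔ
  have hs0 : s ≠ 0 := hs.ne_zero
  -- it is enough to find `b` coprime to `k` for the squarefree part
  suffices h : ∃ b : ℕ, Odd b ∧ k.Coprime b ∧ jacobiSym (σ * s) b = -1 by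
    obtain ⟨b, hb, hkb, hj⟩ := h
    refine ⟨b, hb, ?_⟩
    rw [hΔ, jacobiSym.mul_left, hj, jacobiSym.sq_one' (by simpa [Int.gcd] using hkb), mul_one]
  by_cases hodd : ∃ ℓ : ℕ, ℓ.Prime ∧ ℓ ≠ 2 ∧ ℓ ∣ s
  · obtain ⟨ℓ, hℓ, hℓ2, s', rfl⟩ := hodd
    have := Fact.mk hℓ
    have hℓs' : ¬ ℓ ∣ s' := by
      intro ⟨r, hr⟩
      have := hs ℓ ⟨r, by rw [hr]; ring⟩
      exact hℓ.one_lt.ne' (Nat.isUnit_iff.1 this)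
    -- The powers of ℓ in k are split off so that b ≡ 1 modulo k' is compatible with the condition
    -- modulo ℓ; coprimality to ℓ itself follows because a nonresidue is nonzero.
    obtain ⟨j, k', hk', rfl⟩ := Nat.exists_eq_pow_mul_and_not_dvd hk0 ℓ hℓ.ne_one
    have hℓodd : Odd ℓ := hℓ.odd_of_ne_two hℓ2
    obtain ⟨ν, hν⟩ := FiniteField.exists_nonsquare (F := ZMod ℓ) (by rwa [ZMod.ringChar_zmod_n])
    have hℓ8 : ℓ.Coprime 8 := by
      have : ℓ.Coprime (2 ^ 3) := Nat.Coprime.pow_right 3 hℓodd.coprime_two_right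
      simpa using this
    have hcop : ℓ.Coprime (8 * s' * k') :=
      Nat.Coprime.mul_right (Nat.Coprime.mul_right hℓ8 ((Nat.Prime.coprime_iff_not_dvd hℓ).2 hℓs'))
        ((Nat.Prime.coprime_iff_not_dvd hℓ).2 hk')
    obtain ⟨b, hb1, hb2⟩ := Nat.chineseRemainder hcop ν.val 1
    have hb8 : b ≡ 1 [MOD 8] := hb2.of_mul_right k' |>.of_mul_right s'
    have hbodd : Odd b := by
      rw [Nat.odd_iff]; have : b % 8 = 1 := hb8
      omega
    have hbℓ : ((b : ℕ) : ZMod ℓ) = ν := by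
      rw [(ZMod.natCast_eq_natCast_iff _ _ _).2 hb1, ZMod.natCast_zmod_val]
    have hjb : jacobiSym b ℓ = -1 := by
      refine (ZMod.nonsquare_iff_jacobiSym_eq_neg_one (a := (b : ℤ)) (p := ℓ)).2 ?_
      simpa [hbℓ] using hν
    have hbcop : ∀ t, t ∣ 8 * s' * k' → t.Coprime b := by
      intro t ht
      have : b ≡ 1 [MOD t] := hb2.of_dvd ht
      rw [Nat.Coprime, Nat.gcd_comm, this.gcd_eq, Nat.gcd_one_left]
    have hℓb : ℓ.Coprime b := by
      rw [Nat.Prime.coprime_iff_not_dvd hℓ, ← ZMod.natCast_eq_zero_iff, hbℓ]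
      rintro rfl
      exact hν (IsSquare.zero)
    refine ⟨b, hbodd, Nat.Coprime.mul_left (hℓb.pow_left _) (hbcop _ (Dvd.intro_left _ rfl)), ?_⟩
    have e1 : jacobiSym (σ * s') b = 1 := by
      rw [jacobiSym.mod_right _ hbodd]
      have : b ≡ 1 [MOD 4 * (σ * s').natAbs] := by
        apply hb2.of_dvd
        rw [Int.natAbs_mul, hσ, one_mul, Int.natAbs_natCast]
        exact ⟨2 * k', by ring⟩
      have h1 : 1 < 4 * (σ * s').natAbs := by
        rw [Int.natAbs_mul, hσ, one_mul, Int.natAbs_natCast]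
        have : s' ≠ 0 := by rintro rfl; simp at hs0
        omega
      rw [this, Nat.mod_eq_of_lt h1, jacobiSym.one_right]
    have e2 : jacobiSym ℓ b = -1 := by
      rw [← hjb]
      symm
      apply jacobiSym.quadratic_reciprocity_one_mod_four _ hℓodd
      have : b % 8 = 1 := hb8
      omega
    have : σ * ((ℓ * s' : ℕ) : ℤ) = σ * s' * ℓ := by push_cast; ring
    rw [this, jacobiSym.mul_left, e1, e2, one_mul]
  · push Not at hodd
    have hs2 : s = 1 ∨ s = 2 := by
      rcases Nat.eq_two_pow_or_exists_odd_prime_and_dvd s with ⟨j, hj⟩ | ⟨p, hp, hps, hpo⟩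
      · match j, hj with
        | 0, hj => left; simpa using hj
        | 1, hj => right; simpa using hj
        | j + 2, hj =>
          have := hs 2 ⟨2 ^ j, by rw [hj]; ring⟩
          simp at this
      · exact absurd hps (hodd p hp (by rintro rfl; exact absurd hpo (by decide)))
    have hσ' : σ = 1 ∨ σ = -1 := Int.natAbs_eq_iff.1 hσ
    obtain ⟨j, k', hk', rfl⟩ := Nat.exists_eq_pow_mul_and_not_dvd hk0 2 (by norm_num)
    have hk'o : Odd k' := Nat.odd_iff.2 (by omega)
    have h8k' : Nat.Coprime 8 k' := by
      have : Nat.Coprime (2 ^ 3) k' := Nat.Coprime.pow_left 3 hk'o.coprime_two_left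
      simpa using this
    have main : ∀ c : ℕ, c % 2 = 1 → c < 8 → ∃ b : ℕ, b % 8 = c ∧ Odd b ∧
        (2 ^ j * k').Coprime b := by
      intro c hc hc8
      obtain ⟨b, hb1, hb2⟩ := Nat.chineseRemainder h8k' c 1
      have h1 : b % 8 = c := by have : b % 8 = c % 8 := hb1; omega
      have h2 : Odd b := Nat.odd_iff.2 (by omega)
      refine ⟨b, h1, h2, Nat.Coprime.mul_left (h2.coprime_two_left.pow_left _) ?_⟩
      rw [Nat.Coprime, Nat.gcd_comm, hb2.gcd_eq, Nat.gcd_one_left]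
    -- The four values of σs: 1 contradicts that Δ is not a square, b ≡ 3 modulo 8 serves for -1 and
    -- 2, and b ≡ 5 for -2.
    rcases hs2 with rfl | rfl <;> rcases hσ' with rfl | rfl
    · exact absurd ⟨((2 ^ j * k' : ℕ) : ℤ), by rw [hΔ]; push_cast; ring⟩ hsq
    · obtain ⟨b, h1, h2, h3⟩ := main 3 rfl (by norm_num)
      refine ⟨b, h2, h3, ?_⟩
      rw [jacobiSym.mod_right _ h2]
      have : b % (4 * (-1 * ((1 : ℕ) : ℤ)).natAbs) = 3 := by simp; omega
      rw [this]; norm_num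
    · obtain ⟨b, h1, h2, h3⟩ := main 3 rfl (by norm_num)
      refine ⟨b, h2, h3, ?_⟩
      rw [jacobiSym.mod_right _ h2]
      have : b % (4 * (1 * ((2 : ℕ) : ℤ)).natAbs) = 3 := by simp; omega
      rw [this]; norm_num
    · obtain ⟨b, h1, h2, h3⟩ := main 5 rfl (by norm_num)
      refine ⟨b, h2, h3, ?_⟩
      rw [jacobiSym.mod_right _ h2]
      have : b % (4 * (-1 * ((2 : ℕ) : ℤ)).natAbs) = 5 := by simp; omega
      rw [this]; norm_num

/-- The completely multiplicative function `n ↦ (Δ / n)` on odd numbers, `0` on even ones. -/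
def oddJacobi (Δ : ℤ) : ArithmeticFunction ℝ :=
  ⟨fun n => if Odd n then (jacobiSym Δ n : ℝ) else 0, by simp⟩

theorem oddJacobi_apply (Δ : ℤ) (n : ℕ) :
    oddJacobi Δ n = if Odd n then (jacobiSym Δ n : ℝ) else 0 := rfl

theorem oddJacobi_mul (Δ : ℤ) (m n : ℕ) :
    oddJacobi Δ (m * n) = oddJacobi Δ m * oddJacobi Δ n := by
  simp only [oddJacobi_apply, Nat.odd_mul]
  by_cases hm : Odd m
  · by_cases hn : Odd n
    · have : NeZero m := ⟨hm.pos.ne'⟩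
      have : NeZero n := ⟨hn.pos.ne'⟩
      simp [hm, hn, jacobiSym.mul_right]
    · simp [hn]
  · simp [hm]

theorem oddJacobi_one (Δ : ℤ) : oddJacobi Δ 1 = 1 := by
  simp [oddJacobi_apply]

theorem oddJacobi_pow (Δ : ℤ) (n k : ℕ) : oddJacobi Δ (n ^ k) = oddJacobi Δ n ^ k := by
  induction k with
  | zero => simp [oddJacobi_one]
  | succ k ih => rw [pow_succ, oddJacobi_mul, ih, pow_succ]

theorem oddJacobi_isMultiplicative (Δ : ℤ) : (oddJacobi Δ).IsMultiplicative :=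
  ⟨oddJacobi_one Δ, fun _ => oddJacobi_mul Δ _ _⟩

theorem oddJacobi_trichotomy (Δ : ℤ) (n : ℕ) :
    oddJacobi Δ n = 0 ∨ oddJacobi Δ n = 1 ∨ oddJacobi Δ n = -1 := by
  rw [oddJacobi_apply]
  split_ifs
  · rcases jacobiSym.trichotomy Δ n with h | h | h <;> simp [h]
  · simp

theorem abs_oddJacobi_le (Δ : ℤ) (n : ℕ) : |oddJacobi Δ n| ≤ 1 := by
  rcases oddJacobi_trichotomy Δ n with h | h | h <;> simp [h]

theorem oddJacobi_add_period (Δ : ℤ) (n : ℕ) :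
    oddJacobi Δ (n + 4 * Δ.natAbs) = oddJacobi Δ n := by
  have : Odd (n + 4 * Δ.natAbs) ↔ Odd n := by
    rw [Nat.odd_iff, Nat.odd_iff]; omega
  simp only [oddJacobi_apply, this]
  split_ifs with h
  · rw [jacobiSym.mod_right Δ (this.2 h), Nat.add_mod_right, ← jacobiSym.mod_right Δ h]
  · rfl

theorem oddJacobi_mod (Δ : ℤ) (n : ℕ) :
    oddJacobi Δ (n % (4 * Δ.natAbs)) = oddJacobi Δ n := by
  conv_rhs => rw [← Nat.mod_add_div n (4 * Δ.natAbs)]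
  generalize n % (4 * Δ.natAbs) = r
  induction n / (4 * Δ.natAbs) with
  | zero => simp
  | succ k ih => rw [Nat.mul_succ, ← add_assoc, oddJacobi_add_period, ih]

/-- Multiplication by some b with character value -1 permutes the residues of a period, so the sum
equals its own negative. -/
theorem sum_period_oddJacobi {Δ : ℤ} (h0 : Δ ≠ 0) (hsq : ¬ IsSquare Δ) :
    ∑ n ∈ Finset.range (4 * Δ.natAbs), oddJacobi Δ n = 0 := by
  obtain ⟨b, hb, hj⟩ := exists_jacobiSym_eq_neg_one h0 hsq
  set q := 4 * Δ.natAbs with hq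
  have hq0 : 0 < q := by have := Int.natAbs_pos.2 h0; omega
  have hbχ : oddJacobi Δ b = -1 := by simp [oddJacobi_apply, hb, hj]
  have hcop : b.Coprime q := by
    have h1 : Δ.gcd b = 1 := by
      by_contra hne
      have := (jacobiSym.eq_zero_iff (a := Δ) (b := b)).2 ⟨hb.pos.ne', hne⟩
      rw [hj] at this; norm_num at this
    refine Nat.Coprime.mul_right ?_ ?_
    · have : b.Coprime (2 ^ 2) := Nat.Coprime.pow_right 2 hb.coprime_two_right
      simpa using this
    · rw [Nat.coprime_comm]; simpa [Int.gcd] using h1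
  have hinj : Set.InjOn (fun n => b * n % q) (Finset.range q : Set ℕ) := by
    intro x hx y hy hxy
    have h1 : b * x ≡ b * y [MOD q] := hxy
    have h2 : x ≡ y [MOD q] := Nat.ModEq.cancel_left_of_coprime hcop.symm h1
    simp only [Finset.coe_range, Set.mem_Iio] at hx hy
    exact Nat.ModEq.eq_of_lt_of_lt h2 hx hy
  have himg : (Finset.range q).image (fun n => b * n % q) = Finset.range q := by
    apply Finset.eq_of_subset_of_card_le
    · intro x hx
      obtain ⟨y, -, rfl⟩ := Finset.mem_image.1 hx
      exact Finset.mem_range.2 (Nat.mod_lt _ hq0)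
    · rw [Finset.card_image_of_injOn hinj]
  have : ∑ n ∈ Finset.range q, oddJacobi Δ n = - ∑ n ∈ Finset.range q, oddJacobi Δ n := by
    conv_lhs => rw [← himg, Finset.sum_image hinj]
    simp only [hq, oddJacobi_mod, oddJacobi_mul, hbχ]
    simp
  linarith

theorem abs_sum_oddJacobi_le {Δ : ℤ} (h0 : Δ ≠ 0) (hsq : ¬ IsSquare Δ) (k : ℕ) :
    |∑ n ∈ Finset.range k, oddJacobi Δ n| ≤ 4 * Δ.natAbs := by
  induction k using Nat.strong_induction_on with
  | _ k ih =>
    have hq0 : 0 < 4 * Δ.natAbs := by have := Int.natAbs_pos.2 h0; omega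
    rcases lt_or_ge k (4 * Δ.natAbs) with hk | hk
    · calc |∑ n ∈ Finset.range k, oddJacobi Δ n| ≤ ∑ n ∈ Finset.range k, |oddJacobi Δ n| :=
          Finset.abs_sum_le_sum_abs _ _
        _ ≤ ∑ n ∈ Finset.range k, 1 := Finset.sum_le_sum fun n _ => abs_oddJacobi_le Δ n
        _ = k := by simp
        _ ≤ _ := by exact_mod_cast hk.le
    · obtain ⟨n, rfl⟩ := Nat.exists_eq_add_of_le hk
      rw [Finset.sum_range_add, sum_period_oddJacobi h0 hsq, zero_add]
      simp_rw [add_comm (4 * Δ.natAbs), oddJacobi_add_period]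
      exact ih n (by omega)

/-- Summation by parts: the differences g i - g (i+1) are nonnegative and telescope, so only g 0
survives. -/
theorem abs_sum_mul_antitone_le (f g : ℕ → ℝ) (A : ℝ) (hg : Antitone g) (hg0 : ∀ n, 0 ≤ g n)
    (hA : ∀ k, |∑ i ∈ Finset.range k, f i| ≤ A) (k : ℕ) :
    |∑ i ∈ Finset.range k, f i * g i| ≤ A * g 0 := by
  have key : ∀ k, ∑ i ∈ Finset.range k, f i * g i = (∑ i ∈ Finset.range k, f i) * g k +
      ∑ i ∈ Finset.range k, (∑ j ∈ Finset.range (i + 1), f j) * (g i - g (i + 1)) := by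
    intro k
    induction k with
    | zero => simp
    | succ k ih =>
      rw [Finset.sum_range_succ, ih, Finset.sum_range_succ _ k, Finset.sum_range_succ _ k]
      simp only [Finset.sum_range_succ]
      ring
  rw [key]
  calc _ ≤ |(∑ i ∈ Finset.range k, f i) * g k| +
        |∑ i ∈ Finset.range k, (∑ j ∈ Finset.range (i + 1), f j) * (g i - g (i + 1))| :=
        abs_add_le _ _
    _ ≤ A * g k + ∑ i ∈ Finset.range k, A * (g i - g (i + 1)) := by
        gcongr
        · rw [abs_mul, abs_of_nonneg (hg0 k)]
          gcongr
          · exact hg0 k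
          · exact hA k
        · refine (Finset.abs_sum_le_sum_abs _ _).trans (Finset.sum_le_sum fun i _ => ?_)
          have : 0 ≤ g i - g (i + 1) := sub_nonneg.2 (hg (Nat.le_succ i))
          rw [abs_mul, abs_of_nonneg this]
          gcongr
          exact hA _
    _ = A * g 0 := by
        rw [← Finset.mul_sum, Finset.sum_range_sub']; ring

/-! ### The divisor sum of the quadratic character and its averages -/

open scoped ArithmeticFunction.zeta

/-- The divisor sum `∑_{d ∣ n} (Δ / d)` over odd `d`. -/
def jacobiZeta (Δ : ℤ) : ArithmeticFunction ℝ := oddJacobi Δ * (ζ : ArithmeticFunction ℝ)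

theorem jacobiZeta_isMultiplicative (Δ : ℤ) : (jacobiZeta Δ).IsMultiplicative :=
  (oddJacobi_isMultiplicative Δ).mul ArithmeticFunction.isMultiplicative_zeta.natCast

theorem jacobiZeta_prime_pow (Δ : ℤ) {p : ℕ} (hp : p.Prime) (k : ℕ) :
    jacobiZeta Δ (p ^ k) = ∑ i ∈ Finset.range (k + 1), oddJacobi Δ p ^ i := by
  rw [jacobiZeta, ArithmeticFunction.coe_mul_zeta_apply, Nat.sum_divisors_prime_pow hp]
  simp_rw [oddJacobi_pow]

/-- At a prime power this is a geometric sum of ratio 0, 1 or -1. Nonnegativity is what allows it to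
serve as a majorant and single terms to be extracted from convolutions. -/
theorem jacobiZeta_nonneg (Δ : ℤ) (n : ℕ) : 0 ≤ jacobiZeta Δ n := by
  induction n using Nat.recOnPosPrimePosCoprime with
  | prime_pow p k hp hk =>
    rw [jacobiZeta_prime_pow Δ hp]
    rcases oddJacobi_trichotomy Δ p with h | h | h
    · rw [h]; exact Finset.sum_nonneg fun i _ => by positivity
    · rw [h]; exact Finset.sum_nonneg fun i _ => by positivity
    · rw [h, neg_one_geom_sum]; split_ifs <;> norm_num
  | zero => simp
  | one => simp [(jacobiZeta_isMultiplicative Δ).map_one]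
  | coprime a b _ _ hab ha hb =>
    rw [(jacobiZeta_isMultiplicative Δ).map_mul_of_coprime hab]
    exact mul_nonneg ha hb

theorem sum_jacobiZeta (Δ : ℤ) (X : ℕ) :
    ∑ n ∈ Finset.Ioc 0 X, jacobiZeta Δ n = ∑ n ∈ Finset.Ioc 0 X, oddJacobi Δ n * (X / n : ℕ) :=
  ArithmeticFunction.sum_Ioc_mul_zeta_eq_sum _ _

theorem sum_jacobiZeta_le_log (Δ : ℤ) (X : ℕ) :
    ∑ n ∈ Finset.Ioc 0 X, jacobiZeta Δ n ≤ X * (1 + Real.log X) := by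
  rw [sum_jacobiZeta]
  calc ∑ n ∈ Finset.Ioc 0 X, oddJacobi Δ n * (X / n : ℕ)
      ≤ ∑ n ∈ Finset.Ioc 0 X, X * ((n : ℝ))⁻¹ := by
        refine Finset.sum_le_sum fun n _ => ?_
        calc oddJacobi Δ n * (X / n : ℕ) ≤ 1 * (X / n : ℕ) := by
              gcongr; exact (le_abs_self _).trans (abs_oddJacobi_le Δ n)
          _ ≤ X / n := by rw [one_mul]; exact Nat.cast_div_le
          _ = _ := div_eq_mul_inv _ _
    _ = X * (harmonic X : ℝ) := by
        rw [← Finset.mul_sum, harmonic_eq_sum_Icc]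
        push_cast
        rfl
    _ ≤ _ := by
        gcongr
        exact harmonic_le_one_add_log X

theorem sum_Ioc_zero_eq_sum_range (h : ℕ → ℝ) (X : ℕ) :
    ∑ n ∈ Finset.Ioc 0 X, h n = ∑ i ∈ Finset.range X, h (i + 1) := by
  induction X with
  | zero => simp
  | succ X ih => rw [Finset.sum_Ioc_succ_top (Nat.zero_le _), ih, Finset.sum_range_succ]

/-- Only an upper bound is needed, so no value of an L-function enters: ⌊X/n⌋ decreases from X and
the character has bounded partial sums, so summation by parts removes the logarithm. -/
theorem sum_jacobiZeta_le_linear {Δ : ℤ} (h0 : Δ ≠ 0) (hsq : ¬ IsSquare Δ) (X : ℕ) :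
    ∑ n ∈ Finset.Ioc 0 X, jacobiZeta Δ n ≤ 4 * Δ.natAbs * X := by
  rw [sum_jacobiZeta]
  have hanti : Antitone fun i : ℕ => ((X / (i + 1) : ℕ) : ℝ) := by
    intro i j hij
    simp only [Nat.cast_le]
    exact Nat.div_le_div_left (by omega) (by omega)
  have := abs_sum_mul_antitone_le (fun i => oddJacobi Δ (i + 1)) _ (4 * Δ.natAbs) hanti
    (fun n => by positivity) (fun k => ?_) X
  · rw [sum_Ioc_zero_eq_sum_range]
    refine (le_abs_self _).trans (this.trans (le_of_eq ?_))
    simp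
  -- The sums start at n = 1; the term at 0 can be added since the character vanishes there.
  · have h := abs_sum_oddJacobi_le h0 hsq (k + 1)
    rw [Finset.sum_range_succ'] at h
    simpa using h

/-! ### The number of roots of `N e² ≡ D` modulo `m`, on average -/

/-- The set of roots of `N e² ≡ D` modulo `m`. -/
def rootSet (N D : ℤ) (m : ℕ) : Finset ℕ :=
  (Finset.range m).filter fun e => (m : ℤ) ∣ N * (e : ℤ) ^ 2 - D

theorem mem_rootSet {N D : ℤ} {m e : ℕ} :
    e ∈ rootSet N D m ↔ e < m ∧ (m : ℤ) ∣ N * (e : ℤ) ^ 2 - D := by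
  simp [rootSet]

theorem card_le_of_pairwise_modEq {S : Finset ℕ} {m L C : ℕ} (hL : 0 < L) (hm : m ≤ C * L)
    (hS : ∀ x ∈ S, x < m) (h : ∀ x ∈ S, ∀ y ∈ S, x ≡ y [MOD L]) : S.card ≤ C := by
  rw [← Finset.card_range C]
  refine Finset.card_le_card_of_injOn (fun x => x / L) (fun x hx => ?_) fun x hx y hy hxy => ?_
  · simp only [Finset.coe_range, Set.mem_Iio]
    exact (Nat.div_lt_iff_lt_mul hL).2 ((hS x hx).trans_le hm)
  · have h1 : x % L = y % L := h x hx y hy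
    have h2 : x / L = y / L := hxy
    rw [← Nat.div_add_mod x L, ← Nat.div_add_mod y L, h1, h2]

/-- A crude bound that also covers the primes dividing 2ND. Fix a root e₀ and sort the roots e by d
= gcd(m, e - e₀). With m = dm', the cofactor m' divides N(e + e₀), so within one class N·e is
determined modulo lcm(d, m'). That lcm is m/gcd(d, m'), and gcd(d, m') divides 2D. Each class thus
has at most 2|D||N| elements. -/
theorem card_rootSet_le_divisors {N D : ℤ} (hN : N ≠ 0) (hD : D ≠ 0) {m : ℕ} (hm : 0 < m) :
    (rootSet N D m).card ≤ (2 * D.natAbs * N.natAbs) * m.divisors.card := by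
  rcases (rootSet N D m).eq_empty_or_nonempty with h0 | ⟨e₀, he₀⟩
  · simp [h0]
  have h00 := (mem_rootSet.1 he₀).2
  refine Finset.card_le_mul_card_image_of_maps_to
    (f := fun e : ℕ => Int.gcd m ((e : ℤ) - e₀)) (t := m.divisors) (fun e _ => ?_) _ fun d hd => ?_
  · refine Nat.mem_divisors.2 ⟨?_, hm.ne'⟩
    exact_mod_cast Int.gcd_dvd_left (m : ℤ) ((e : ℤ) - e₀)
  obtain ⟨m', hm'⟩ := Nat.dvd_of_mem_divisors hd
  have hd0 : 0 < d := Nat.pos_of_mem_divisors hd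
  have hm0 : 0 < m' := Nat.pos_of_ne_zero (by rintro rfl; simp at hm'; omega)
  set S := (rootSet N D m).filter fun e : ℕ => Int.gcd m ((e : ℤ) - e₀) = d
  have hSd : ∀ e ∈ S, (d : ℤ) ∣ (e : ℤ) - e₀ := by
    intro e he
    rw [← (Finset.mem_filter.1 he).2]
    exact Int.gcd_dvd_right _ _
  have hSm : ∀ e ∈ S, (m' : ℤ) ∣ N * ((e : ℤ) + e₀) := by
    intro e he
    obtain ⟨t, ht⟩ := hSd e he
    have h1 := (mem_rootSet.1 (Finset.mem_filter.1 he).1).2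
    have h2 : (m : ℤ) ∣ N * (((e : ℤ) - e₀) * (e + e₀)) := by
      have := dvd_sub h1 h00
      ring_nf at this ⊢
      exact this
    rw [ht, hm'] at h2
    push_cast at h2
    have h3 : (m' : ℤ) ∣ t * (N * ((e : ℤ) + e₀)) := by
      have hdz : (d : ℤ) ≠ 0 := by exact_mod_cast hd0.ne'
      refine (mul_dvd_mul_iff_left hdz).1 ?_
      calc (d : ℤ) * m' ∣ N * (d * t * (e + e₀)) := h2
        _ = _ := by ring
    refine IsCoprime.dvd_of_dvd_mul_left ?_ h3
    have h4 := (Finset.mem_filter.1 he).2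
    rw [ht, hm'] at h4
    push_cast at h4
    rw [Int.gcd_mul_left, Int.natAbs_natCast] at h4
    exact Int.isCoprime_iff_gcd_eq_one.2 (Nat.eq_of_mul_eq_mul_left hd0 (by rw [h4, mul_one]))
  rcases S.eq_empty_or_nonempty with hS0 | ⟨e₁, he₁⟩
  · simp [hS0]
  -- A common divisor of d and m' divides N(e₁ - e₀) and N(e₁ + e₀), hence 2Ne₀², hence 2D because
  -- Ne₀² ≡ D.
  have hg : d.gcd m' ≤ 2 * D.natAbs := by
    refine Nat.le_of_dvd (by have := Int.natAbs_pos.2 hD; omega) ?_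
    have hgd : ((d.gcd m' : ℕ) : ℤ) ∣ d := Int.natCast_dvd_natCast.2 (Nat.gcd_dvd_left _ _)
    have hgm : ((d.gcd m' : ℕ) : ℤ) ∣ m' := Int.natCast_dvd_natCast.2 (Nat.gcd_dvd_right _ _)
    have hgmm : ((d.gcd m' : ℕ) : ℤ) ∣ m := hgm.trans ⟨d, by rw [hm']; push_cast; ring⟩
    have a1 := (hgd.trans (hSd e₁ he₁)).mul_left N
    have a2 := hgm.trans (hSm e₁ he₁)
    have a3 := (dvd_sub a2 a1).mul_right (e₀ : ℤ)
    have a4 := (hgmm.trans h00).mul_left 2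
    have a5 : ((d.gcd m' : ℕ) : ℤ) ∣ 2 * D := by
      have := dvd_sub a3 a4
      ring_nf at this ⊢
      exact this
    have := Int.natAbs_dvd_natAbs.2 a5
    rwa [Int.natAbs_natCast, Int.natAbs_mul] at this
  set L := d.lcm m' with hLdef
  have hL0 : 0 < L := Nat.lcm_pos hd0 hm0
  have hLN : 0 < L.gcd N.natAbs := Nat.gcd_pos_of_pos_left _ hL0
  have hL'0 : 0 < L / L.gcd N.natAbs := Nat.div_pos (Nat.gcd_le_left _ hL0) hLN
  refine card_le_of_pairwise_modEq hL'0 ?_ (m := m) (fun x hx =>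
    (mem_rootSet.1 (Finset.mem_filter.1 hx).1).1) fun x hx y hy => ?_
  · have h1 : m = d.gcd m' * L := by rw [hLdef, Nat.gcd_mul_lcm, hm']
    have h2 : L ≤ N.natAbs * (L / L.gcd N.natAbs) := by
      calc L = L.gcd N.natAbs * (L / L.gcd N.natAbs) :=
            (Nat.mul_div_cancel' (Nat.gcd_dvd_left _ _)).symm
        _ ≤ _ := Nat.mul_le_mul_right _ (Nat.gcd_le_right _ (Int.natAbs_pos.2 hN))
    calc m = d.gcd m' * L := h1
      _ ≤ (2 * D.natAbs) * (N.natAbs * (L / L.gcd N.natAbs)) := Nat.mul_le_mul hg h2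
      _ = _ := by ring
  · have b1 : (d : ℤ) ∣ N * ((y : ℤ) - x) := by
      have := (dvd_sub (hSd y hy) (hSd x hx)).mul_left N
      ring_nf at this ⊢; exact this
    have b2 : (m' : ℤ) ∣ N * ((y : ℤ) - x) := by
      have := dvd_sub (hSm y hy) (hSm x hx)
      ring_nf at this ⊢; exact this
    have b3 : L ∣ N.natAbs * ((y : ℤ) - x).natAbs := by
      rw [← Int.natAbs_mul]
      exact Nat.lcm_dvd (Int.natCast_dvd.1 b1) (Int.natCast_dvd.1 b2)
    have b4 : L / L.gcd N.natAbs ∣ ((y : ℤ) - x).natAbs := by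
      have c1 : (L / L.gcd N.natAbs).Coprime (N.natAbs / L.gcd N.natAbs) :=
        Nat.coprime_div_gcd_div_gcd hLN
      refine c1.dvd_of_dvd_mul_left ?_
      refine Nat.dvd_of_mul_dvd_mul_left hLN ?_
      rwa [Nat.mul_div_cancel' (Nat.gcd_dvd_left _ _), ← mul_assoc,
        Nat.mul_div_cancel' (Nat.gcd_dvd_right _ _)]
    exact (Nat.modEq_iff_dvd).2 (Int.natCast_dvd.2 b4)

/-- Pairing d with m/d puts one of them below √m. Applied to the part of the modulus at the bad
primes, a power saving over m is all that is needed. -/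
theorem card_divisors_le_sqrt (m : ℕ) : (m.divisors.card : ℝ) ≤ 2 * Real.sqrt m := by
  have h : m.divisors ⊆ Finset.Ioc 0 m.sqrt ∪ (Finset.Ioc 0 m.sqrt).image (fun d => m / d) := by
    intro d hd
    obtain ⟨k, hk⟩ := Nat.dvd_of_mem_divisors hd
    have hd0 := Nat.pos_of_mem_divisors hd
    have hm0 : m ≠ 0 := (Nat.mem_divisors.1 hd).2
    have hk0 : 0 < k := Nat.pos_of_ne_zero (by rintro rfl; simp at hk; exact hm0 hk)
    rcases le_or_gt d m.sqrt with h1 | h1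
    · exact Finset.mem_union_left _ (Finset.mem_Ioc.2 ⟨hd0, h1⟩)
    · refine Finset.mem_union_right _ (Finset.mem_image.2 ⟨k, Finset.mem_Ioc.2 ⟨hk0, ?_⟩, ?_⟩)
      · by_contra h2
        push Not at h2
        have : m < d * k := (Nat.lt_succ_sqrt m).trans_le (Nat.mul_le_mul h1 h2)
        omega
      · rw [hk, Nat.mul_div_cancel _ hk0]
  have h2 : m.divisors.card ≤ 2 * m.sqrt := by
    refine (Finset.card_le_card h).trans ((Finset.card_union_le _ _).trans ?_)
    have := Finset.card_image_le (s := Finset.Ioc 0 m.sqrt) (f := fun d => m / d)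
    simp only [Nat.card_Ioc, tsub_zero] at this ⊢
    omega
  calc (m.divisors.card : ℝ) ≤ 2 * (m.sqrt : ℝ) := by exact_mod_cast h2
    _ ≤ _ := by gcongr; exact Real.nat_sqrt_le_real_sqrt

theorem card_rootSet_mul_le (N D : ℤ) {a b : ℕ} (hab : a.Coprime b) (ha : 0 < a) (hb : 0 < b) :
    (rootSet N D (a * b)).card ≤ (rootSet N D a).card * (rootSet N D b).card := by
  rw [← Finset.card_product]
  have red : ∀ (c e : ℕ), (c : ℤ) ∣ N * (e : ℤ) ^ 2 - D →
      (c : ℤ) ∣ N * ((e % c : ℕ) : ℤ) ^ 2 - D := by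
    intro c e h
    have h1 : (c : ℤ) ∣ (e : ℤ) - ((e % c : ℕ) : ℤ) := ⟨(e / c : ℕ), by
      have := Nat.div_add_mod e c
      have : (c : ℤ) * (e / c : ℕ) + (e % c : ℕ) = e := by exact_mod_cast this
      linarith⟩
    have h2 := (h1.mul_left (N * ((e : ℤ) + ((e % c : ℕ) : ℤ))))
    have h3 := dvd_sub h h2
    have e3 : N * (e : ℤ) ^ 2 - D - N * ((e : ℤ) + ((e % c : ℕ) : ℤ)) * ((e : ℤ) - ((e % c : ℕ) : ℤ))
      = N * ((e % c : ℕ) : ℤ) ^ 2 - D := by ring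
    rwa [e3] at h3
  refine Finset.card_le_card_of_injOn (fun e => (e % a, e % b)) (fun e he => ?_)
    fun x hx y hy hxy => ?_
  · obtain ⟨-, h⟩ := mem_rootSet.1 he
    push_cast at h
    simp only [Finset.coe_product, Set.mem_prod, Finset.mem_coe, mem_rootSet]
    exact ⟨⟨Nat.mod_lt _ ha, red _ _ ((dvd_mul_right _ _).trans h)⟩,
      ⟨Nat.mod_lt _ hb, red _ _ ((dvd_mul_left _ _).trans h)⟩⟩
  · simp only [Prod.mk.injEq] at hxy
    have h := (Nat.modEq_and_modEq_iff_modEq_mul hab).1 hxy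
    exact Nat.ModEq.eq_of_lt_of_lt h (mem_rootSet.1 hx).1 (mem_rootSet.1 hy).1

/-- If there is a root e₀, then ND ≡ (Ne₀)² modulo p, so the character is 1 at p and the right side
is k + 1 ≥ 2. And p cannot divide both e - e₀ and e + e₀, so p^k divides one of them and there are
at most two roots. -/
theorem card_rootSet_prime_pow_le {N D : ℤ} {p k : ℕ} (hp : p.Prime) (hk : 0 < k)
    (hcop : p.Coprime (2 * (N * D).natAbs)) :
    ((rootSet N D (p ^ k)).card : ℝ) ≤ jacobiZeta (N * D) (p ^ k) := by
  have := Fact.mk hp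
  have hp2 : p ≠ 2 := by
    rintro rfl
    exact Nat.not_coprime_of_dvd_of_dvd (by norm_num) dvd_rfl (dvd_mul_right _ _) hcop
  have hpΔ : ¬ (p : ℤ) ∣ N * D := fun h =>
    Nat.not_coprime_of_dvd_of_dvd hp.one_lt dvd_rfl ((Int.natCast_dvd.1 h).mul_left 2) hcop
  have hodd : Odd p := hp.odd_of_ne_two hp2
  have hpz : Prime (p : ℤ) := Nat.prime_iff_prime_int.1 hp
  have hpow : (p : ℤ) ∣ ((p ^ k : ℕ) : ℤ) := by
    push_cast; exact dvd_pow_self _ hk.ne'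
  rcases (rootSet N D (p ^ k)).eq_empty_or_nonempty with h0 | ⟨e₀, he₀⟩
  · rw [h0]; simpa using jacobiZeta_nonneg _ _
  have h00 := (mem_rootSet.1 he₀).2
  have hχ : oddJacobi (N * D) p = 1 := by
    rw [oddJacobi_apply, if_pos hodd]
    have hne : jacobiSym (N * D) p ≠ 0 := jacobiSym.ne_zero (by
      have := Int.isCoprime_iff_gcd_eq_one.1 ((Prime.coprime_iff_not_dvd hpz).2 hpΔ)
      rwa [Int.gcd_comm] at this)
    have hne' : jacobiSym (N * D) p ≠ -1 := by
      intro h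
      refine ZMod.nonsquare_of_jacobiSym_eq_neg_one h ⟨(N * e₀ : ℤ), ?_⟩
      have h1 : (p : ℤ) ∣ N * e₀ * (N * e₀) - N * D := by
        calc (p : ℤ) ∣ N * (N * (e₀ : ℤ) ^ 2 - D) := (hpow.trans h00).mul_left N
          _ = _ := by ring
      rw [← Int.cast_mul (N * e₀ : ℤ)]
      exact ((ZMod.intCast_eq_intCast_iff_dvd_sub _ _ _).2 h1)
    rcases jacobiSym.trichotomy (N * D) p with h | h | h
    · exact absurd h hne
    · simp [h]
    · exact absurd h hne'
  have hsub : rootSet N D (p ^ k) ⊆ {e₀, (p ^ k - e₀) % p ^ k} := by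
    intro e he
    obtain ⟨hlt, h1⟩ := mem_rootSet.1 he
    have hlt0 := (mem_rootSet.1 he₀).1
    have h2 : ((p ^ k : ℕ) : ℤ) ∣ N * (((e : ℤ) - e₀) * (e + e₀)) := by
      calc ((p ^ k : ℕ) : ℤ) ∣ N * (e : ℤ) ^ 2 - D - (N * (e₀ : ℤ) ^ 2 - D) := dvd_sub h1 h00
        _ = _ := by ring
    have hpN : ¬ (p : ℤ) ∣ N := fun h => hpΔ (h.mul_right _)
    push_cast at h2
    have hN : IsCoprime ((p : ℤ) ^ k) N := ((Prime.coprime_iff_not_dvd hpz).2 hpN).pow_left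
    have h3 := hN.dvd_of_dvd_mul_left h2
    by_cases hd : (p : ℤ) ∣ (e : ℤ) - e₀
    · have hd' : ¬ (p : ℤ) ∣ (e : ℤ) + e₀ := by
        intro hd'
        have h4 : (p : ℤ) ∣ 2 * e₀ := by
          calc (p : ℤ) ∣ (e : ℤ) + e₀ - (e - e₀) := dvd_sub hd' hd
            _ = _ := by ring
        have h5 : (p : ℤ) ∣ e₀ := by
          rcases hpz.dvd_or_dvd h4 with h | h
          · exfalso
            have : p ∣ 2 := by exact_mod_cast h
            exact hp2 ((Nat.prime_dvd_prime_iff_eq hp Nat.prime_two).1 this)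
          · exact h
        have h6 : (p : ℤ) ∣ D := by
          have := dvd_sub ((h5.mul_left (N * e₀))) (hpow.trans h00)
          have e6 : N * e₀ * (e₀ : ℤ) - (N * (e₀ : ℤ) ^ 2 - D) = D := by ring
          rwa [e6] at this
        exact hpΔ (h6.mul_left _)
      have h7 : (p : ℤ) ^ k ∣ (e : ℤ) - e₀ :=
        IsCoprime.dvd_of_dvd_mul_right (((Prime.coprime_iff_not_dvd hpz).2 hd').pow_left) h3
      have : e₀ ≡ e [MOD p ^ k] := (Nat.modEq_iff_dvd).2 (by push_cast; exact h7)
      have := Nat.ModEq.eq_of_lt_of_lt this hlt0 hlt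
      simp [this]
    · have h7 : (p : ℤ) ^ k ∣ (e : ℤ) + e₀ :=
        IsCoprime.dvd_of_dvd_mul_left (((Prime.coprime_iff_not_dvd hpz).2 hd).pow_left) h3
      have : (p ^ k - e₀) ≡ e [MOD p ^ k] := (Nat.modEq_iff_dvd).2 (by
        rw [Nat.cast_sub hlt0.le]
        push_cast
        calc (p : ℤ) ^ k ∣ (e : ℤ) + e₀ - (p : ℤ) ^ k := dvd_sub h7 dvd_rfl
          _ = _ := by ring)
      have h8 : (p ^ k - e₀) % p ^ k = e % p ^ k := this
      rw [Nat.mod_eq_of_lt hlt] at h8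
      simp [h8]
  rw [jacobiZeta_prime_pow _ hp, hχ]
  have hc : (rootSet N D (p ^ k)).card ≤ 2 := (Finset.card_le_card hsub).trans Finset.card_le_two
  simp only [one_pow, Finset.sum_const, Finset.card_range, nsmul_eq_mul, mul_one]
  exact_mod_cast hc.trans (by omega)

theorem card_rootSet_one (N D : ℤ) : (rootSet N D 1).card ≤ 1 :=
  (Finset.card_filter_le _ _).trans (by simp)

theorem card_rootSet_le_jacobiZeta {N D : ℤ} {m : ℕ} (hm : 0 < m)
    (hcop : m.Coprime (2 * (N * D).natAbs)) :
    ((rootSet N D m).card : ℝ) ≤ jacobiZeta (N * D) m := by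
  induction m using Nat.recOnPosPrimePosCoprime with
  | prime_pow p k hp hk =>
    exact card_rootSet_prime_pow_le hp hk (Nat.Coprime.coprime_dvd_left (dvd_pow_self p hk.ne') hcop)
  | zero => omega
  | one =>
    rw [(jacobiZeta_isMultiplicative _).map_one]
    exact_mod_cast card_rootSet_one N D
  | coprime a b ha hb hab iha ihb =>
    rw [(jacobiZeta_isMultiplicative _).map_mul_of_coprime hab]
    calc ((rootSet N D (a * b)).card : ℝ) ≤ (rootSet N D a).card * (rootSet N D b).card := by
          exact_mod_cast card_rootSet_mul_le N D hab (by omega) (by omega)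
      _ ≤ _ := by
          gcongr
          · exact jacobiZeta_nonneg _ _
          · exact iha (by omega) (Nat.Coprime.coprime_mul_right hcop)
          · exact ihb (by omega) (Nat.Coprime.coprime_mul_left hcop)

theorem exists_factored_mul_coprime (P : ℕ) (hP : P ≠ 0) (m : ℕ) (hm : 0 < m) :
    ∃ m₁ m₂, m = m₁ * m₂ ∧ m₁ ∈ Nat.factoredNumbers P.primeFactors ∧ m₂.Coprime P := by
  induction m using Nat.strong_induction_on with
  | _ m ih =>
    by_cases h : m.Coprime P
    · exact ⟨1, m, by simp,
        Nat.mem_factoredNumbers'.2 fun p hp h1 => absurd (Nat.dvd_one.1 h1) hp.ne_one, h⟩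
    · obtain ⟨p, hp, hpm, hpP⟩ := Nat.Prime.not_coprime_iff_dvd.1 h
      obtain ⟨m', rfl⟩ := hpm
      have hm' : 0 < m' := Nat.pos_of_mul_pos_left hm
      obtain ⟨m₁, m₂, h1, h2, h3⟩ := ih m' (by nlinarith [hp.one_lt]) hm'
      refine ⟨p * m₁, m₂, by rw [h1]; ring, ?_, h3⟩
      refine Nat.mul_mem_factoredNumbers ?_ h2
      rw [Nat.mem_factoredNumbers']
      intro q hq hqp
      rw [(Nat.prime_dvd_prime_iff_eq hq hp).1 hqp]
      exact Nat.mem_primeFactors.2 ⟨hp, hpP, hP⟩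

/-- A finite Euler product with factors (1 - p^(-1/2))⁻¹. -/
theorem summable_factored_inv_sqrt (s : Finset ℕ) :
    Summable fun m : Nat.factoredNumbers s => (Real.sqrt ((m : ℕ) : ℝ))⁻¹ := by
  let f : ℕ →* ℝ :=
    { toFun := fun n => (Real.sqrt (n : ℝ))⁻¹
      map_one' := by simp
      map_mul' := fun a b => by
        push_cast
        rw [Real.sqrt_mul (Nat.cast_nonneg a), mul_inv] }
  have hf : ∀ {p : ℕ}, p.Prime → ‖f p‖ < 1 := by
    intro p hp
    have h1 : 1 < Real.sqrt (p : ℝ) := by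
      rw [Real.lt_sqrt zero_le_one]; simpa using hp.one_lt
    change ‖(Real.sqrt (p : ℝ))⁻¹‖ < 1
    rw [Real.norm_of_nonneg (by positivity)]
    exact inv_lt_one_of_one_lt₀ h1
  exact (EulerProduct.summable_and_hasSum_factoredNumbers_prod_filter_prime_geometric hf s).2.summable

open Classical in
/-- The square root on the numbers with all prime factors in `s`, zero elsewhere. -/
noncomputable def factoredSqrt (s : Finset ℕ) : ArithmeticFunction ℝ :=
  ⟨fun n => if n ∈ Nat.factoredNumbers s then Real.sqrt n else 0, by simp⟩

/-- Split m = m₁m₂ with m₁ composed of primes dividing 2ND and m₂ prime to them. The root count is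
at most a constant times √m₁ times the divisor sum at m₂, hence at most a Dirichlet convolution;
summing over m₂ ≤ X/m₁ leaves the convergent series of 1/√m₁. The constant A is quantified after X
so that it may contain log X. -/
theorem sum_card_rootSet_le {N D : ℤ} (hN : N ≠ 0) (hD : D ≠ 0) :
    ∃ C : ℝ, 0 < C ∧ ∀ (X : ℕ) (A : ℝ), 0 ≤ A →
      (∀ Y ≤ X, ∑ n ∈ Finset.Ioc 0 Y, jacobiZeta (N * D) n ≤ A * Y) →
      ∑ m ∈ Finset.Ioc 0 X, ((rootSet N D m).card : ℝ) ≤ C * A * X := by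
  classical
  set P := 2 * (N * D).natAbs with hP
  have hP0 : P ≠ 0 := by
    have := Int.natAbs_pos.2 (mul_ne_zero hN hD); omega
  set s := P.primeFactors
  set F := factoredSqrt s with hF
  have hF0 : ∀ n, 0 ≤ F n := fun n => by
    change 0 ≤ ite _ _ _
    split_ifs
    · positivity
    · exact le_rfl
  set K : ℝ := 2 * (2 * D.natAbs * N.natAbs) with hK
  have hDpos : (0 : ℝ) < D.natAbs := by exact_mod_cast Int.natAbs_pos.2 hD
  have hNpos : (0 : ℝ) < N.natAbs := by exact_mod_cast Int.natAbs_pos.2 hN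
  have hKpos : 0 < K := by positivity
  -- pointwise comparison with the convolution
  have hpt : ∀ m, 0 < m → ((rootSet N D m).card : ℝ) ≤ K * (F * jacobiZeta (N * D)) m := by
    intro m hm
    obtain ⟨m₁, m₂, rfl, h1, h2⟩ := exists_factored_mul_coprime P hP0 m hm
    have hm1 : 0 < m₁ := Nat.pos_of_mul_pos_right hm
    have hm2 : 0 < m₂ := Nat.pos_of_mul_pos_left hm
    have hcop : m₁.Coprime m₂ := by
      by_contra h
      obtain ⟨p, hp, hp1, hp2⟩ := Nat.Prime.not_coprime_iff_dvd.1 h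
      have := (Nat.mem_factoredNumbers'.1 h1) p hp hp1
      exact Nat.not_coprime_of_dvd_of_dvd hp.one_lt hp2 (Nat.dvd_of_mem_primeFactors this) h2
    have e1 : ((rootSet N D m₁).card : ℝ) ≤ K * F m₁ := by
      have hFm : F m₁ = Real.sqrt m₁ := if_pos h1
      rw [hFm]
      calc ((rootSet N D m₁).card : ℝ) ≤ (2 * D.natAbs * N.natAbs) * m₁.divisors.card := by
            exact_mod_cast card_rootSet_le_divisors hN hD hm1
        _ ≤ (2 * D.natAbs * N.natAbs) * (2 * Real.sqrt m₁) := by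
            gcongr; exact card_divisors_le_sqrt m₁
        _ = _ := by rw [hK]; ring
    calc ((rootSet N D (m₁ * m₂)).card : ℝ)
        ≤ (rootSet N D m₁).card * (rootSet N D m₂).card := by
          exact_mod_cast card_rootSet_mul_le N D hcop hm1 hm2
      _ ≤ (K * F m₁) * jacobiZeta (N * D) m₂ := by
          gcongr
          · exact mul_nonneg hKpos.le (hF0 _)
          · exact card_rootSet_le_jacobiZeta hm2 h2
      _ = K * (F m₁ * jacobiZeta (N * D) m₂) := by ring
      _ ≤ _ := by
          gcongr
          rw [ArithmeticFunction.mul_apply]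
          refine Finset.single_le_sum (f := fun x : ℕ × ℕ => F x.1 * jacobiZeta (N * D) x.2)
            (fun x _ => mul_nonneg (hF0 _) (jacobiZeta_nonneg _ _)) (a := (m₁, m₂)) ?_
          exact Nat.mem_divisorsAntidiagonal.2 ⟨rfl, hm.ne'⟩
  have hsum := summable_factored_inv_sqrt s
  set Z := ∑' m : Nat.factoredNumbers s, (Real.sqrt ((m : ℕ) : ℝ))⁻¹ with hZ
  have hZ0 : 0 ≤ Z := tsum_nonneg fun _ => by positivity
  -- Adding 1 to the value of the series makes positivity of the constant immediate.
  refine ⟨K * (Z + 1), by positivity, fun X A hA hY => ?_⟩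
  calc ∑ m ∈ Finset.Ioc 0 X, ((rootSet N D m).card : ℝ)
      ≤ ∑ m ∈ Finset.Ioc 0 X, K * (F * jacobiZeta (N * D)) m :=
        Finset.sum_le_sum fun m hm => hpt m (Finset.mem_Ioc.1 hm).1
    _ = K * ∑ n ∈ Finset.Ioc 0 X, F n * ∑ m ∈ Finset.Ioc 0 (X / n), jacobiZeta (N * D) m := by
        rw [← Finset.mul_sum, ArithmeticFunction.sum_Ioc_mul_eq_sum_sum]
    _ ≤ K * ∑ n ∈ Finset.Ioc 0 X, (A * X) *
          Set.indicator (Nat.factoredNumbers s) (fun n => (Real.sqrt (n : ℝ))⁻¹) n := by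
        refine mul_le_mul_of_nonneg_left (Finset.sum_le_sum fun n hn => ?_) hKpos.le
        have hn0 : (0 : ℝ) < n := by exact_mod_cast (Finset.mem_Ioc.1 hn).1
        calc F n * ∑ m ∈ Finset.Ioc 0 (X / n), jacobiZeta (N * D) m
            ≤ F n * (A * (X / n : ℕ)) := by
              gcongr
              · exact hF0 n
              · exact hY _ (Nat.div_le_self _ _)
          _ ≤ F n * (A * (X / n)) := by
              gcongr
              · exact hF0 n
              · exact Nat.cast_div_le
          _ = _ := by
              change (ite _ _ _) * _ = _
              by_cases h : n ∈ Nat.factoredNumbers s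
              · rw [if_pos h, Set.indicator_of_mem h]
                have hs := Real.mul_self_sqrt hn0.le
                have hs0 : Real.sqrt (n : ℝ) ≠ 0 := (Real.sqrt_pos.2 hn0).ne'
                rw [show A * (X / (n : ℝ)) = A * (X / (Real.sqrt n * Real.sqrt n)) by rw [hs]]
                field_simp
              · rw [if_neg h, Set.indicator_of_notMem h]; simp
    _ ≤ K * ((A * X) * Z) := by
        rw [← Finset.mul_sum]
        gcongr
        rw [hZ, tsum_subtype (Nat.factoredNumbers s) (fun n : ℕ => (Real.sqrt (n : ℝ))⁻¹)]
        refine Summable.sum_le_tsum _ (fun n _ => ?_) (summable_subtype_iff_indicator.1 hsum)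
        exact Set.indicator_nonneg (fun _ _ => by positivity) _
    _ ≤ K * (Z + 1) * A * X := by
        have : 0 ≤ K * A * X := by positivity
        nlinarith

theorem sum_card_rootSet_le_log {N D : ℤ} (hN : N ≠ 0) (hD : D ≠ 0) :
    ∃ C : ℝ, 0 < C ∧ ∀ X : ℕ,
      ∑ m ∈ Finset.Ioc 0 X, ((rootSet N D m).card : ℝ) ≤ C * (X * (1 + Real.log X)) := by
  obtain ⟨C, hC, h⟩ := sum_card_rootSet_le hN hD
  refine ⟨C, hC, fun X => ?_⟩
  rcases Nat.eq_zero_or_pos X with rfl | hX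
  · simp
  have hlog : 0 ≤ Real.log X := Real.log_natCast_nonneg X
  refine (h X (1 + Real.log X) (by positivity) fun Y hY => ?_).trans (le_of_eq (by ring))
  refine (sum_jacobiZeta_le_log _ Y).trans ?_
  rw [mul_comm]
  rcases Nat.eq_zero_or_pos Y with rfl | hY0
  · simp
  gcongr

theorem sum_card_rootSet_le_linear {N D : ℤ} (hN : N ≠ 0) (hD : D ≠ 0)
    (hsq : ¬ IsSquare (N * D)) :
    ∃ C : ℝ, 0 < C ∧ ∀ X : ℕ,
      ∑ m ∈ Finset.Ioc 0 X, ((rootSet N D m).card : ℝ) ≤ C * X := by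
  obtain ⟨C, hC, h⟩ := sum_card_rootSet_le hN hD
  have h0 : (0 : ℝ) < (N * D).natAbs := by exact_mod_cast Int.natAbs_pos.2 (mul_ne_zero hN hD)
  refine ⟨C * (4 * (N * D).natAbs), by positivity, fun X => ?_⟩
  exact h X (4 * (N * D).natAbs) (by positivity) fun Y _ =>
    sum_jacobiZeta_le_linear (mul_ne_zero hN hD) hsq Y

/-! ### Zoom measures of balls as cardinalities -/

/-- The points of `W` of height at most `T ^ 5` in the ball of radius `ε` after zooming by
`T ^ 2`. -/
def zoomSet (W : Set Y3) (T ε : ℝ) : Set Y3 :=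
  {P | P ∈ W ∧ P ∈ chart ∧ height P ≤ T ^ 5 ∧ T ^ 2 * ‖toTangent P‖ ≤ ε}

theorem zoom_apply (W : Set Y3) (B r : ℝ) {A : Set (ℝ × ℝ)} (hA : MeasurableSet A) :
    zoom W B r A = ({P | P ∈ W ∧ P ∈ chart ∧ height P ≤ B ∧
      B ^ (1 / r) • toTangent P ∈ A} : Set Y3).encard := by
  rw [zoom, Measure.sum_apply _ hA]
  simp_rw [Measure.dirac_apply' _ hA]
  set S : Set Y3 := {P | P ∈ W ∧ P ∈ chart ∧ height P ≤ B}
  set S' : Set Y3 := {P | P ∈ W ∧ P ∈ chart ∧ height P ≤ B ∧ B ^ (1 / r) • toTangent P ∈ A}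
  calc ∑' P : {P : Y3 // P ∈ W ∧ P ∈ chart ∧ height P ≤ B},
        A.indicator (1 : ℝ × ℝ → ℝ≥0∞) (B ^ (1 / r) • toTangent P.1)
      = ∑' P : S, S'.indicator (1 : Y3 → ℝ≥0∞) P := by
        refine tsum_congr fun P => ?_
        by_cases h : B ^ (1 / r) • toTangent P.1 ∈ A
        · rw [Set.indicator_of_mem h, Set.indicator_of_mem]
          · rfl
          · exact ⟨P.2.1, P.2.2.1, P.2.2.2, h⟩
        · rw [Set.indicator_of_notMem h, Set.indicator_of_notMem]
          exact fun h' => h h'.2.2.2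
    _ = ∑' P, S.indicator (S'.indicator (1 : Y3 → ℝ≥0∞)) P := tsum_subtype S _
    _ = ∑' P, S'.indicator (1 : Y3 → ℝ≥0∞) P := by
        refine tsum_congr fun P => ?_
        rw [Set.indicator_indicator, Set.inter_eq_right.2]
        exact fun P hP => ⟨hP.1, hP.2.1, hP.2.2.1⟩
    _ = S'.encard := by
        rw [← tsum_subtype]
        exact ENNReal.tsum_set_one S'

theorem rpow_two_fifths {B : ℝ} (hB : 0 ≤ B) : B ^ (1 / (5 / 2) : ℝ) = (B ^ (1 / 5 : ℝ)) ^ 2 := by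
  rw [← Real.rpow_natCast, ← Real.rpow_mul hB]; norm_num

theorem rpow_one_fifth_pow {B : ℝ} (hB : 0 ≤ B) : (B ^ (1 / 5 : ℝ)) ^ 5 = B := by
  rw [← Real.rpow_natCast, ← Real.rpow_mul hB]; norm_num

theorem zoom_closedBall (W : Set Y3) {B : ℝ} (hB : 0 ≤ B) (ε : ℝ) :
    zoom W B (5 / 2) (Metric.closedBall 0 ε) = (zoomSet W (B ^ (1 / 5 : ℝ)) ε).encard := by
  rw [zoom_apply _ _ _ measurableSet_closedBall]
  congr 3
  ext P
  rw [rpow_one_fifth_pow hB, rpow_two_fifths hB,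
    mem_closedBall_zero_iff, norm_smul, Real.norm_of_nonneg (by positivity)]

/-! ### Upper bounds -/

open Classical in
/-- The pairs `(e, m)` of comparable size with `m ∣ N e² - D`. -/
noncomputable def divisorPairs (K N : ℕ) (D : ℤ) (T : ℝ) : Finset (ℕ × ℕ) :=
  (Finset.Ioc 0 ⌊K * T⌋₊ ×ˢ Finset.Ioc 0 ⌊K * T⌋₊).filter fun p =>
    T ≤ K * (p.2 : ℝ) ∧ (p.2 : ℤ) ∣ N * (p.1 : ℤ) ^ 2 - D

/-- For fixed m, the integer e is given by its residue modulo m, which is a root, and by ⌊e/m⌋,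
which is at most K² because e ≤ KT ≤ K²m. -/
theorem card_divisorPairs_le (K N : ℕ) (D : ℤ) {T : ℝ} (hT : 0 < T) :
    ((divisorPairs K N D T).card : ℝ) ≤
      (K ^ 2 + 1) * ∑ m ∈ Finset.Ioc 0 ⌊K * T⌋₊, ((rootSet N D m).card : ℝ) := by
  classical
  have hmaps : ∀ p ∈ divisorPairs K N D T, p.2 ∈ Finset.Ioc 0 ⌊K * T⌋₊ := fun p hp =>
    (Finset.mem_product.1 (Finset.mem_filter.1 hp).1).2
  rw [Finset.card_eq_sum_card_fiberwise hmaps]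
  push_cast
  rw [Finset.mul_sum]
  refine Finset.sum_le_sum fun m hm => ?_
  have hm0 : 0 < m := (Finset.mem_Ioc.1 hm).1
  rcases lt_or_ge (K * (m : ℝ)) T with hlt | hge
  · rw [Finset.card_eq_zero.2]
    · simp; positivity
    · rw [Finset.filter_eq_empty_iff]
      intro p hp hpm
      have := (Finset.mem_filter.1 hp).2.1
      rw [hpm] at this
      linarith
  have hcard : ((divisorPairs K N D T).filter fun p => p.2 = m).card ≤
      (rootSet N D m ×ˢ Finset.range (K ^ 2 + 1)).card := by
    refine Finset.card_le_card_of_injOn (fun p => (p.1 % m, p.1 / m)) (fun p hp => ?_)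
      fun p hp q hq hpq => ?_
    · obtain ⟨hp1, hpm⟩ := Finset.mem_filter.1 hp
      obtain ⟨hp2, -, hp3⟩ := Finset.mem_filter.1 hp1
      rw [hpm] at hp3
      simp only [Finset.coe_product, Set.mem_prod, Finset.mem_coe, mem_rootSet, Finset.mem_range]
      refine ⟨⟨Nat.mod_lt _ hm0, ?_⟩, ?_⟩
      · have h1 : (m : ℤ) ∣ (p.1 : ℤ) - ((p.1 % m : ℕ) : ℤ) := ⟨(p.1 / m : ℕ), by
          have := Nat.div_add_mod p.1 m
          have : (m : ℤ) * (p.1 / m : ℕ) + (p.1 % m : ℕ) = p.1 := by exact_mod_cast this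
          linarith⟩
        calc (m : ℤ) ∣ (N * (p.1 : ℤ) ^ 2 - D) -
              (N * ((p.1 : ℤ) + ((p.1 % m : ℕ) : ℤ))) * ((p.1 : ℤ) - ((p.1 % m : ℕ) : ℤ)) :=
              dvd_sub hp3 (h1.mul_left _)
          _ = _ := by ring
      · rw [Nat.lt_succ_iff]
        have h1 : p.1 ≤ ⌊K * T⌋₊ := (Finset.mem_Ioc.1 (Finset.mem_product.1 hp2).1).2
        have h2 : (p.1 : ℝ) ≤ K * T := (Nat.le_floor_iff (by positivity)).1 h1
        have h3 : (p.1 : ℝ) ≤ (K ^ 2 * m : ℕ) := by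
          push_cast
          calc (p.1 : ℝ) ≤ K * T := h2
            _ ≤ K * (K * m) := by gcongr
            _ = _ := by ring
        exact Nat.div_le_of_le_mul (by rw [mul_comm]; exact_mod_cast h3)
    · have e1 := (Finset.mem_filter.1 hp).2
      have e2 := (Finset.mem_filter.1 hq).2
      simp only [Prod.mk.injEq] at hpq
      ext
      · rw [← Nat.div_add_mod p.1 m, ← Nat.div_add_mod q.1 m, hpq.1, hpq.2]
      · rw [e1, e2]
  rw [Finset.card_product, Finset.card_range] at hcard
  calc (((divisorPairs K N D T).filter fun p => p.2 = m).card : ℝ)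
      ≤ (rootSet N D m).card * (K ^ 2 + 1) := by exact_mod_cast hcard
    _ = _ := mul_comm _ _

/-- The relation between a point and its discrete invariants. -/
def HasInvariants (P : Y3) (a c : ℕ) (k₁ k₂ D : ℤ) (e m : ℕ) : Prop :=
  ∃ (f g n : ℕ) (u v : ℚ), P = pt u v ∧
    (1 ≤ a ∧ 1 ≤ c ∧ 1 ≤ e ∧ 1 ≤ f ∧ 1 ≤ g ∧ 1 ≤ m ∧ 1 ≤ n) ∧
    u * (a * e * g) = m * f ∧ v * (c * e * f) = n * g ∧
    (m * f : ℤ) = a * e * g + k₁ ∧ (n * g : ℤ) = c * e * f + k₂ ∧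
    (m * n : ℤ) = a * c * e ^ 2 - D ∧ D ≠ 0

/-- First n is found from mn = ace² - D. Then f and g solve the linear system mf - aeg = k₁, ng -
cef = k₂, whose determinant mn - ace² = -D is nonzero. -/
theorem HasInvariants.unique {P P' : Y3} {a c : ℕ} {k₁ k₂ D : ℤ} {e m : ℕ}
    (h : HasInvariants P a c k₁ k₂ D e m) (h' : HasInvariants P' a c k₁ k₂ D e m) : P = P' := by
  obtain ⟨f, g, n, u, v, rfl, ⟨ha, hc, he, hf, hg, hm, hn⟩, e1, e2, e3, e4, e5, hD⟩ := h
  obtain ⟨f', g', n', u', v', rfl, ⟨-, -, -, hf', hg', -, hn'⟩, e1', e2', e3', e4', e5', -⟩ := h'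
  have hmz : (m : ℤ) ≠ 0 := by exact_mod_cast (by omega : m ≠ 0)
  have hn : n = n' := by
    have : (n : ℤ) = n' := mul_left_cancel₀ hmz (by rw [e5, e5'])
    exact_mod_cast this
  subst hn
  have hff : f = f' := by
    have : D * ((f : ℤ) - f') = 0 := by
      linear_combination ((f : ℤ) - f') * e5 - (n : ℤ) * e3 + n * e3' - a * e * e4 + a * e * e4'
    have := (mul_eq_zero.1 this).resolve_left hD
    have : (f : ℤ) = f' := by linarith
    exact_mod_cast this
  subst hff
  have hgg : g = g' := by
    have h1 : (a * e : ℤ) * g = a * e * g' := by linarith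
    have h2 : (a * e : ℤ) ≠ 0 := by positivity
    exact_mod_cast mul_left_cancel₀ h2 h1
  subst hgg
  rw [pt_inj]
  constructor
  · exact mul_right_cancel₀ (by positivity) (e1.trans e1'.symm)
  · exact mul_right_cancel₀ (by positivity) (e2.trans e2'.symm)

/-- Counting points near `Q`, given a bound for the average number of roots. -/
theorem encard_zoomSet_le (good : ℤ → Prop) (φ : ℕ → ℝ) (ε : ℝ)
    (hφ : ∀ N D : ℤ, N ≠ 0 → D ≠ 0 → good (N * D) → ∃ C : ℝ, 0 < C ∧ ∀ X : ℕ,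
      ∑ m ∈ Finset.Ioc 0 X, ((rootSet N D m).card : ℝ) ≤ C * φ X) :
    ∃ (K : ℕ) (C : ℝ), 1 ≤ K ∧ 0 < C ∧ ∀ (T : ℝ) (W : Set Y3), 0 < T → 2 * ε ≤ T ^ 2 →
      0 ≤ φ ⌊K * T⌋₊ →
      (∀ u v : ℚ, pt u v ∈ W → u ≠ 1 ∧ v ≠ 1 ∧ u * v ≠ 1 ∧
        ∀ (N e : ℕ) (D : ℤ), 1 ≤ N → 1 ≤ e → D ≠ 0 → (D : ℚ) = N * e ^ 2 * (1 - u * v) →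
          good (N * D)) →
      ((zoomSet W T ε).encard : ℝ≥0∞) ≤ ENNReal.ofReal (C * φ ⌊K * T⌋₊) := by
  classical
  obtain ⟨K, hK1, hK⟩ := exists_bounded_cox ε
  -- Made total in N and D, with default constant 1, so that a constant can be chosen for every pair
  -- and summed over the finite set `Par`.
  have hφ' : ∀ N D : ℤ, ∃ C : ℝ, 0 < C ∧ (N ≠ 0 → D ≠ 0 → good (N * D) → ∀ X : ℕ,
      ∑ m ∈ Finset.Ioc 0 X, ((rootSet N D m).card : ℝ) ≤ C * φ X) := by
    intro N D
    by_cases h : N ≠ 0 ∧ D ≠ 0 ∧ good (N * D)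
    · obtain ⟨C, hC, h'⟩ := hφ N D h.1 h.2.1 h.2.2
      exact ⟨C, hC, fun _ _ _ => h'⟩
    · exact ⟨1, one_pos, fun h1 h2 h3 => absurd ⟨h1, h2, h3⟩ h⟩
  choose Cf hCf0 hCf using hφ'
  let Par : Finset (ℕ × ℕ × ℤ × ℤ × ℤ) :=
    (Finset.Icc 1 K ×ˢ Finset.Icc 1 K ×ˢ Finset.Icc (-K : ℤ) K ×ˢ Finset.Icc (-K : ℤ) K ×ˢ
      Finset.Icc (-K : ℤ) K).filter fun p =>
        p.2.2.2.2 ≠ 0 ∧ good ((p.1 * p.2.1 : ℕ) * p.2.2.2.2)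
  refine ⟨K, 1 + ∑ p ∈ Par, (K ^ 2 + 1) * Cf ((p.1 * p.2.1 : ℕ) : ℤ) p.2.2.2.2, hK1, ?_, ?_⟩
  · have : 0 ≤ ∑ p ∈ Par, ((K : ℝ) ^ 2 + 1) * Cf ((p.1 * p.2.1 : ℕ) : ℤ) p.2.2.2.2 :=
      Finset.sum_nonneg fun p _ => mul_nonneg (by positivity) (hCf0 _ _).le
    linarith
  intro T W hT hεT hφ0 hW
  let F : Finset (Σ _ : ℕ × ℕ × ℤ × ℤ × ℤ, ℕ × ℕ) :=
    Par.sigma fun p => divisorPairs K (p.1 * p.2.1) p.2.2.2.2 T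
  have hex : ∀ P ∈ zoomSet W T ε, ∃ x ∈ F,
      HasInvariants P x.1.1 x.1.2.1 x.1.2.2.1 x.1.2.2.2.1 x.1.2.2.2.2 x.2.1 x.2.2 := by
    rintro P ⟨hPW, hPc, hPh, hPd⟩
    obtain ⟨u, v, rfl⟩ := (mem_chart_iff P).1 hPc
    obtain ⟨hu, hv, huv, hgood⟩ := hW u v hPW
    rw [norm_toTangent_pt] at hPd
    have hd2 : max |(u : ℝ) - 1| |(v : ℝ) - 1| ≤ 1 / 2 := by
      have h1 : 0 < T ^ 2 := by positivity
      have h2 : T ^ 2 * max |(u : ℝ) - 1| |(v : ℝ) - 1| ≤ T ^ 2 * (1 / 2) := by linarith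
      exact le_of_mul_le_mul_left h2 h1
    obtain ⟨a, c, e, f, g, m, n, k₁, k₂, D, hpos, E1, E2, e1, e2, e3, hD, e4,
      ⟨b1, b2, b3, b4, b5⟩, b6, b7, b8⟩ := hK T u v hT hu hv huv hPd hd2 hPh
    have hpos' := hpos
    obtain ⟨ha, hc, he, hf, hg, hm, hn⟩ := hpos'
    refine ⟨⟨(a, c, k₁, k₂, D), (e, m)⟩, ?_, f, g, n, u, v, rfl, hpos, E1, E2, e1, e2, e3, hD⟩
    refine Finset.mem_sigma.2 ⟨Finset.mem_filter.2 ⟨?_, hD, ?_⟩, ?_⟩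
    · simp only [Finset.mem_product, Finset.mem_Icc]
      exact ⟨⟨ha, b1⟩, ⟨hc, b2⟩, abs_le.1 b3, abs_le.1 b4, abs_le.1 b5⟩
    · exact hgood (a * c) e D (Nat.mul_pos ha hc) he hD (by push_cast; exact e4)
    · refine Finset.mem_filter.2 ⟨Finset.mem_product.2 ⟨Finset.mem_Ioc.2 ⟨he, ?_⟩,
        Finset.mem_Ioc.2 ⟨hm, ?_⟩⟩, b8, ⟨n, ?_⟩⟩
      · exact Nat.le_floor b6
      · exact Nat.le_floor b7
      · push_cast
        linarith
  choose! ψ hψF hψ using hex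
  have hcard : (zoomSet W T ε).encard ≤ F.card := by
    rw [← Set.encard_coe_eq_coe_finsetCard]
    refine Set.encard_le_encard_of_injOn (f := ψ) (fun P hP => hψF P hP) fun P hP P' hP' h => ?_
    have h1 := hψ P hP
    rw [h] at h1
    exact h1.unique (hψ P' hP')
  have hF : (F.card : ℝ) ≤
      (1 + ∑ p ∈ Par, (K ^ 2 + 1) * Cf ((p.1 * p.2.1 : ℕ) : ℤ) p.2.2.2.2) * φ ⌊K * T⌋₊ := by
    rw [Finset.card_sigma]
    push_cast
    rw [add_mul, one_mul, Finset.sum_mul]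
    refine le_add_of_nonneg_of_le hφ0 (Finset.sum_le_sum fun p hp => ?_)
    obtain ⟨hp1, hD, hg⟩ := Finset.mem_filter.1 hp
    simp only [Finset.mem_product, Finset.mem_Icc] at hp1
    have hN : ((p.1 * p.2.1 : ℕ) : ℤ) ≠ 0 := by
      have : 0 < p.1 * p.2.1 := Nat.mul_pos hp1.1.1 hp1.2.1.1
      exact_mod_cast this.ne'
    refine (card_divisorPairs_le K _ _ hT).trans ?_
    have := hCf _ _ hN hD hg ⌊K * T⌋₊
    push_cast at this ⊢
    rw [mul_assoc]
    gcongr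
  calc ((zoomSet W T ε).encard : ℝ≥0∞) ≤ ((F.card : ℕ∞) : ℝ≥0∞) := by exact_mod_cast hcard
    _ = ENNReal.ofReal (F.card : ℝ) := by simp
    _ ≤ _ := ENNReal.ofReal_le_ofReal hF

/-- The open subset of the torus off the curves `u = 1`, `v = 1`, `u v = 1`. -/
def torusOpen : Set Y3 :=
  {P | ∃ u v : ℚ, P = pt u v ∧ u ≠ 0 ∧ v ≠ 0 ∧ u ≠ 1 ∧ v ≠ 1 ∧ u * v ≠ 1}

/-- `M` avoids the three curves excluded from the Liouville inequality: a cuspidal curve meets u = 1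
and v = 1 within the chart only at `Q`, and uv = 1 is the zero discriminant. -/
theorem M_ne_one {u v : ℚ} (h : pt u v ∈ M) : u ≠ 1 ∧ v ≠ 1 ∧ u * v ≠ 1 := by
  have h' := h
  obtain ⟨hQ, a, b, ⟨-, ha, hb, hab⟩, hP⟩ := h'
  rw [pt_mem_cuspCurve] at hP
  rw [Q_eq_pt, Ne, pt_inj] at hQ
  have ha' : (a : ℚ) ≠ 0 := by exact_mod_cast ha
  have hb' : (b : ℚ) ≠ 0 := by exact_mod_cast hb
  have h1 : u ≠ 1 := by
    rintro rfl
    have : (a : ℚ) ^ 2 * (v - 1) ^ 2 = 0 := by linear_combination hP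
    have : v = 1 := by simpa [ha', sub_eq_zero] using this
    exact hQ ⟨rfl, this⟩
  have h2 : v ≠ 1 := by
    rintro rfl
    have : (b : ℚ) ^ 2 * (u - 1) ^ 2 = 0 := by linear_combination hP
    have : u = 1 := by simpa [hb', sub_eq_zero] using this
    exact hQ ⟨this, rfl⟩
  refine ⟨h1, h2, fun huv => ?_⟩
  have hu0 : u ≠ 0 := by rintro rfl; simp at huv
  have hv0 : v ≠ 0 := by rintro rfl; simp at huv
  obtain ⟨q, hq, hq2⟩ := (pt_mem_M_iff hu0 hv0 h1 h2).1 h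
  rw [huv, sub_self] at hq2
  exact hq (pow_eq_zero_iff (two_ne_zero) |>.1 hq2.symm)

theorem floor_mul_pos_of_le {K : ℕ} (hK : 1 ≤ K) {T : ℝ} (hT : 1 ≤ T) : 1 ≤ ⌊K * T⌋₊ := by
  have hK' : (1 : ℝ) ≤ K := by exact_mod_cast hK
  exact Nat.le_floor (by push_cast; nlinarith)

theorem encard_zoomSet_M_le (ε : ℝ) : ∃ C : ℝ, 0 < C ∧ ∀ᶠ T : ℝ in atTop,
    ((zoomSet M T ε).encard : ℝ≥0∞) ≤ ENNReal.ofReal (C * (T * Real.log T)) := by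
  obtain ⟨K, C, hK, hC, h⟩ := encard_zoomSet_le (fun _ => True)
    (fun X => X * (1 + Real.log X)) ε fun N D hN hD _ => sum_card_rootSet_le_log hN hD
  have hK' : (1 : ℝ) ≤ K := by exact_mod_cast hK
  -- For T ≥ K and T ≥ exp 1 one has 1 + log⌊KT⌋ ≤ 1 + log K + log T ≤ 3 log T.
  refine ⟨C * (K * 3), by positivity, ?_⟩
  filter_upwards [eventually_ge_atTop (max 1 (2 * ε)), eventually_ge_atTop (K : ℝ),
    eventually_ge_atTop (Real.exp 1)] with T hT hTK hTe
  have hT1 : 1 ≤ T := (le_max_left _ _).trans hT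
  have hX := floor_mul_pos_of_le hK hT1
  have hX0 : (1 : ℝ) ≤ (⌊K * T⌋₊ : ℝ) := by exact_mod_cast hX
  have hXK : (⌊K * T⌋₊ : ℝ) ≤ K * T := Nat.floor_le (by positivity)
  have hlog : 1 ≤ Real.log T := by
    rw [← Real.log_exp 1]; exact Real.log_le_log (Real.exp_pos _) hTe
  have hlogK : Real.log K ≤ Real.log T := Real.log_le_log (by positivity) hTK
  have hlogX : Real.log ⌊K * T⌋₊ ≤ Real.log K + Real.log T := by
    rw [← Real.log_mul (by positivity) (by positivity)]
    exact Real.log_le_log (by positivity) hXK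
  refine (h T M (by positivity) ?_ ?_ ?_).trans (ENNReal.ofReal_le_ofReal ?_)
  · calc 2 * ε ≤ T := (le_max_right _ _).trans hT
      _ ≤ T ^ 2 := by nlinarith
  · have := Real.log_nonneg hX0; positivity
  · intro u v huv
    obtain ⟨h1, h2, h3⟩ := M_ne_one huv
    exact ⟨h1, h2, h3, fun _ _ _ _ _ _ _ => trivial⟩
  · have := Real.log_nonneg hX0
    calc C * (⌊K * T⌋₊ * (1 + Real.log ⌊K * T⌋₊)) ≤ C * ((K * T) * (3 * Real.log T)) := by
          gcongr
          linarith
      _ = _ := by ring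

/-- Since ND = (Ne)²(1 - uv), a square value of ND would put the point in `M`. Off `M` only
nonsquare ND occur, and the linear bound applies. -/
theorem encard_zoomSet_torusOpen_diff_le (ε : ℝ) : ∃ C : ℝ, 0 < C ∧ ∀ᶠ T : ℝ in atTop,
    ((zoomSet (torusOpen \ M) T ε).encard : ℝ≥0∞) ≤ ENNReal.ofReal (C * T) := by
  obtain ⟨K, C, hK, hC, h⟩ := encard_zoomSet_le (fun Δ => ¬ IsSquare Δ)
    (fun X => X) ε fun N D hN hD hsq => sum_card_rootSet_le_linear hN hD hsq
  have hK' : (1 : ℝ) ≤ K := by exact_mod_cast hK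
  refine ⟨C * K, by positivity, ?_⟩
  filter_upwards [eventually_ge_atTop (max 1 (2 * ε))] with T hT
  have hT1 : 1 ≤ T := (le_max_left _ _).trans hT
  have hXK : (⌊K * T⌋₊ : ℝ) ≤ K * T := Nat.floor_le (by positivity)
  refine (h T (torusOpen \ M) (by positivity) ?_ (by positivity) ?_).trans
    (ENNReal.ofReal_le_ofReal ?_)
  · calc 2 * ε ≤ T := (le_max_right _ _).trans hT
      _ ≤ T ^ 2 := by nlinarith
  · rintro u v ⟨⟨u', v', huv', hu0, hv0, hu1, hv1, huv1⟩, hM⟩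
    obtain ⟨rfl, rfl⟩ := pt_inj.1 huv'
    refine ⟨hu1, hv1, huv1, fun N e D hN he hD hDe hsq => hM ?_⟩
    rw [pt_mem_M_iff hu0 hv0 hu1 hv1]
    obtain ⟨x, hx⟩ := hsq
    have hN' : (N : ℚ) ≠ 0 := by exact_mod_cast (by omega : N ≠ 0)
    have he' : (e : ℚ) ≠ 0 := by exact_mod_cast (by omega : e ≠ 0)
    have hx' : (N : ℚ) * D = x * x := by exact_mod_cast hx
    have hx0 : (x : ℚ) ≠ 0 := by
      rintro h0
      rw [h0, mul_zero] at hx'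
      have : (D : ℚ) ≠ 0 := by exact_mod_cast hD
      exact mul_ne_zero hN' this hx'
    refine ⟨x / (N * e), div_ne_zero hx0 (mul_ne_zero hN' he'), ?_⟩
    rw [div_pow, eq_div_iff (pow_ne_zero 2 (mul_ne_zero hN' he'))]
    linear_combination hx' - (N : ℚ) * hDe
  · calc C * (⌊K * T⌋₊ : ℝ) ≤ C * (K * T) := by gcongr
      _ = _ := by ring

/-! ### A family of points of `M` -/

/-- The point with `x = y - 1`, `s = t - 1`, `y = e (e + m)`, `t = e (e + n)`. -/
def famPt (e m n : ℕ) : Y3 := pt (1 - 1 / (e * (e + m))) (1 - 1 / (e * (e + n)))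

/-- The family has the smallest possible invariants a = c = 1, k₁ = k₂ = -1, D = 1, with f = e + n
and g = e + m. Then uv = mn/e², so 1 - uv is visibly a square. -/
theorem famPt_mul {e m n : ℕ} (he : 2 ≤ e) (h : (m * n : ℚ) = e ^ 2 - 1) :
    (1 - 1 / (e * (e + m)) : ℚ) * (1 - 1 / (e * (e + n))) = 1 - 1 / e ^ 2 := by
  have he' : (0 : ℚ) < e := by exact_mod_cast (by omega : 0 < e)
  field_simp
  linear_combination h

theorem famPt_coord_ne {e m : ℕ} (he : 2 ≤ e) :
    (1 - 1 / (e * (e + m)) : ℚ) ≠ 0 ∧ (1 - 1 / (e * (e + m)) : ℚ) ≠ 1 := by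
  have he' : (2 : ℚ) ≤ e := by exact_mod_cast he
  have hm : (0 : ℚ) ≤ m := Nat.cast_nonneg m
  have h1 : (1 : ℚ) < e * (e + m) := by nlinarith
  constructor
  · intro h
    have : (1 : ℚ) / (e * (e + m)) = 1 := by linarith
    rw [div_eq_one_iff_eq (by positivity)] at this
    linarith
  · intro h
    have : (1 : ℚ) / (e * (e + m)) = 0 := by linarith
    have h2 : (0 : ℚ) < 1 / (e * (e + m)) := by positivity
    linarith

theorem famPt_mem_M {e m n : ℕ} (he : 2 ≤ e) (h : (m * n : ℚ) = e ^ 2 - 1) : famPt e m n ∈ M := by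
  obtain ⟨h1, h2⟩ := famPt_coord_ne (m := m) he
  obtain ⟨h3, h4⟩ := famPt_coord_ne (m := n) he
  rw [famPt, pt_mem_M_iff h1 h3 h2 h4, famPt_mul he h]
  have he' : (e : ℚ) ≠ 0 := by exact_mod_cast (by omega : e ≠ 0)
  exact ⟨1 / e, by positivity, by ring⟩

theorem norm_famPt_le {e m n : ℕ} (he : 2 ≤ e) : ‖toTangent (famPt e m n)‖ ≤ 1 / (e : ℝ) ^ 2 := by
  have he' : (0 : ℝ) < e := by exact_mod_cast (by omega : 0 < e)
  rw [famPt, norm_toTangent_pt]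
  have key : ∀ k : ℕ, |((1 - 1 / (e * (e + k)) : ℚ) : ℝ) - 1| ≤ 1 / (e : ℝ) ^ 2 := by
    intro k
    push_cast
    rw [show (1 - 1 / ((e : ℝ) * (e + k))) - 1 = -(1 / (e * (e + k))) by ring, abs_neg,
      abs_of_nonneg (by positivity)]
    apply one_div_le_one_div_of_le (by positivity)
    have : (0 : ℝ) ≤ k := Nat.cast_nonneg k
    nlinarith
  exact max_le (key m) (key n)

/-- From mf + 1 = eg and ng + 1 = ef, the monomial e³fg of the section y²t² dominates the other
five. An upper bound needs no primitivity. -/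
theorem height_famPt_le {e m n : ℕ} (he : 2 ≤ e) (h : m * n + 1 = e ^ 2) :
    height (famPt e m n) ≤ (e : ℝ) ^ 3 * (e + n) * (e + m) := by
  obtain ⟨f, hf⟩ : ∃ f, f = e + n := ⟨_, rfl⟩
  obtain ⟨g, hg⟩ : ∃ g, g = e + m := ⟨_, rfl⟩
  have e1 : m * f + 1 = e * g := by rw [hf, hg]; linear_combination h
  have e2 : n * g + 1 = e * f := by rw [hf, hg]; linear_combination h
  have he0 : 0 < e := by omega
  have hf0 : 0 < f := by omega
  have hg0 : 0 < g := by omega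
  have heQ : (e : ℚ) ≠ 0 := by exact_mod_cast he0.ne'
  have hfQ : (f : ℚ) ≠ 0 := by exact_mod_cast hf0.ne'
  have hgQ : (g : ℚ) ≠ 0 := by exact_mod_cast hg0.ne'
  have e1Q : (m * f + 1 : ℚ) = e * g := by exact_mod_cast e1
  have e2Q : (n * g + 1 : ℚ) = e * f := by exact_mod_cast e2
  have hu : (1 - 1 / (e * (e + m)) : ℚ) = m * f / (e * g) := by
    rw [show (e + m : ℚ) = g by rw [hg]; push_cast; ring, eq_div_iff (by positivity), sub_mul,
      div_mul_cancel₀ _ (by positivity)]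
    linarith
  have hv : (1 - 1 / (e * (e + n)) : ℚ) = n * g / (e * f) := by
    rw [show (e + n : ℚ) = f by rw [hf]; push_cast; ring, eq_div_iff (by positivity), sub_mul,
      div_mul_cancel₀ _ (by positivity)]
    linarith
  have hR : (e : ℝ) ^ 3 * (e + n) * (e + m) = ((e ^ 3 * f * g : ℕ) : ℝ) := by
    rw [hf, hg]; push_cast; ring
  have m1 : m * f ≤ e * g := by omega
  have m2 : n * g ≤ e * f := by omega
  let X : Fin 6 → ℕ := ![f ^ 2 * m ^ 2 * n, e ^ 2 * g ^ 2 * n, e ^ 2 * f ^ 2 * m, g ^ 2 * n ^ 2 * m,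
    e * f * m * n * g, e ^ 3 * f * g]
  rw [famPt, hu, hv, hR, height_pt_of_smul (c := (e ^ 3 * f * g : ℚ)) (by positivity)
    (fun i => (X i : ℤ))]
  · refine mulHeight_le_of_abs_le (fun i => (X i : ℤ)) ?_ _ fun i => ?_
    · intro h0
      have h5 : ((X 5 : ℕ) : ℤ) = 0 := congrFun h0 5
      have : X 5 = 0 := by exact_mod_cast h5
      have : e ^ 3 * f * g = 0 := this
      have h1 : 0 < e ^ 3 * f * g := by positivity
      omega
    · rw [Int.cast_natCast, Nat.abs_cast, Nat.cast_le]
      fin_cases i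
      · calc f ^ 2 * m ^ 2 * n = (m * f) * (m * f) * n := by ring
          _ ≤ (e * g) * (e * g) * n := by gcongr
          _ = e * e * g * (n * g) := by ring
          _ ≤ e * e * g * (e * f) := by gcongr
          _ = e ^ 3 * f * g := by ring
      · calc e ^ 2 * g ^ 2 * n = e * e * g * (n * g) := by ring
          _ ≤ e * e * g * (e * f) := by gcongr
          _ = e ^ 3 * f * g := by ring
      · calc e ^ 2 * f ^ 2 * m = e * e * f * (m * f) := by ring
          _ ≤ e * e * f * (e * g) := by gcongr
          _ = e ^ 3 * f * g := by ring
      · calc g ^ 2 * n ^ 2 * m = (n * g) * (n * g) * m := by ring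
          _ ≤ (e * f) * (e * f) * m := by gcongr
          _ = e * e * f * (m * f) := by ring
          _ ≤ e * e * f * (e * g) := by gcongr
          _ = e ^ 3 * f * g := by ring
      · calc e * f * m * n * g = e * (m * f) * (n * g) := by ring
          _ ≤ e * (e * g) * (e * f) := by gcongr
          _ = e ^ 3 * f * g := by ring
      · exact le_rfl
  · intro i
    fin_cases i <;> simp [X, chartSections] <;> field_simp

theorem famPt_inj {e m n e' m' n' : ℕ} (he : 2 ≤ e) (he' : 2 ≤ e')
    (h : (m * n : ℚ) = e ^ 2 - 1) (h' : (m' * n' : ℚ) = e' ^ 2 - 1)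
    (heq : famPt e m n = famPt e' m' n') : e = e' ∧ m = m' := by
  obtain ⟨h1, h2⟩ := pt_inj.1 heq
  have h3 := famPt_mul he h
  have h4 := famPt_mul he' h'
  rw [h1, h2, h4] at h3
  have e1 : (e' : ℚ) ^ 2 = e ^ 2 := by
    have : (1 : ℚ) / e' ^ 2 = 1 / e ^ 2 := by linarith
    simpa using this
  have e2 : e' = e := by
    have : (e' : ℚ) = e := (pow_left_inj₀ (by positivity) (by positivity) two_ne_zero).1 e1
    exact_mod_cast this
  subst e2
  refine ⟨rfl, ?_⟩
  have he0 : (0 : ℚ) < e' := by exact_mod_cast (by omega : 0 < e')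
  have h5 : (1 : ℚ) / (e' * (e' + m)) = 1 / (e' * (e' + m')) := by linarith
  rw [one_div, one_div, inv_inj] at h5
  have h6 := mul_left_cancel₀ he0.ne' h5
  have h7 : (m : ℚ) = m' := by linarith
  exact_mod_cast h7

/-! ### Counting the family -/

/-- The coprime pairs `r < j ≤ 2 r`. -/
def coprimePairs (R : ℕ) : Finset (Σ _ : ℕ, ℕ) :=
  (Finset.Icc 1 R).sigma fun r => (Finset.Ico (r + 1) (r + 1 + r)).filter r.Coprime

/-- The third parameters `s` belonging to the pair `(r, j)`. -/
noncomputable def sValues (T : ℝ) (r j : ℕ) : Finset ℕ :=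
  open Classical in
  (Finset.range (⌊T⌋₊ + 1)).filter fun s => r ∣ s * j - 2 ∧ T / 4 + 1 ≤ (s * j : ℕ) ∧
    ((s * j : ℕ) : ℝ) ≤ T / 2 + 1

theorem exists_mem_block {r j : ℕ} (hr : 0 < r) (h : r.Coprime j) (A : ℕ) :
    ∃ σ < r, ((r : ℕ) : ℤ) ∣ ((A + σ : ℕ) : ℤ) * j - 2 := by
  obtain ⟨x, y, hxy⟩ := (Nat.isCoprime_iff_coprime.2 h)
  -- `y * j ≡ 1` modulo `r`
  have hr' : (0 : ℤ) < r := by exact_mod_cast hr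
  obtain ⟨σ, hσ⟩ : ∃ σ : ℕ, (2 * y - A) % (r : ℤ) = σ :=
    Int.eq_ofNat_of_zero_le (Int.emod_nonneg _ hr'.ne')
  refine ⟨σ, ?_, ?_⟩
  · have := Int.emod_lt_of_pos (2 * y - A) hr'
    rw [hσ] at this
    exact_mod_cast this
  · have h1 := Int.emod_add_mul_ediv (2 * y - A) r
    rw [hσ] at h1
    refine ⟨-(((2 * y - A) / r) * j) - 2 * x, ?_⟩
    push_cast
    linear_combination (j : ℤ) * h1 + 2 * hxy

/-- The admissible s fill one residue class modulo r in an interval of length T/(4j). As j ≤ 2r and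
8r² ≤ T, the expected number T/(4jr) is at least 1, so rounding down costs at most a factor 2. -/
theorem card_sValues_ge {T : ℝ} {r j R : ℕ} (hr : 1 ≤ r) (hrR : r ≤ R) (hR : (8 * R ^ 2 : ℝ) ≤ T)
    (hrj : r < j) (hj : j ≤ 2 * r) (h : r.Coprime j) :
    T / (16 * (r : ℝ) ^ 2) ≤ (sValues T r j).card := by
  classical
  have hrp : (1 : ℝ) ≤ r := by exact_mod_cast hr
  have hjp : (1 : ℝ) ≤ j := by exact_mod_cast (by omega : 1 ≤ j)
  have hj2 : (j : ℝ) ≤ 2 * r := by exact_mod_cast hj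
  have hrR' : (r : ℝ) ≤ R := by exact_mod_cast hrR
  have hT8 : 8 * (r : ℝ) ^ 2 ≤ T := le_trans (by gcongr) hR
  have hT0 : 8 ≤ T := by nlinarith
  set A := ⌈(T / 4 + 1) / j⌉₊ with hA
  obtain ⟨σ, hσ, hdvd⟩ := exists_mem_block (by omega) h A
  set n₀ := ⌊T / (4 * j * r)⌋₊ with hn₀
  have hA1 : T / 4 + 1 ≤ A * j := by
    have := Nat.le_ceil ((T / 4 + 1) / j)
    rwa [div_le_iff₀ (by positivity)] at this
  have hA2 : (A : ℝ) * j ≤ T / 4 + 1 + j := by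
    have := (Nat.ceil_lt_add_one (show 0 ≤ (T / 4 + 1) / j by positivity)).le
    calc (A : ℝ) * j ≤ ((T / 4 + 1) / j + 1) * j := by gcongr
      _ = _ := by field_simp
  have hn₀' : (n₀ : ℝ) * (4 * j * r) ≤ T := by
    have := Nat.floor_le (show 0 ≤ T / (4 * j * r) by positivity)
    rwa [le_div_iff₀ (by positivity)] at this
  have hsub : (Finset.range n₀).image (fun i => A + σ + r * i) ⊆ sValues T r j := by
    intro s hs
    obtain ⟨i, hi, rfl⟩ := Finset.mem_image.1 hs
    have hi' : (i : ℝ) + 1 ≤ n₀ := by exact_mod_cast (Finset.mem_range.1 hi)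
    have hσ' : (σ : ℝ) + 1 ≤ r := by exact_mod_cast hσ
    have hlow : T / 4 + 1 ≤ ((A + σ + r * i) * j : ℕ) := by
      push_cast
      have : (0 : ℝ) ≤ (σ + r * i) * j := by positivity
      nlinarith
    have hup : (((A + σ + r * i) * j : ℕ) : ℝ) ≤ T / 2 + 1 := by
      push_cast
      have h1 : (σ : ℝ) + r * i + 1 ≤ r * n₀ := by nlinarith
      have h2 : ((σ : ℝ) + r * i + 1) * j ≤ (r * n₀) * j := by gcongr
      nlinarith
    refine Finset.mem_filter.2 ⟨Finset.mem_range.2 ?_, ?_, hlow, hup⟩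
    · refine Nat.lt_succ_of_le (Nat.le_floor ?_)
      have : ((A + σ + r * i : ℕ) : ℝ) ≤ ((A + σ + r * i) * j : ℕ) := by
        exact_mod_cast Nat.le_mul_of_pos_right _ (by omega)
      linarith
    · have h2 : 2 ≤ (A + σ + r * i) * j := by
        have : (2 : ℝ) ≤ ((A + σ + r * i) * j : ℕ) := by linarith
        exact_mod_cast this
      have : ((r : ℕ) : ℤ) ∣ (((A + σ + r * i) * j - 2 : ℕ) : ℤ) := by
        push_cast [Nat.cast_sub h2]
        calc (r : ℤ) ∣ (((A + σ : ℕ) : ℤ) * j - 2) + r * (i * j) :=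
              dvd_add hdvd (dvd_mul_right _ _)
          _ = _ := by push_cast; ring
      exact_mod_cast this
  have hcard : n₀ ≤ (sValues T r j).card := by
    refine le_trans (le_of_eq ?_) (Finset.card_le_card hsub)
    rw [Finset.card_image_of_injective, Finset.card_range]
    intro a b hab
    have : r * a = r * b := by simpa using hab
    exact Nat.eq_of_mul_eq_mul_left (by omega) this
  have h1 : 1 ≤ T / (4 * j * r) := by
    rw [le_div_iff₀ (by positivity)]
    nlinarith
  have h2 : T / (4 * j * r) / 2 ≤ n₀ := by
    have := Nat.lt_floor_add_one (T / (4 * j * r))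
    have h3 : (1 : ℝ) ≤ n₀ := Nat.one_le_cast.2 ((Nat.one_le_floor_iff _).2 h1)
    linarith
  calc T / (16 * (r : ℝ) ^ 2) ≤ T / (4 * j * r) / 2 := by
        rw [div_div]
        refine div_le_div_of_nonneg_left (by linarith) (by positivity) ?_
        nlinarith
    _ ≤ n₀ := h2
    _ ≤ _ := by exact_mod_cast hcard

theorem sum_divisors_le (g : ℕ → ℕ → ℝ) (hg : ∀ d k, 0 ≤ g d k) (R : ℕ) :
    ∑ n ∈ Finset.Icc 1 R, ∑ d ∈ n.divisors, g d (n / d) ≤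
      ∑ p ∈ Finset.Icc 1 R ×ˢ Finset.Icc 1 R, g p.1 p.2 := by
  rw [Finset.sum_sigma']
  set S := (Finset.Icc 1 R).sigma fun n => n.divisors
  have hS : ∀ x ∈ S, 0 < x.2 ∧ 0 < x.1 ∧ x.1 ≤ R ∧ x.2 * (x.1 / x.2) = x.1 := by
    intro x hx
    obtain ⟨h1, h2⟩ := Finset.mem_sigma.1 hx
    obtain ⟨h3, h4⟩ := Finset.mem_Icc.1 h1
    exact ⟨Nat.pos_of_mem_divisors h2, h3, h4, Nat.mul_div_cancel' (Nat.dvd_of_mem_divisors h2)⟩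
  let i : (Σ _ : ℕ, ℕ) → ℕ × ℕ := fun x => (x.2, x.1 / x.2)
  have hinj : Set.InjOn i S := by
    rintro ⟨a, b⟩ hx ⟨a', b'⟩ hy hxy
    simp only [i, Prod.mk.injEq] at hxy
    obtain ⟨-, -, -, h1⟩ := hS _ hx
    obtain ⟨-, -, -, h2⟩ := hS _ hy
    simp only at h1 h2
    obtain ⟨rfl, h3⟩ := hxy
    rw [h3, h2] at h1
    rw [h1]
  calc ∑ x ∈ S, g x.2 (x.1 / x.2) = ∑ p ∈ S.image i, g p.1 p.2 :=
        (Finset.sum_image (f := fun p : ℕ × ℕ => g p.1 p.2) hinj).symm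
    _ ≤ _ := by
        refine Finset.sum_le_sum_of_subset_of_nonneg (fun p hp => ?_) fun p _ _ => hg _ _
        obtain ⟨x, hx, rfl⟩ := Finset.mem_image.1 hp
        obtain ⟨h1, h2, h3, h4⟩ := hS x hx
        have h5 : 0 < x.1 / x.2 := Nat.pos_of_ne_zero fun h => by rw [h] at h4; omega
        refine Finset.mem_product.2 ⟨Finset.mem_Icc.2 ⟨h1, ?_⟩, Finset.mem_Icc.2 ⟨h5, ?_⟩⟩
        · exact (Nat.le_of_dvd h2 ⟨_, h4.symm⟩).trans h3
        · exact (Nat.div_le_self _ _).trans h3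

/-- Insert n = ∑_{d ∣ n} φ(d) into 1/n = n/n² and write n = dk: the harmonic sum is at most ∑
φ(d)/d² times ∑ 1/k², and the latter is at most 2. -/
theorem sum_totient_div_sq (R : ℕ) :
    Real.log (R + 1) ≤ 2 * ∑ r ∈ Finset.Icc 1 R, (r.totient : ℝ) / (r : ℝ) ^ 2 := by
  have h1 : Real.log (R + 1) ≤ (harmonic R : ℝ) := by exact_mod_cast log_add_one_le_harmonic R
  refine h1.trans ?_
  rw [harmonic_eq_sum_Icc]
  push_cast
  have hsq : ∀ k : ℕ, ∑ i ∈ Finset.Icc 1 k, (1 : ℝ) / (i : ℝ) ^ 2 ≤ 2 := by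
    intro k
    have : ∀ k : ℕ, 1 ≤ k → ∑ i ∈ Finset.Icc 1 k, (1 : ℝ) / (i : ℝ) ^ 2 ≤ 2 - 1 / k := by
      intro k hk
      induction k, hk using Nat.le_induction with
      | base => simp; norm_num
      | succ k hk ih =>
        rw [Finset.sum_Icc_succ_top (by omega)]
        have hk' : (1 : ℝ) ≤ k := by exact_mod_cast hk
        have : (1 : ℝ) / ((k + 1 : ℕ) : ℝ) ^ 2 ≤ 1 / k - 1 / ((k + 1 : ℕ) : ℝ) := by
          push_cast
          rw [div_sub_div _ _ (by positivity) (by positivity),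
            div_le_div_iff₀ (by positivity) (by positivity)]
          nlinarith
        linarith
    rcases Nat.eq_zero_or_pos k with rfl | hk
    · simp
    · have := this k hk
      have h0 : (0 : ℝ) ≤ 1 / k := by positivity
      linarith
  calc ∑ n ∈ Finset.Icc 1 R, ((n : ℝ))⁻¹
      = ∑ n ∈ Finset.Icc 1 R, ∑ d ∈ n.divisors, (d.totient : ℝ) / (n : ℝ) ^ 2 := by
        refine Finset.sum_congr rfl fun n hn => ?_
        have hn0 : (n : ℝ) ≠ 0 := by
          have := (Finset.mem_Icc.1 hn).1
          exact_mod_cast (by omega : n ≠ 0)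
        rw [← Finset.sum_div, ← Nat.cast_sum, Nat.sum_totient]
        field_simp
    _ ≤ ∑ p ∈ Finset.Icc 1 R ×ˢ Finset.Icc 1 R,
          (p.1.totient : ℝ) / (p.1 : ℝ) ^ 2 * (1 / (p.2 : ℝ) ^ 2) := by
        refine le_trans (le_of_eq ?_) (sum_divisors_le
          (fun d k => (d.totient : ℝ) / (d : ℝ) ^ 2 * (1 / (k : ℝ) ^ 2))
          (fun d k => by positivity) R)
        refine Finset.sum_congr rfl fun n hn => Finset.sum_congr rfl fun d hd => ?_
        have h4 := Nat.mul_div_cancel' (Nat.dvd_of_mem_divisors hd)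
        have h5 : (n : ℝ) = d * ((n / d : ℕ) : ℝ) := by exact_mod_cast h4.symm
        rw [h5, mul_pow, div_mul_div_comm, mul_one]
    _ = ∑ r ∈ Finset.Icc 1 R, (r.totient : ℝ) / (r : ℝ) ^ 2 *
          ∑ k ∈ Finset.Icc 1 R, 1 / (k : ℝ) ^ 2 := by
        rw [Finset.sum_product]
        simp_rw [Finset.mul_sum]
    _ ≤ ∑ r ∈ Finset.Icc 1 R, (r.totient : ℝ) / (r : ℝ) ^ 2 * 2 := by
        gcongr
        exact hsq R
    _ = _ := by rw [← Finset.sum_mul, mul_comm]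

/-! ### The family and a fixed curve -/

theorem exists_eval_ne_zero {p : Polynomial ℚ} (hp : p ≠ 0) : ∃ x : ℚ, x ≠ 0 ∧ p.eval x ≠ 0 := by
  by_contra! h
  have : p * Polynomial.X = 0 := by
    apply Polynomial.funext
    intro x
    rcases eq_or_ne x 0 with rfl | hx
    · simp
    · simp [h x hx]
  rcases mul_eq_zero.1 this with h1 | h1
  · exact hp h1
  · exact Polynomial.X_ne_zero h1

/-- A curve meets `u v = 1 - 1 / e²` in boundedly many points, for all large `e`. -/
theorem exists_roots_on_hyperbola {F : Polynomial (Polynomial ℚ)} (hF : F ≠ 0) :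
    ∃ d E₀ : ℕ, ∀ e : ℕ, E₀ ≤ e → ∃ Z : Finset ℚ, Z.card ≤ d ∧
      ∀ u v : ℚ, u ≠ 0 → u * v = 1 - 1 / (e : ℚ) ^ 2 → F.evalEval u v = 0 → u ∈ Z := by
  classical
  set n := F.natDegree
  set D₀ := ((Finset.range (n + 1)).sup fun j => (F.coeff j).natDegree) + n with hD₀
  obtain ⟨x₀, hx₀, hlead⟩ := exists_eval_ne_zero (Polynomial.leadingCoeff_ne_zero.2 hF)
  -- `Pc c` is u^n F(u, c/u), the equation of the curve on uv = c with denominators cleared; `Qp` is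
  -- its value at u = x₀ as a polynomial in c. The coefficient of c^n in `Qp` is the leading
  -- coefficient of F at x₀, so `Qp` is nonzero and `Pc c` vanishes identically for only finitely
  -- many c = 1 - 1/e².
  let Pc : ℚ → Polynomial ℚ := fun c => ∑ j ∈ Finset.range (n + 1),
    F.coeff j * Polynomial.C (c ^ j) * Polynomial.X ^ (n - j)
  let Qp : Polynomial ℚ := ∑ j ∈ Finset.range (n + 1),
    Polynomial.C ((F.coeff j).eval x₀ * x₀ ^ (n - j)) * Polynomial.X ^ j
  have hQ0 : Qp ≠ 0 := by
    intro h
    have h1 : Qp.coeff n = F.leadingCoeff.eval x₀ := by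
      simp only [Qp, Polynomial.finsetSum_coeff, Polynomial.coeff_C_mul_X_pow]
      rw [Finset.sum_eq_single n]
      · rw [if_pos rfl, Nat.sub_self, pow_zero, mul_one]; rfl
      · intro j _ hj
        simp [Ne.symm hj]
      · intro h; simp at h
    rw [h, Polynomial.coeff_zero] at h1
    exact hlead h1.symm
  have hPQ : ∀ c, (Pc c).eval x₀ = Qp.eval c := by
    intro c
    simp only [Pc, Qp, Polynomial.eval_finsetSum, Polynomial.eval_mul, Polynomial.eval_C,
      Polynomial.eval_pow, Polynomial.eval_X]
    exact Finset.sum_congr rfl fun j _ => by ring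
  have hdeg : ∀ c, (Pc c).natDegree ≤ D₀ := by
    intro c
    refine Polynomial.natDegree_sum_le_of_forall_le _ _ fun j hj => ?_
    refine Polynomial.natDegree_mul_le.trans ?_
    rw [Polynomial.natDegree_X_pow]
    refine Nat.add_le_add ((Polynomial.natDegree_mul_C_le _ _).trans ?_) (Nat.sub_le _ _)
    exact Finset.le_sup (f := fun j => (F.coeff j).natDegree) hj
  have hfin : {e : ℕ | (1 - 1 / (e : ℚ) ^ 2) ∈ Qp.roots.toFinset}.Finite := by
    refine Set.Finite.preimage ?_ (Finset.finite_toSet _)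
    intro a _ b _ hab
    have h1 : (1 : ℚ) / (a : ℚ) ^ 2 = 1 / (b : ℚ) ^ 2 := by
      simp only at hab; linarith
    rw [one_div, one_div, inv_inj] at h1
    have h2 : (a : ℚ) = b := (pow_left_inj₀ (by positivity) (by positivity) two_ne_zero).1 h1
    exact_mod_cast h2
  obtain ⟨E, hE⟩ := hfin.bddAbove
  refine ⟨D₀, E + 1, fun e he => ?_⟩
  set c : ℚ := 1 - 1 / (e : ℚ) ^ 2 with hc
  have hPc : Pc c ≠ 0 := by
    intro h
    have h1 : Qp.eval c = 0 := by rw [← hPQ, h, Polynomial.eval_zero]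
    have : e ≤ E := hE (show _ ∈ Qp.roots.toFinset from
      Multiset.mem_toFinset.2 ((Polynomial.mem_roots hQ0).2 h1))
    omega
  refine ⟨(Pc c).roots.toFinset, (Multiset.toFinset_card_le _).trans
    ((Polynomial.card_roots' _).trans (hdeg c)), fun u v hu huv h => ?_⟩
  rw [Multiset.mem_toFinset, Polynomial.mem_roots hPc, Polynomial.IsRoot]
  have h2 : (Pc c).eval u = u ^ n * F.evalEval u v := by
    simp only [Pc, Polynomial.evalEval, Polynomial.eval_eq_sum_range (p := F),
      Polynomial.eval_finsetSum, Polynomial.eval_mul, Polynomial.eval_C,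
      Polynomial.eval_pow, Polynomial.eval_X, Finset.mul_sum]
    refine Finset.sum_congr rfl fun j hj => ?_
    have hj' : j ≤ n := Nat.lt_succ_iff.1 (Finset.mem_range.1 hj)
    rw [← huv, mul_pow]
    have : u ^ n = u ^ j * u ^ (n - j) := by rw [← pow_add, Nat.add_sub_cancel' hj']
    rw [this]; ring
  rw [h2, h, mul_zero]

/-- The parameters `((r, j), s)` of the points of the family used for the lower bound. -/
noncomputable def famParams (T : ℝ) (R : ℕ) : Finset (Σ _ : (Σ _ : ℕ, ℕ), ℕ) :=
  (coprimePairs R).sigma fun p => sValues T p.1 p.2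

/-- The integers `e`, `m`, `n` attached to the parameters `r`, `j`, `s`. -/
structure FamData (T : ℝ) (r j s e m n : ℕ) : Prop where
  e_eq : e + 1 = s * j
  m_eq : m = r * s
  two_le : 2 ≤ e
  coprime : r.Coprime j
  mul_eq : m * n + 1 = e ^ 2
  m_le : m ≤ e
  n_le : n ≤ 2 * e
  le_e : T / 4 ≤ e
  e_le : (e : ℝ) ≤ T / 2

/-- Factor e + 1 = sj and e - 1 = ri, and regroup (e - 1)(e + 1) as m = rs times n = ji. The
condition r < j ≤ 2r gives m ≤ e and n ≤ 2e. -/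
theorem exists_famData {T : ℝ} (hT : 8 ≤ T) {R : ℕ} {x : Σ _ : (Σ _ : ℕ, ℕ), ℕ}
    (hx : x ∈ famParams T R) : FamData T x.1.1 x.1.2 x.2 (x.2 * x.1.2 - 1) (x.1.1 * x.2)
      (x.1.2 * ((x.2 * x.1.2 - 2) / x.1.1)) := by
  classical
  obtain ⟨⟨r, j⟩, s⟩ := x
  obtain ⟨h1, h2⟩ := Finset.mem_sigma.1 hx
  obtain ⟨h3, h4⟩ := Finset.mem_sigma.1 h1
  obtain ⟨h5, h6⟩ := Finset.mem_filter.1 h4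
  simp only [Finset.mem_Ico] at h5
  simp only at h2 h3 h6 ⊢
  obtain ⟨h7, h8, h9, h10⟩ := Finset.mem_filter.1 h2
  obtain ⟨h11, h12⟩ := Finset.mem_Icc.1 h3
  have hS : 3 ≤ s * j := by
    have : (3 : ℝ) ≤ (s * j : ℕ) := by linarith
    exact_mod_cast this
  have hs : 1 ≤ s := Nat.pos_of_ne_zero (by rintro rfl; simp at hS)
  obtain ⟨i, hi⟩ := h8
  have hdiv : (s * j - 2) / r = i := by rw [hi]; exact Nat.mul_div_cancel_left _ (by omega)
  rw [hdiv]
  have hi' : s * j = r * i + 2 := by omega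
  have he : s * j - 1 = r * i + 1 := by omega
  have hmul : r * s * (j * i) + 1 = (s * j - 1) ^ 2 := by
    rw [he]
    calc r * s * (j * i) + 1 = (r * i) * (s * j) + 1 := by ring
      _ = (r * i + 1) ^ 2 := by rw [hi']; ring
  have hm : r * s ≤ s * j - 1 := by
    have : r * s + s ≤ s * j := by
      calc r * s + s = s * (r + 1) := by ring
        _ ≤ s * j := Nat.mul_le_mul_left _ h5.1
    omega
  have hcast : ((s * j - 1 : ℕ) : ℝ) = ((s * j : ℕ) : ℝ) - 1 := by
    rw [Nat.cast_sub (by omega)]; simp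
  refine ⟨by omega, rfl, by omega, h6, hmul, hm, ?_, ?_, ?_⟩
  · have : j * i ≤ (2 * r) * i := Nat.mul_le_mul_right _ (by omega)
    calc j * i ≤ 2 * (r * i) := by rw [← mul_assoc]; exact this
      _ ≤ _ := by omega
  · rw [hcast]; linarith
  · rw [hcast]; linarith

/-- The point of the family with given parameters. -/
def famPoint (x : Σ _ : (Σ _ : ℕ, ℕ), ℕ) : Y3 :=
  famPt (x.2 * x.1.2 - 1) (x.1.1 * x.2) (x.1.2 * ((x.2 * x.1.2 - 2) / x.1.1))

theorem FamData.mul_eq_rat {T : ℝ} {r j s e m n : ℕ} (h : FamData T r j s e m n) :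
    (m * n : ℚ) = e ^ 2 - 1 := by
  have : (m * n + 1 : ℚ) = e ^ 2 := by exact_mod_cast h.mul_eq
  linarith

/-- The range T/4 ≤ e ≤ T/2 suits both conditions: the height is at most 6e^5 ≤ (6/32)T^5, and T²/e²
≤ 16, which is the source of the radius 16. -/
theorem FamData.mem_zoomSet {T : ℝ} (hT : 0 < T) {r j s e m n : ℕ} (h : FamData T r j s e m n)
    {W : Set Y3} (hW : famPt e m n ∈ W) {ε : ℝ} (hε : 16 ≤ ε) : famPt e m n ∈ zoomSet W T ε := by
  have he : (0 : ℝ) < e := by exact_mod_cast (by have := h.two_le; omega : 0 < e)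
  refine ⟨hW, pt_mem_chart _ _, ?_, ?_⟩
  · refine (height_famPt_le h.two_le h.mul_eq).trans ?_
    have h1 : (m : ℝ) ≤ e := by exact_mod_cast h.m_le
    have h2 : (n : ℝ) ≤ 2 * e := by exact_mod_cast h.n_le
    calc (e : ℝ) ^ 3 * (e + n) * (e + m) ≤ (e : ℝ) ^ 3 * (e + 2 * e) * (e + e) := by gcongr
      _ = 6 * (e : ℝ) ^ 5 := by ring
      _ ≤ 6 * (T / 2) ^ 5 := by gcongr; exact h.e_le
      _ = 6 / 32 * T ^ 5 := by ring
      _ ≤ 1 * T ^ 5 := by gcongr; norm_num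
      _ = T ^ 5 := one_mul _
  · calc T ^ 2 * ‖toTangent (famPt e m n)‖ ≤ T ^ 2 * (1 / (e : ℝ) ^ 2) := by
          gcongr; exact norm_famPt_le h.two_le
      _ = (T / e) ^ 2 := by ring
      _ ≤ 4 ^ 2 := by
          gcongr
          rw [div_le_iff₀ he]; linarith [h.le_e]
      _ ≤ ε := by linarith

/-- A point determines e (from uv) and m; then s = gcd(rs, sj) = gcd(m, e + 1) because r and j are
coprime, and r, j follow. -/
theorem famPoint_injOn {T : ℝ} (hT : 8 ≤ T) (R : ℕ) :
    Set.InjOn famPoint (famParams T R : Set (Σ _ : (Σ _ : ℕ, ℕ), ℕ)) := by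
  intro x hx y hy hxy
  have dx := exists_famData hT hx
  have dy := exists_famData hT hy
  obtain ⟨h1, h2⟩ := famPt_inj dx.two_le dy.two_le dx.mul_eq_rat dy.mul_eq_rat hxy
  obtain ⟨⟨r, j⟩, s⟩ := x
  obtain ⟨⟨r', j'⟩, s'⟩ := y
  simp only at h1 h2 dx dy
  have h3 : s * j = s' * j' := by have := dx.e_eq; have := dy.e_eq; omega
  have key : ∀ {r j s : ℕ}, r.Coprime j → (r * s).gcd (s * j) = s := by
    intro r j s h
    rw [mul_comm r s, Nat.gcd_mul_left, h, mul_one]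
  have hs : s = s' := by
    calc s = (r * s).gcd (s * j) := (key dx.coprime).symm
      _ = (r' * s').gcd (s' * j') := by rw [h2, h3]
      _ = s' := key dy.coprime
  subst hs
  have hs0 : 0 < s := Nat.pos_of_ne_zero (by
    rintro rfl
    have := dx.e_eq
    simp at this)
  rw [Nat.eq_of_mul_eq_mul_right hs0 h2, Nat.eq_of_mul_eq_mul_left hs0 h3]

/-- The j attached to r are the integers prime to r among r consecutive ones, so there are φ(r),
each with at least T/(16r²) values of s; the sum of φ(r)/r² produces the logarithm. -/
theorem card_famParams_ge {T : ℝ} {R : ℕ} (hR : (8 * R ^ 2 : ℝ) ≤ T) (hT : 0 ≤ T) :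
    T / 32 * Real.log (R + 1) ≤ (famParams T R).card := by
  rw [famParams, Finset.card_sigma]
  push_cast
  calc T / 32 * Real.log (R + 1)
      ≤ T / 32 * (2 * ∑ r ∈ Finset.Icc 1 R, (r.totient : ℝ) / (r : ℝ) ^ 2) := by
        gcongr; exact sum_totient_div_sq R
    _ = ∑ r ∈ Finset.Icc 1 R, (r.totient : ℝ) * (T / (16 * (r : ℝ) ^ 2)) := by
        rw [Finset.mul_sum, Finset.mul_sum]
        exact Finset.sum_congr rfl fun r _ => by ring
    _ = ∑ p ∈ coprimePairs R, T / (16 * (p.1 : ℝ) ^ 2) := by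
        rw [coprimePairs, Finset.sum_sigma]
        refine Finset.sum_congr rfl fun r _ => ?_
        dsimp only
        rw [Finset.sum_const, nsmul_eq_mul]
        congr 2
        exact (Nat.filter_coprime_Ico_eq_totient r (r + 1)).symm
    _ ≤ _ := by
        refine Finset.sum_le_sum fun p hp => ?_
        obtain ⟨h3, h4⟩ := Finset.mem_sigma.1 hp
        obtain ⟨h5, h6⟩ := Finset.mem_filter.1 h4
        rw [Finset.mem_Ico] at h5
        rw [Finset.mem_Icc] at h3
        exact card_sValues_ge h3.1 h3.2 hR (by omega) (by omega) h6

/-- The family has order T log T, while the curve F = 0 removes boundedly many points for each e ≤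
T/2, hence O(T). The threshold for T does not depend on the set W nor on ε. -/
theorem exists_lower_bound {F : Polynomial (Polynomial ℚ)} (hF : F ≠ 0) :
    ∃ C : ℝ, 0 < C ∧ ∀ᶠ T : ℝ in atTop, ∀ W : Set Y3,
      (∀ u v : ℚ, pt u v ∈ M → F.evalEval u v ≠ 0 → pt u v ∈ W) → ∀ ε : ℝ, 16 ≤ ε →
      ENNReal.ofReal (T / 64 * Real.log (T / 8) - C * T) ≤ (zoomSet W T ε).encard := by
  classical
  obtain ⟨d, E₀, hd⟩ := exists_roots_on_hyperbola hF
  choose! Z hZcard hZ using hd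
  refine ⟨d + 1, by positivity, ?_⟩
  filter_upwards [eventually_ge_atTop 8, eventually_ge_atTop (4 * (E₀ : ℝ))] with T hT hTE W hW ε hε
  -- The largest R with 8R² ≤ T; log R is still half of log T up to a constant.
  set R := ⌊Real.sqrt (T / 8)⌋₊ with hRdef
  have hR1 : (R : ℝ) ≤ Real.sqrt (T / 8) := Nat.floor_le (Real.sqrt_nonneg _)
  have hR : (8 * R ^ 2 : ℝ) ≤ T := by
    have : (R : ℝ) ^ 2 ≤ T / 8 := by
      calc (R : ℝ) ^ 2 ≤ Real.sqrt (T / 8) ^ 2 := by gcongr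
        _ = T / 8 := Real.sq_sqrt (by linarith)
    linarith
  have hlogR : Real.log (T / 8) / 2 ≤ Real.log (R + 1) := by
    rw [← Real.log_sqrt (by linarith)]
    exact Real.log_le_log (Real.sqrt_pos.2 (by linarith)) (Nat.lt_floor_add_one _).le
  let ux : (Σ _ : (Σ _ : ℕ, ℕ), ℕ) → ℚ := fun x =>
    1 - 1 / (((x.2 * x.1.2 - 1 : ℕ) : ℚ) * (((x.2 * x.1.2 - 1 : ℕ) : ℚ) + (x.1.1 * x.2 : ℕ)))
  let vx : (Σ _ : (Σ _ : ℕ, ℕ), ℕ) → ℚ := fun x =>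
    1 - 1 / (((x.2 * x.1.2 - 1 : ℕ) : ℚ) * (((x.2 * x.1.2 - 1 : ℕ) : ℚ) +
      (x.1.2 * ((x.2 * x.1.2 - 2) / x.1.1) : ℕ)))
  have hpt : ∀ x, famPoint x = pt (ux x) (vx x) := fun x => rfl
  set good := (famParams T R).filter fun x => F.evalEval (ux x) (vx x) ≠ 0
  set bad := (famParams T R).filter fun x => ¬ F.evalEval (ux x) (vx x) ≠ 0 with hbad
  have hsplit : good.card + bad.card = (famParams T R).card :=
    Finset.card_filter_add_card_filter_not _
  -- A bad point is determined by e and u, because v = (1 - 1/e²)/u; for each e there are at most d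
  -- values of u.
  have hbadcard : (bad.card : ℝ) ≤ (d + 1) * T := by
    have h1 : bad.card ≤ ((Finset.Icc E₀ ⌊T / 2⌋₊).sigma fun e => Z e).card := by
      refine Finset.card_le_card_of_injOn (fun x => ⟨x.2 * x.1.2 - 1, ux x⟩) (fun x hx => ?_)
        fun x hx y hy hxy => ?_
      · obtain ⟨hx1, hx2⟩ := Finset.mem_filter.1 hx
        have dx := exists_famData hT hx1
        have hE : E₀ ≤ x.2 * x.1.2 - 1 := by
          have : (E₀ : ℝ) ≤ (x.2 * x.1.2 - 1 : ℕ) := by linarith [dx.le_e]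
          exact_mod_cast this
        refine Finset.mem_sigma.2 ⟨Finset.mem_Icc.2 ⟨hE, Nat.le_floor dx.e_le⟩, ?_⟩
        exact hZ _ hE (ux x) (vx x) (famPt_coord_ne dx.two_le).1
          (famPt_mul dx.two_le dx.mul_eq_rat) (not_not.1 hx2)
      · have hx1 := (Finset.mem_filter.1 hx).1
        have hy1 := (Finset.mem_filter.1 hy).1
        have dx := exists_famData hT hx1
        have dy := exists_famData hT hy1
        simp only [Sigma.mk.injEq, heq_eq_eq] at hxy
        refine famPoint_injOn hT R hx1 hy1 ?_
        rw [hpt, hpt, pt_inj]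
        refine ⟨hxy.2, ?_⟩
        have h1 := famPt_mul dx.two_le dx.mul_eq_rat
        have h2 := famPt_mul dy.two_le dy.mul_eq_rat
        change ux x * vx x = _ at h1
        change ux y * vx y = _ at h2
        rw [← hxy.1, ← h1, hxy.2] at h2
        exact (mul_left_cancel₀ (hxy.2 ▸ (famPt_coord_ne dx.two_le).1 : ux y ≠ 0) h2).symm
    have h2 : ((Finset.Icc E₀ ⌊T / 2⌋₊).sigma fun e => Z e).card ≤ (⌊T / 2⌋₊ + 1) * d := by
      rw [Finset.card_sigma]
      calc ∑ e ∈ Finset.Icc E₀ ⌊T / 2⌋₊, (Z e).card ≤ ∑ e ∈ Finset.Icc E₀ ⌊T / 2⌋₊, d :=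
            Finset.sum_le_sum fun e he => hZcard e (Finset.mem_Icc.1 he).1
        _ = (⌊T / 2⌋₊ + 1 - E₀) * d := by rw [Finset.sum_const, Nat.card_Icc, smul_eq_mul]
        _ ≤ _ := Nat.mul_le_mul_right _ (Nat.sub_le _ _)
    have h3 : (⌊T / 2⌋₊ : ℝ) ≤ T / 2 := Nat.floor_le (by linarith)
    calc (bad.card : ℝ) ≤ ((⌊T / 2⌋₊ + 1) * d : ℕ) := by exact_mod_cast h1.trans h2
      _ = (⌊T / 2⌋₊ + 1) * d := by push_cast; ring
      _ ≤ T * (d + 1) := by gcongr <;> linarith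
      _ = _ := mul_comm _ _
  have hgood : T / 64 * Real.log (T / 8) - (d + 1) * T ≤ good.card := by
    have h1 := card_famParams_ge hR (by linarith)
    have h2 : T / 64 * Real.log (T / 8) ≤ T / 32 * Real.log (R + 1) := by
      calc T / 64 * Real.log (T / 8) = T / 32 * (Real.log (T / 8) / 2) := by ring
        _ ≤ _ := by gcongr
    have h3 : (good.card : ℝ) + bad.card = (famParams T R).card := by exact_mod_cast hsplit
    linarith
  have hsub : (good.image famPoint : Set Y3) ⊆ zoomSet W T ε := by
    intro P hP
    rw [Finset.coe_image] at hP
    obtain ⟨x, hx, rfl⟩ := hP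
    obtain ⟨hx1, hx2⟩ := Finset.mem_filter.1 hx
    have dx := exists_famData hT hx1
    exact dx.mem_zoomSet (by linarith) (hW _ _ (famPt_mem_M dx.two_le dx.mul_eq_rat) hx2) hε
  have hcard : (good.image famPoint).card = good.card :=
    Finset.card_image_of_injOn ((famPoint_injOn hT R).mono
      (Finset.coe_subset.2 (Finset.filter_subset _ _)))
  calc ENNReal.ofReal (T / 64 * Real.log (T / 8) - (d + 1) * T)
      ≤ ENNReal.ofReal (good.card : ℝ) := ENNReal.ofReal_le_ofReal hgood
    _ = (((good.image famPoint).card : ℕ∞) : ℝ≥0∞) := by rw [hcard]; simp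
    _ ≤ _ := by
        rw [← Set.encard_coe_eq_coe_finsetCard]
        exact_mod_cast Set.encard_le_encard hsub

/-! ### The Zariski topology -/

/-- The prime ideal of the polynomials vanishing at a point. -/
noncomputable def CoxPoint.toSpec (η : CoxPoint) : PrimeSpectrum (MvPolynomial (Fin 7) ℚ) :=
  ⟨RingHom.ker (MvPolynomial.eval η.coord), RingHom.ker_isPrime _⟩

/-- The topology comes from the spectrum of a polynomial ring, hence is Noetherian. On `Y3` every
open set is then retrocompact, so constructible in the topological sense. -/
theorem CoxPoint.isInducing_toSpec : IsInducing CoxPoint.toSpec := by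
  constructor
  rw [PrimeSpectrum.isTopologicalBasis_basic_opens.eq_generateFrom, induced_generateFrom_eq]
  refine congrArg TopologicalSpace.generateFrom ?_
  ext D
  constructor
  · rintro ⟨f, rfl⟩
    exact ⟨_, ⟨f, rfl⟩, rfl⟩
  · rintro ⟨_, ⟨f, rfl⟩, rfl⟩
    exact ⟨f, rfl⟩

instance : TopologicalSpace.NoetherianSpace CoxPoint :=
  CoxPoint.isInducing_toSpec.noetherianSpace

instance : TopologicalSpace.NoetherianSpace Y3 :=
  TopologicalSpace.noetherianSpace_of_surjective (α := CoxPoint) (Quotient.mk torusSetoid)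
    continuous_quotient_mk' Quotient.mk_surjective

theorem isConstructible_of_isOpen {U : Set Y3} (hU : IsOpen U) : IsConstructible U :=
  IsRetrocompact.isConstructible hU fun _ _ _ => TopologicalSpace.NoetherianSpace.isCompact _

theorem isOpen_iff {O : Set Y3} : IsOpen O ↔ IsOpen (Quotient.mk torusSetoid ⁻¹' O) :=
  isOpen_coinduced

theorem isOpen_setOf_eval_ne_zero (f : MvPolynomial (Fin 7) ℚ) :
    IsOpen {η : CoxPoint | MvPolynomial.eval η.coord f ≠ 0} :=
  TopologicalSpace.isOpen_generateFrom_of_mem ⟨f, rfl⟩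

theorem exists_basic_subset {O : Set CoxPoint} (hO : IsOpen O) {η : CoxPoint} (hη : η ∈ O) :
    ∃ f : MvPolynomial (Fin 7) ℚ, MvPolynomial.eval η.coord f ≠ 0 ∧
      ∀ η' : CoxPoint, MvPolynomial.eval η'.coord f ≠ 0 → η' ∈ O := by
  induction hO with
  | basic s hs =>
    obtain ⟨f, rfl⟩ := hs
    exact ⟨f, hη, fun _ h => h⟩
  | univ => exact ⟨1, by simp, fun _ _ => trivial⟩
  | inter s t _ _ h₁ h₂ =>
    obtain ⟨f, hf, hf'⟩ := h₁ hη.1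
    obtain ⟨g, hg, hg'⟩ := h₂ hη.2
    refine ⟨f * g, by simp [hf, hg], fun η' h => ?_⟩
    rw [map_mul] at h
    exact ⟨hf' _ (left_ne_zero_of_mul h), hg' _ (right_ne_zero_of_mul h)⟩
  | sUnion S _ h =>
    obtain ⟨s, hs, hηs⟩ := hη
    obtain ⟨f, hf, hf'⟩ := h s hs hηs
    exact ⟨f, hf, fun η' h => ⟨s, hs, hf' _ h⟩⟩

theorem exists_eval_ne_zero_of_coord_ne_zero {f : MvPolynomial (Fin 7) ℚ} (hf : f ≠ 0) :
    ∃ x : Fin 7 → ℚ, (∀ i, x i ≠ 0) ∧ MvPolynomial.eval x f ≠ 0 := by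
  by_contra! h
  have : f * ∏ i, MvPolynomial.X i = 0 := by
    apply MvPolynomial.funext
    intro x
    rw [map_mul, map_prod, map_zero]
    simp only [MvPolynomial.eval_X]
    by_cases hx : ∀ i, x i ≠ 0
    · rw [h x hx, zero_mul]
    · push Not at hx
      obtain ⟨i, hi⟩ := hx
      rw [Finset.prod_eq_zero (Finset.mem_univ i) hi, mul_zero]
  rcases mul_eq_zero.1 this with h1 | h1
  · exact hf h1
  · exact Finset.prod_ne_zero_iff.2 (fun i _ => MvPolynomial.X_ne_zero i) h1

/-- A nonempty Zariski open set contains the complement of a plane curve in the chart. -/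
theorem exists_curve_of_isOpen {O : Set Y3} (hO : IsOpen O) (hne : O.Nonempty) :
    ∃ F : Polynomial (Polynomial ℚ), F ≠ 0 ∧ ∀ u v : ℚ, F.evalEval u v ≠ 0 → pt u v ∈ O := by
  obtain ⟨P, hP⟩ := hne
  obtain ⟨η, rfl⟩ := Quotient.mk_surjective P
  obtain ⟨f, hf, hfO⟩ := exists_basic_subset (isOpen_iff.1 hO) (η := η) hP
  have hf0 : f ≠ 0 := by rintro rfl; simp at hf
  obtain ⟨x, hx, hfx⟩ := exists_eval_ne_zero_of_coord_ne_zero hf0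
  -- The unit vector σ agrees with x at 0, 1, 2, 3, 6, and its entries 4 and 5 are forced by the
  -- torus relations. Pulling f back along (u, v) ↦ σ·(1, 1, 1, 1, u, v, 1) gives F, which is
  -- nonzero since it takes the value f(x) at (x₄/σ₄, x₅/σ₅).
  let τ : Fin 7 → ℚˣ := fun i => Units.mk0 (x i) (hx i)
  let σ : Fin 7 → ℚˣ := ![τ 0, τ 1, τ 2, τ 3, τ 0 * τ 1 * τ 6 / τ 3, τ 2 * τ 1 * τ 3 / τ 6, τ 6]
  let g : Fin 7 → Polynomial (Polynomial ℚ) := fun i =>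
    Polynomial.C (Polynomial.C (σ i : ℚ)) *
      (![1, 1, 1, 1, Polynomial.C Polynomial.X, Polynomial.X, 1] : Fin 7 → _) i
  let F := MvPolynomial.eval₂ (Polynomial.C.comp Polynomial.C) g f
  have hF : ∀ u v : ℚ, F.evalEval u v =
      MvPolynomial.eval (fun i => σ i * (![1, 1, 1, 1, u, v, 1] : Fin 7 → ℚ) i) f := by
    intro u v
    rw [← Polynomial.coe_evalEvalRingHom]
    change (Polynomial.evalEvalRingHom u v) (MvPolynomial.eval₂ _ g f) = _
    rw [MvPolynomial.hom_eval₂, MvPolynomial.eval, MvPolynomial.coe_eval₂Hom]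
    congr 1
    · ext; simp
    · funext i
      fin_cases i <;> simp [g]
  refine ⟨F, fun h0 => hfx ?_, fun u v h => ?_⟩
  · have := hF (x 4 / σ 4) (x 5 / σ 5)
    rw [h0] at this
    rw [show (0 : Polynomial (Polynomial ℚ)).evalEval (x 4 / σ 4) (x 5 / σ 5) = 0 by simp] at this
    rw [this]
    congr 1
    congr 1
    funext i
    have h4 := (σ 4).ne_zero
    have h5 := (σ 5).ne_zero
    fin_cases i
    · simp [σ, τ]
    · simp [σ, τ]
    · simp [σ, τ]
    · simp [σ, τ]
    · change x 4 = σ 4 * (x 4 / σ 4); field_simp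
    · change x 5 = σ 5 * (x 5 / σ 5); field_simp
    · simp [σ, τ]
  · rw [hF] at h
    have hc : ∀ i j : Fin 7, (σ i : ℚ) * (![1, 1, 1, 1, u, v, 1] : Fin 7 → ℚ) i = 0 →
        (σ j : ℚ) * (![1, 1, 1, 1, u, v, 1] : Fin 7 → ℚ) j = 0 → j = i ∨ j = i + 1 ∨ i = j + 1 := by
      intro i j
      fin_cases i <;> fin_cases j <;> simp
    have hmem := hfO ⟨_, hc⟩ h
    have : pt u v = Quotient.mk torusSetoid ⟨_, hc⟩ := by
      apply Quotient.sound
      refine ⟨σ, ?_, ?_, fun i => rfl⟩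
      · simp [σ]
      · simp [σ]
    rw [this]
    exact hmem

theorem M_ne_Q {u v : ℚ} (h : pt u v ∈ M) : pt u v ≠ Q := h.1

theorem tendsto_lower_bound (C : ℝ) :
    Tendsto (fun T : ℝ => T / 64 * Real.log (T / 8) - C * T) atTop atTop := by
  have h1 : Tendsto (fun T : ℝ => 1 / 64 * Real.log (T / 8) - C) atTop atTop := by
    refine tendsto_atTop_add_const_right _ _ (Tendsto.const_mul_atTop (by norm_num) ?_)
    exact Real.tendsto_log_atTop.comp (tendsto_id.atTop_div_const (by norm_num))
  refine (tendsto_id.atTop_mul_atTop₀ h1).congr fun T => ?_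
  simp only [id]; ring

theorem nonempty_of_ofReal_le_encard {S : Set Y3} {x : ℝ} (hx : 0 < x)
    (h : ENNReal.ofReal x ≤ (S.encard : ℝ≥0∞)) : S.Nonempty := by
  by_contra h0
  rw [Set.not_nonempty_iff_eq_empty] at h0
  rw [h0, Set.encard_empty] at h
  have : ENNReal.ofReal x = 0 := by simpa using h
  rw [ENNReal.ofReal_eq_zero] at this
  linarith

/-- The points of `M` are Zariski dense. -/
theorem exists_mem_M {F : Polynomial (Polynomial ℚ)} (hF : F ≠ 0) :
    ∃ u v : ℚ, pt u v ∈ M ∧ F.evalEval u v ≠ 0 := by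
  obtain ⟨C, -, hC⟩ := exists_lower_bound hF
  obtain ⟨T, hT, hT0⟩ := (hC.and ((tendsto_lower_bound C).eventually_gt_atTop 0)).exists
  obtain ⟨P, ⟨u, v, rfl, h1, h2⟩, -⟩ := nonempty_of_ofReal_le_encard hT0
    (hT {P | ∃ u v, P = pt u v ∧ pt u v ∈ M ∧ F.evalEval u v ≠ 0}
      (fun u v h1 h2 => ⟨u, v, rfl, h1, h2⟩) 16 le_rfl)
  exact ⟨u, v, h1, h2⟩

/-- Irreducibility of the surface and density of `M` at once: the product of the two excluded
equations is a nonzero polynomial, and `M` is not contained in its zero locus. -/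
theorem inter_nonempty_of_isOpen {O₁ O₂ : Set Y3} (h₁ : IsOpen O₁) (h₂ : IsOpen O₂)
    (n₁ : O₁.Nonempty) (n₂ : O₂.Nonempty) : ((O₁ ∩ O₂) ∩ M).Nonempty := by
  obtain ⟨F₁, hF₁, hO₁⟩ := exists_curve_of_isOpen h₁ n₁
  obtain ⟨F₂, hF₂, hO₂⟩ := exists_curve_of_isOpen h₂ n₂
  obtain ⟨u, v, hM, huv⟩ := exists_mem_M (mul_ne_zero hF₁ hF₂)
  rw [← Polynomial.coe_evalEvalRingHom, map_mul] at huv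
  exact ⟨pt u v, ⟨hO₁ u v (left_ne_zero_of_mul huv), hO₂ u v (right_ne_zero_of_mul huv)⟩, hM⟩

/-- A constructible subset of a dense set contains, or misses, a nonempty open subset. -/
theorem IsConstructible.dichotomy {W : Set Y3} {S : Set W} (hS : IsConstructible S) :
    (∃ O : Set Y3, IsOpen O ∧ O.Nonempty ∧ ∀ x : W, (x : Y3) ∈ O → x ∈ S) ∨
      ∃ O : Set Y3, IsOpen O ∧ O.Nonempty ∧ ∀ x : W, (x : Y3) ∈ O → x ∉ S := by
  induction hS using IsConstructible.empty_union_induction with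
  | open_retrocompact U hU _ =>
    obtain ⟨O, hO, rfl⟩ := isOpen_induced_iff.1 hU
    rcases O.eq_empty_or_nonempty with rfl | hne
    · exact Or.inr ⟨Set.univ, isOpen_univ, ⟨Q, trivial⟩, fun _ _ h => h⟩
    · exact Or.inl ⟨O, hO, hne, fun _ h => h⟩
  | union s _ t _ hs ht =>
    rcases hs with ⟨O, hO, hne, h⟩ | ⟨O, hO, hne, h⟩
    · exact Or.inl ⟨O, hO, hne, fun x hx => Or.inl (h x hx)⟩
    rcases ht with ⟨O', hO', hne', h'⟩ | ⟨O', hO', hne', h'⟩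
    · exact Or.inl ⟨O', hO', hne', fun x hx => Or.inr (h' x hx)⟩
    · refine Or.inr ⟨O ∩ O', hO.inter hO', (inter_nonempty_of_isOpen hO hO' hne hne').left, ?_⟩
      rintro x ⟨hx, hx'⟩ (hx'' | hx'')
      · exact h x hx hx''
      · exact h' x hx' hx''
  | compl s _ hs =>
    rcases hs with ⟨O, hO, hne, h⟩ | ⟨O, hO, hne, h⟩
    · exact Or.inr ⟨O, hO, hne, fun x hx hx' => hx' (h x hx)⟩
    · exact Or.inl ⟨O, hO, hne, h⟩

/-- Since `M` meets every nonempty open set, density of V excludes that V misses one in W. So V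
contains a nonempty open part of W, and with it `M` minus a curve; this puts V within reach of
`exists_lower_bound`. -/
theorem IsDenseConstructible.exists_curve {V W : Set Y3} (hV : IsDenseConstructible V W)
    (hW : M ⊆ W) : ∃ F : Polynomial (Polynomial ℚ), F ≠ 0 ∧
      ∀ u v : ℚ, pt u v ∈ M → F.evalEval u v ≠ 0 → pt u v ∈ V := by
  obtain ⟨-, hc, hd⟩ := hV
  rcases IsConstructible.dichotomy hc with ⟨O, hO, hne, h⟩ | ⟨O, hO, hne, h⟩
  · obtain ⟨F, hF, hFO⟩ := exists_curve_of_isOpen hO hne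
    exact ⟨F, hF, fun u v hM huv => h ⟨pt u v, hW hM⟩ (hFO u v huv)⟩
  · obtain ⟨P, ⟨hP, -⟩, hPM⟩ := inter_nonempty_of_isOpen hO hO hne hne
    obtain ⟨x, hxO, hxV⟩ := hd.inter_open_nonempty (Subtype.val ⁻¹' O)
      (hO.preimage continuous_subtype_val) ⟨⟨P, hW hPM⟩, hP⟩
    exact absurd hxV (h x hxO)

/-! ### The approximation constants -/

/-- V contains points other than `Q` with distance at most 16/T² and height at most T^5 for
arbitrarily large T. For δ > 5/2 they give d^δ H ≤ 16^δ T^(5-2δ), which tends to 0. -/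
theorem approxConst_le {V : Set Y3} {F : Polynomial (Polynomial ℚ)} (hF : F ≠ 0)
    (hV : ∀ u v : ℚ, pt u v ∈ M → F.evalEval u v ≠ 0 → pt u v ∈ V) :
    approxConst V ≤ ENNReal.ofReal (5 / 2) := by
  refine iSup₂_le fun δ hδ => ENNReal.ofReal_le_ofReal ?_
  obtain ⟨hδ0, C, hC, h⟩ := hδ
  by_contra! hlt
  obtain ⟨C', -, hC'⟩ := exists_lower_bound hF
  have hlim : Tendsto (fun T : ℝ => (16 : ℝ) ^ δ * T ^ (-(2 * δ - 5))) atTop (𝓝 0) := by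
    simpa using (tendsto_rpow_neg_atTop (by linarith : 0 < 2 * δ - 5)).const_mul ((16 : ℝ) ^ δ)
  obtain ⟨T, ⟨⟨hT, hT0⟩, hTC⟩, hTpos⟩ := (((hC'.and
    ((tendsto_lower_bound C').eventually_gt_atTop 0)).and (hlim.eventually_lt_const hC)).and
      (eventually_gt_atTop 0)).exists
  obtain ⟨P, ⟨hPV, hPQ⟩, hPc, hPH, hPd⟩ := nonempty_of_ofReal_le_encard hT0
    (hT (V \ {Q}) (fun u v h1 h2 => ⟨hV u v h1 h2, M_ne_Q h1⟩) 16 le_rfl)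
  have hC2 := h P hPV hPQ
  have hd0 : 0 ≤ distQ P := by
    rw [distQ]
    split_ifs
    positivity
  have hd : distQ P ≤ 16 / T ^ 2 := by
    rw [distQ, if_pos hPc, le_div_iff₀ (by positivity)]
    refine le_trans ?_ hPd
    rw [mul_comm]
    gcongr
    exact min_le_right _ _
  have : distQ P ^ δ * height P ≤ (16 : ℝ) ^ δ * T ^ (-(2 * δ - 5)) := by
    calc distQ P ^ δ * height P ≤ (16 / T ^ 2) ^ δ * T ^ 5 := by
          gcongr
          linarith [one_le_height P]
      _ = (16 : ℝ) ^ δ * T ^ (-(2 * δ - 5)) := by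
          rw [Real.div_rpow (by norm_num) (by positivity), ← Real.rpow_natCast T 2,
            ← Real.rpow_mul hTpos.le, ← Real.rpow_natCast T 5, div_mul_eq_mul_div, mul_div_assoc,
            ← Real.rpow_sub hTpos]
          congr 2
          push_cast; ring
  linarith

theorem le_approxConst {V : Set Y3}
    (hV : ∀ u v : ℚ, pt u v ∈ V → u ≠ 1 ∧ v ≠ 1 ∧ u * v ≠ 1) :
    ENNReal.ofReal (5 / 2) ≤ approxConst V := by
  -- The constant 1/2 works because (1/2)² < 1/3 near `Q`, and because heights are at least 1 where
  -- the distance is truncated to 1.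
  refine le_iSup₂_of_le (5 / 2 : ℝ) ⟨by norm_num, 1 / 2, by norm_num, fun P hP _ => ?_⟩ le_rfl
  have key : distQ P = 1 → 1 / 2 < distQ P ^ (5 / 2 : ℝ) * height P := by
    intro h
    rw [h, Real.one_rpow]
    linarith [one_le_height P]
  by_cases hc : P ∈ chart
  · obtain ⟨u, v, rfl⟩ := (mem_chart_iff P).1 hc
    obtain ⟨hu, hv, huv⟩ := hV u v hP
    rcases lt_or_ge (max |(u : ℝ) - 1| |(v : ℝ) - 1|) 1 with hd | hd
    · have h := liouville_sq hu hv huv rfl hd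
      rw [distQ_pt, min_eq_right hd.le]
      set d := max |(u : ℝ) - 1| |(v : ℝ) - 1|
      have hd0 : 0 ≤ d := le_max_of_le_left (abs_nonneg _)
      have h2 : (d ^ (5 / 2 : ℝ)) ^ 2 = d ^ 5 := by
        rw [← Real.rpow_natCast, ← Real.rpow_natCast, ← Real.rpow_mul hd0]; norm_num
      rw [← h2, ← mul_pow] at h
      have hpos : 0 ≤ d ^ (5 / 2 : ℝ) * height (pt u v) :=
        mul_nonneg (Real.rpow_nonneg hd0 _) (by linarith [one_le_height (pt u v)])
      nlinarith
    · exact key (by rw [distQ_pt, min_eq_left hd])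
  · exact key (by rw [distQ, if_neg hc])

theorem mem_torusOpen_iff {η : CoxPoint} : Quotient.mk torusSetoid η ∈ torusOpen ↔
    (∀ i, η.coord i ≠ 0) ∧
      η.coord 4 * η.coord 3 ≠ η.coord 0 * η.coord 1 * η.coord 6 ∧
      η.coord 5 * η.coord 6 ≠ η.coord 2 * η.coord 1 * η.coord 3 ∧
      η.coord 4 * η.coord 5 ≠ η.coord 0 * η.coord 1 ^ 2 * η.coord 2 := by
  constructor
  · rintro ⟨u, v, h, hu, hv, hu1, hv1, huv⟩
    have n : ∀ i, η.coord i ≠ 0 := by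
      obtain ⟨τ, -, -, hτ⟩ := Quotient.exact h
      intro i h0
      have := hτ i
      rw [h0, mul_zero] at this
      revert this
      fin_cases i <;> simp [hu, hv]
    rw [mk_eq_pt η (by simp [n]) (by simp [n]), pt_inj] at h
    obtain ⟨rfl, rfl⟩ := h
    rw [Ne, div_eq_one_iff_eq (by simp [n])] at hu1 hv1
    refine ⟨n, hu1, hv1, fun h => huv ?_⟩
    have h0 := n 0
    have h1 := n 1
    have h2 := n 2
    have h6 := n 6
    have h3 := n 3
    field_simp
    linear_combination h
  · rintro ⟨h, h1, h2, h3⟩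
    have n : ∀ i, η.coord i ≠ 0 := h
    refine ⟨_, _, mk_eq_pt η ?_ ?_, ?_, ?_, ?_, ?_, ?_⟩
    · simp [h]
    · simp [h]
    · simp [h]
    · simp [h]
    · rw [Ne, div_eq_one_iff_eq (by simp [h])]; exact h1
    · rw [Ne, div_eq_one_iff_eq (by simp [h])]; exact h2
    · have h0 := n 0
      have h1 := n 1
      have h2 := n 2
      have h6 := n 6
      have h3' := n 3
      intro h
      field_simp at h
      exact h3 (by linear_combination h)

theorem isOpen_torusOpen : IsOpen torusOpen := by
  rw [isOpen_iff]
  have : Quotient.mk torusSetoid ⁻¹' torusOpen = {η : CoxPoint | MvPolynomial.eval η.coord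
      ((∏ i, MvPolynomial.X i) *
        (MvPolynomial.X 4 * MvPolynomial.X 3 - MvPolynomial.X 0 * MvPolynomial.X 1 * MvPolynomial.X 6) *
        (MvPolynomial.X 5 * MvPolynomial.X 6 - MvPolynomial.X 2 * MvPolynomial.X 1 * MvPolynomial.X 3) *
        (MvPolynomial.X 4 * MvPolynomial.X 5 -
          MvPolynomial.X 0 * MvPolynomial.X 1 ^ 2 * MvPolynomial.X 2)) ≠ 0} := by
    ext η
    refine mem_torusOpen_iff.trans ?_
    change _ ↔ MvPolynomial.eval η.coord _ ≠ 0
    simp only [map_mul, map_sub, map_pow, map_prod, MvPolynomial.eval_X, mul_ne_zero_iff,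
      Finset.prod_ne_zero_iff, sub_ne_zero, Finset.mem_univ, true_imp_iff, and_assoc]
  rw [this]
  exact isOpen_setOf_eval_ne_zero _

theorem torusOpen_nonempty : torusOpen.Nonempty :=
  ⟨pt 2 2, 2, 2, rfl, by norm_num, by norm_num, by norm_num, by norm_num, by norm_num⟩

theorem dense_torusOpen : Dense torusOpen := by
  rw [dense_iff_inter_open]
  intro O hO hne
  exact (inter_nonempty_of_isOpen hO isOpen_torusOpen hne torusOpen_nonempty).left

theorem isDenseConstructible_torusOpen : IsDenseConstructible torusOpen Set.univ := by
  refine ⟨Set.subset_univ _, ?_, ?_⟩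
  · refine IsConstructible.preimage continuous_subtype_val (fun s hs _ => ?_)
      (isConstructible_of_isOpen isOpen_torusOpen)
    exact fun _ _ _ => TopologicalSpace.NoetherianSpace.isCompact _
  · rw [dense_iff_inter_open]
    intro O hO hne
    obtain ⟨O', hO', rfl⟩ := isOpen_induced_iff.1 hO
    obtain ⟨x, hx⟩ := hne
    obtain ⟨P, ⟨hP, hP'⟩, -⟩ :=
      inter_nonempty_of_isOpen hO' isOpen_torusOpen ⟨_, hx⟩ torusOpen_nonempty
    exact ⟨⟨P, trivial⟩, hP, hP'⟩

theorem isDenseConstructible_M : IsDenseConstructible M M := by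
  refine ⟨subset_rfl, ?_, ?_⟩
  · rw [Subtype.coe_preimage_self]; exact IsConstructible.univ
  · rw [Subtype.coe_preimage_self]; exact dense_univ

theorem torusOpen_ne_one {u v : ℚ} (h : pt u v ∈ torusOpen) : u ≠ 1 ∧ v ≠ 1 ∧ u * v ≠ 1 := by
  obtain ⟨u', v', h, -, -, h1, h2, h3⟩ := h
  obtain ⟨rfl, rfl⟩ := pt_inj.1 h
  exact ⟨h1, h2, h3⟩

theorem approxConst_torusOpen : approxConst torusOpen = ENNReal.ofReal (5 / 2) := by
  obtain ⟨F, hF, h⟩ := isDenseConstructible_torusOpen.exists_curve (Set.subset_univ _)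
  exact le_antisymm (approxConst_le hF h) (le_approxConst fun _ _ => torusOpen_ne_one)

theorem essConst_eq {W V : Set Y3} (hW : M ⊆ W) (hV : IsDenseConstructible V W)
    (h : ENNReal.ofReal (5 / 2) ≤ approxConst V) : essConst W = ENNReal.ofReal (5 / 2) := by
  refine le_antisymm (iSup₂_le fun V hV => ?_) (le_iSup₂_of_le V hV h)
  obtain ⟨F, hF, h⟩ := IsDenseConstructible.exists_curve hV hW
  exact approxConst_le hF h

theorem tendsto_rpow_one_fifth : Tendsto (fun B : ℝ => B ^ (1 / 5 : ℝ)) atTop atTop :=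
  tendsto_rpow_atTop (by norm_num)

/-- With U the open set `torusOpen`, the complement of `M` contributes O(T), whereas any dense
constructible V in `M` contributes at least a constant times T log T once ε ≥ 16. -/
theorem locallyWeaklyAccumulating_M : LocallyWeaklyAccumulating M := by
  have hu : essConst Set.univ = ENNReal.ofReal (5 / 2) :=
    essConst_eq (Set.subset_univ _) isDenseConstructible_torusOpen approxConst_torusOpen.ge
  have hM : essConst M = ENNReal.ofReal (5 / 2) :=
    essConst_eq subset_rfl isDenseConstructible_M (le_approxConst fun _ _ => M_ne_one)
  refine ⟨by rw [hu]; exact ENNReal.ofReal_ne_top, by rw [hu, hM], torusOpen, isOpen_torusOpen,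
    dense_torusOpen, by rw [hu, approxConst_torusOpen], fun V hV _ => ?_⟩
  rw [hu, ENNReal.toReal_ofReal (by norm_num)]
  obtain ⟨F, hF, hFV⟩ := hV.exists_curve subset_rfl
  obtain ⟨C', -, hC'⟩ := exists_lower_bound hF
  filter_upwards [eventually_ge_atTop 16] with ε hε c hc
  obtain ⟨C, hC, hup⟩ := encard_zoomSet_torusOpen_diff_le ε
  have hlog : ∀ᶠ T : ℝ in atTop, C * T ≤ c * (T / 64 * Real.log (T / 8) - C' * T) := by
    have h1 : Tendsto (fun T : ℝ => Real.log (T / 8)) atTop atTop :=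
      Real.tendsto_log_atTop.comp (tendsto_id.atTop_div_const (by norm_num))
    filter_upwards [h1.eventually_ge_atTop (64 * (C / c + C')), eventually_ge_atTop 0] with T hT hT0
    have : C / c ≤ 1 / 64 * Real.log (T / 8) - C' := by linarith
    rw [div_le_iff₀ hc] at this
    nlinarith [mul_le_mul_of_nonneg_left this hT0]
  filter_upwards [tendsto_rpow_one_fifth.eventually (hC'.and (hup.and hlog)),
    eventually_ge_atTop 0] with B hB hB0
  obtain ⟨h1, h2, h3⟩ := hB
  rw [zoom_closedBall _ hB0, zoom_closedBall _ hB0]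
  calc _ ≤ ENNReal.ofReal (C * B ^ (1 / 5 : ℝ)) := h2
    _ ≤ ENNReal.ofReal c * ENNReal.ofReal _ := by
        rw [← ENNReal.ofReal_mul hc.le]; exact ENNReal.ofReal_le_ofReal h3
    _ ≤ _ := by gcongr; exact h1 V hFV ε hε

/-! ### The order of magnitude -/

theorem zoom_M_order {ε : ℝ} (hε : 16 ≤ ε) : ∃ c C : ℝ, 0 < c ∧ 0 < C ∧ ∀ᶠ B : ℝ in atTop,
    ENNReal.ofReal (c * (B ^ (1 / 5 : ℝ) * Real.log B)) ≤
      zoom M B (5 / 2) (Metric.closedBall 0 ε) ∧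
    zoom M B (5 / 2) (Metric.closedBall 0 ε) ≤
      ENNReal.ofReal (C * (B ^ (1 / 5 : ℝ) * Real.log B)) := by
  obtain ⟨C', -, hC'⟩ := exists_lower_bound (one_ne_zero : (1 : Polynomial (Polynomial ℚ)) ≠ 0)
  obtain ⟨C, hC, hup⟩ := encard_zoomSet_M_le ε
  -- The factors 5 come from log T = (log B)/5: 640 = 5 · 128, where 1/128 is half of 1/64 and
  -- absorbs the error terms.
  refine ⟨1 / 640, C / 5, by norm_num, by positivity, ?_⟩
  have hlog : ∀ᶠ T : ℝ in atTop,
      1 / 128 * (T * Real.log T) ≤ T / 64 * Real.log (T / 8) - C' * T := by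
    filter_upwards [Real.tendsto_log_atTop.eventually_ge_atTop (2 * Real.log 8 + 128 * C'),
      eventually_gt_atTop 0] with T hT hT0
    rw [Real.log_div hT0.ne' (by norm_num)]
    nlinarith [mul_le_mul_of_nonneg_left hT hT0.le]
  filter_upwards [tendsto_rpow_one_fifth.eventually (hC'.and (hup.and hlog)),
    eventually_gt_atTop 0] with B hB hB0
  obtain ⟨h1, h2, h3⟩ := hB
  rw [zoom_closedBall _ hB0.le]
  rw [Real.log_rpow hB0] at h2 h3
  refine ⟨le_trans (ENNReal.ofReal_le_ofReal ?_) (h1 M (fun _ _ h _ => h) ε hε),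
    h2.trans (ENNReal.ofReal_le_ofReal (le_of_eq (by ring)))⟩
  refine le_trans (le_of_eq (by ring)) h3

theorem mem_M_iff_of_mem_chart {P : Y3} (hP : P ∈ chart) (h : wCoord P * zCoord P ≠ 0)
    (h' : (1 + wCoord P) * (1 + zCoord P) ≠ 0) :
    P ∈ M ↔ ∃ q : ℚ, q ≠ 0 ∧ -wCoord P - zCoord P - wCoord P * zCoord P = q ^ 2 := by
  obtain ⟨u, v, rfl⟩ := (mem_chart_iff P).1 hP
  rw [wCoord_pt, zCoord_pt] at *
  rw [add_sub_cancel, add_sub_cancel] at h'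
  rw [pt_mem_M_iff (left_ne_zero_of_mul h') (right_ne_zero_of_mul h')
    (sub_ne_zero.1 (left_ne_zero_of_mul h)) (sub_ne_zero.1 (right_ne_zero_of_mul h))]
  rw [show -(u - 1) - (v - 1) - (u - 1) * (v - 1) = 1 - u * v by ring]

/-! ### Rational points of a cuspidal curve -/

/-- The anticanonical sections along the parametrization of the cuspidal curve: the parameter
`[p : q]` is the slope `z / w`. -/
def cuspForm {A : Type*} [CommRing A] (a b p q : A) : Fin 6 → A :=
  ![a * b ^ 2 * q ^ 2 * ((2 * a + b) * p - b * q) ^ 2 * ((a + 2 * b) * q - a * p),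
    a * p ^ 2 * ((a + 2 * b) * q - a * p) * (a ^ 2 * p + b ^ 2 * q) ^ 2,
    b * q ^ 2 * ((2 * a + b) * p - b * q) * (a ^ 2 * p + b ^ 2 * q) ^ 2,
    a ^ 2 * b * p ^ 2 * ((2 * a + b) * p - b * q) * ((a + 2 * b) * q - a * p) ^ 2,
    a * b * p * q * ((2 * a + b) * p - b * q) * ((a + 2 * b) * q - a * p) *
      (a ^ 2 * p + b ^ 2 * q),
    p * q * (a ^ 2 * p + b ^ 2 * q) ^ 3]

theorem map_cuspForm {A B : Type*} [CommRing A] [CommRing B] (f : A →+* B) (a b p q : A)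
    (i : Fin 6) : f (cuspForm a b p q i) = cuspForm (f a) (f b) (f p) (f q) i := by
  have h2 : f 2 = 2 := map_ofNat f 2
  fin_cases i <;> simp [cuspForm, h2]

theorem intCast_cuspForm {B : Type*} [CommRing B] (a b p q : ℤ) (i : Fin 6) :
    ((cuspForm a b p q i : ℤ) : B) = cuspForm (a : B) b p q i :=
  map_cuspForm (Int.castRingHom B) a b p q i

/-- The point of the cuspidal curve with parameter `[p : q]`. -/
def cuspPt (a b p q : ℤ) : Y3 :=
  pt (1 - (a * p - b * q) ^ 2 / (p * (a ^ 2 * p + b ^ 2 * q)))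
    (1 - (a * p - b * q) ^ 2 / (q * (a ^ 2 * p + b ^ 2 * q)))

/-- The parameter `[p : q]` is neither that of `Q` nor that of a point outside the chart. -/
def IsRegularParam (a b p q : ℤ) : Prop :=
  p ≠ 0 ∧ q ≠ 0 ∧ a ^ 2 * p + b ^ 2 * q ≠ 0 ∧ a * p - b * q ≠ 0

theorem IsRegularParam.cast {a b p q : ℤ} (h : IsRegularParam a b p q) :
    (p : ℚ) ≠ 0 ∧ (q : ℚ) ≠ 0 ∧ (a ^ 2 * p + b ^ 2 * q : ℚ) ≠ 0 ∧ (a * p - b * q : ℚ) ≠ 0 := by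
  obtain ⟨h1, h2, h3, h4⟩ := h
  exact ⟨by exact_mod_cast h1, by exact_mod_cast h2, by exact_mod_cast h3, by exact_mod_cast h4⟩

theorem cuspPt_mem {a b p q : ℤ} (h : IsRegularParam a b p q) : cuspPt a b p q ∈ cuspCurve a b := by
  obtain ⟨h1, h2, h3, -⟩ := h.cast
  rw [cuspPt, pt_mem_cuspCurve]
  field_simp
  ring

theorem cuspPt_ne_Q {a b p q : ℤ} (h : IsRegularParam a b p q) : cuspPt a b p q ≠ Q := by
  obtain ⟨h1, h2, h3, h4⟩ := h.cast
  rw [cuspPt, Q_eq_pt, Ne, pt_inj]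
  rintro ⟨h, -⟩
  have : (a * p - b * q : ℚ) ^ 2 / (p * (a ^ 2 * p + b ^ 2 * q)) = 0 := by linarith
  rw [div_eq_zero_iff] at this
  simp_all

/-- The line of slope z/w = p/q through the double point `Q` meets the cubic in one further point.
With (w, z) = s(q, p), the equation becomes linear in s, and ab(a + b) ≠ 0 keeps its coefficients
from vanishing. -/
theorem exists_cuspPt {a b : ℤ} (hab : IsCuspidal a b) {P : Y3} (hP : P ∈ cuspCurve a b)
    (hc : P ∈ chart) (hQ : P ≠ Q) :
    ∃ p q : ℤ, IsCoprime p q ∧ IsRegularParam a b p q ∧ P = cuspPt a b p q := by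
  obtain ⟨-, ha, hb, hab'⟩ := hab
  obtain ⟨u, v, rfl⟩ := (mem_chart_iff P).1 hc
  rw [pt_mem_cuspCurve] at hP
  rw [Q_eq_pt, Ne, pt_inj] at hQ
  have ha' : (a : ℚ) ≠ 0 := by exact_mod_cast ha
  have hb' : (b : ℚ) ≠ 0 := by exact_mod_cast hb
  have hab'' : (a + b : ℚ) ≠ 0 := by exact_mod_cast hab'
  obtain ⟨w, rfl⟩ : ∃ w, u = 1 + w := ⟨u - 1, by ring⟩
  obtain ⟨z, rfl⟩ : ∃ z, v = 1 + z := ⟨v - 1, by ring⟩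
  have hw : w ≠ 0 := by
    rintro rfl
    apply hQ
    have : (a : ℚ) ^ 2 * z ^ 2 = 0 := by linear_combination hP
    have hz : z = 0 := by simpa [ha'] using this
    simp [hz]
  have hz : z ≠ 0 := by
    rintro rfl
    have : (b : ℚ) ^ 2 * w ^ 2 = 0 := by linear_combination hP
    exact hw (by simpa [hb'] using this)
  obtain ⟨p, q, hq, hcop, hpq⟩ :
      ∃ p q : ℤ, (q : ℚ) ≠ 0 ∧ IsCoprime p q ∧ (p : ℚ) / q = z / w := by
    refine ⟨(z / w).num, ((z / w).den : ℤ), ?_, Int.isCoprime_iff_gcd_eq_one.2 (z / w).reduced, ?_⟩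
    · have := (z / w).den_ne_zero
      exact_mod_cast this
    · exact_mod_cast (z / w).num_div_den
  have hp : (p : ℚ) ≠ 0 := by
    intro h
    rw [h, zero_div] at hpq
    exact div_ne_zero hz hw hpq.symm
  obtain ⟨s, rfl⟩ : ∃ s, w = q * s := ⟨w / q, by field_simp⟩
  have hs : s ≠ 0 := right_ne_zero_of_mul hw
  obtain rfl : z = p * s := by
    rw [div_eq_div_iff hq hw] at hpq
    apply mul_right_cancel₀ hq
    linear_combination -hpq
  have key : (a * p - b * q : ℚ) ^ 2 + s * (p * q * (a ^ 2 * p + b ^ 2 * q)) = 0 := by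
    apply mul_left_cancel₀ (pow_ne_zero 2 hs)
    linear_combination hP
  have hL : (a ^ 2 * p + b ^ 2 * q : ℚ) ≠ 0 := by
    intro hL
    rw [hL] at key
    have hk : (a * p - b * q : ℚ) = 0 := by
      rw [mul_zero, mul_zero, add_zero] at key
      exact pow_eq_zero_iff two_ne_zero |>.1 key
    have : (b : ℚ) * q * (a + b) = 0 := by linear_combination hL - a * hk
    simp_all
  have hk : (a * p - b * q : ℚ) ≠ 0 := by
    intro hk
    rw [hk] at key
    simp_all
  refine ⟨p, q, ?_, ⟨by exact_mod_cast hp, by exact_mod_cast hq, by exact_mod_cast hL,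
    by exact_mod_cast hk⟩, ?_⟩
  · exact hcop
  · rw [cuspPt, pt_inj]
    have h1 : (a * p - b * q : ℚ) ^ 2 / (p * (a ^ 2 * p + b ^ 2 * q)) = -(q * s) := by
      rw [div_eq_iff (mul_ne_zero hp hL)]; linear_combination key
    have h2 : (a * p - b * q : ℚ) ^ 2 / (q * (a ^ 2 * p + b ^ 2 * q)) = -(p * s) := by
      rw [div_eq_iff (mul_ne_zero hq hL)]; linear_combination key
    rw [h1, h2, sub_neg_eq_add, sub_neg_eq_add]
    exact ⟨rfl, rfl⟩

theorem cuspPt_inj {a b p q p' q' : ℤ} (h : IsRegularParam a b p q)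
    (h' : IsRegularParam a b p' q') (he : cuspPt a b p q = cuspPt a b p' q') :
    p * q' = p' * q := by
  obtain ⟨h1, h2, h3, h4⟩ := h.cast
  obtain ⟨h1', h2', h3', h4'⟩ := h'.cast
  rw [cuspPt, cuspPt, pt_inj] at he
  obtain ⟨e1, e2⟩ := he
  have f1 := sub_right_injective e1
  have f2 := sub_right_injective e2
  have e : (q : ℚ) / p = q' / p' := by
    calc (q : ℚ) / p = ((a * p - b * q : ℚ) ^ 2 / (p * (a ^ 2 * p + b ^ 2 * q))) /
          ((a * p - b * q : ℚ) ^ 2 / (q * (a ^ 2 * p + b ^ 2 * q))) := by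
          rw [div_div_div_cancel_left' _ _ (pow_ne_zero 2 h4), mul_div_mul_right _ _ h3]
      _ = ((a * p' - b * q' : ℚ) ^ 2 / (p' * (a ^ 2 * p' + b ^ 2 * q'))) /
          ((a * p' - b * q' : ℚ) ^ 2 / (q' * (a ^ 2 * p' + b ^ 2 * q'))) := by
        rw [f1, f2]
      _ = q' / p' := by
        rw [div_div_div_cancel_left' _ _ (pow_ne_zero 2 h4'), mul_div_mul_right _ _ h3']
  rw [div_eq_div_iff h1 h1'] at e
  have : (p * q' : ℚ) = p' * q := by linear_combination -e
  exact_mod_cast this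

theorem height_cuspPt {a b p q : ℤ} (h : IsRegularParam a b p q) :
    height (cuspPt a b p q) = Height.mulHeight fun i => ((cuspForm a b p q i : ℤ) : ℚ) := by
  obtain ⟨h1, h2, h3, h4⟩ := h.cast
  refine height_pt_of_smul (c := p * q * (a ^ 2 * p + b ^ 2 * q) ^ 3)
    (mul_ne_zero (mul_ne_zero h1 h2) (pow_ne_zero 3 h3)) _ fun i => ?_
  rw [intCast_cuspForm]
  fin_cases i <;> simp [cuspForm, chartSections] <;> field_simp <;> ring

/-- The greatest common divisor of the sections at the parameter `[p : q]`. -/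
def cuspGcd (a b p q : ℤ) : ℤ := Finset.univ.gcd (cuspForm a b p q)

theorem cuspForm_ne_zero {a b p q : ℤ} (h : IsRegularParam a b p q) : cuspForm a b p q ≠ 0 := by
  obtain ⟨h1, h2, h3, h4⟩ := h
  intro h
  have := congrFun h 5
  simp [cuspForm, h1, h2, h3] at this

theorem height_cuspPt_mul {a b p q : ℤ} (h : IsRegularParam a b p q) :
    height (cuspPt a b p q) * cuspGcd a b p q = ‖cuspForm (a : ℝ) b p q‖ := by
  rw [height_cuspPt h]
  have e : ∀ i, (cuspForm (a : ℝ) b p q) i = ((cuspForm a b p q i : ℤ) : ℝ) := fun i =>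
    (intCast_cuspForm a b p q i).symm
  apply le_antisymm
  · refine mulHeight_mul_gcd_le _ (cuspForm_ne_zero h) _ fun i => ?_
    rw [← e, ← Real.norm_eq_abs]
    exact norm_le_pi_norm _ i
  · refine (pi_norm_le_iff_of_nonneg ?_).2 fun i => ?_
    · exact (abs_nonneg _).trans (abs_le_mulHeight_mul_gcd _ 0)
    · rw [Real.norm_eq_abs, e]
      exact abs_le_mulHeight_mul_gcd _ i

theorem cuspGcd_nonneg (a b p q : ℤ) : 0 ≤ cuspGcd a b p q := by
  rw [cuspGcd, ← Finset.normalize_gcd]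
  exact Int.nonneg_of_normalize_eq_self (by simp)

/-- A multiple of all the greatest common divisors `cuspGcd a b p q`. -/
def cuspBound (a b : ℤ) : ℤ := b ^ 6 * a ^ 6 * (a ^ 7 * b ^ 6 * (a + b) ^ 6) ^ 3

/-- A resultant argument by hand. The gcd divides the last section pqL³ with L = a²p + b²q, so its
common parts with p, q and L are bounded separately. Modulo p the third section is -b⁶q⁵, modulo q
the second is -a⁶p⁵, and modulo L the first, times a, is a(a+b)⁶p²q³. -/
theorem cuspGcd_dvd {a b p q : ℤ} (hpq : IsCoprime p q) : cuspGcd a b p q ∣ cuspBound a b := by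
  set G := cuspGcd a b p q
  have hG : ∀ i, G ∣ cuspForm a b p q i := fun i => Finset.gcd_dvd (Finset.mem_univ i)
  have h5 : G ∣ p * q * (a ^ 2 * p + b ^ 2 * q) ^ 3 := hG 5
  have hmul : G ∣ gcd G p * gcd G q * gcd G (a ^ 2 * p + b ^ 2 * q) ^ 3 := by
    calc G ∣ gcd G (p * q * (a ^ 2 * p + b ^ 2 * q) ^ 3) := dvd_gcd dvd_rfl h5
      _ ∣ gcd G (p * q) * gcd G ((a ^ 2 * p + b ^ 2 * q) ^ 3) := gcd_mul_dvd_mul_gcd _ _ _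
      _ ∣ _ := mul_dvd_mul (gcd_mul_dvd_mul_gcd _ _ _) gcd_pow_right_dvd_pow_gcd
  refine hmul.trans (mul_dvd_mul (mul_dvd_mul ?_ ?_) (pow_dvd_pow_of_dvd ?_ 3))
  · have d1 := gcd_dvd_right G p
    have d2 := (gcd_dvd_left G p).trans (hG 2)
    have hco : IsCoprime (gcd G p) (q ^ 5) := (hpq.of_isCoprime_of_dvd_left d1).pow_right
    refine hco.dvd_of_dvd_mul_right ?_
    have e : b ^ 6 * q ^ 5 = p * (b * q ^ 2 * (2 * a + b) * (a ^ 2 * p + b ^ 2 * q) ^ 2 -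
        b ^ 2 * q ^ 3 * (a ^ 4 * p + 2 * a ^ 2 * b ^ 2 * q)) - cuspForm a b p q 2 := by
      simp only [cuspForm, Matrix.cons_val]; ring
    rw [e]
    exact dvd_sub (d1.mul_right _) d2
  · have d1 := gcd_dvd_right G q
    have d2 := (gcd_dvd_left G q).trans (hG 1)
    have hco : IsCoprime (gcd G q) (p ^ 5) := (hpq.symm.of_isCoprime_of_dvd_left d1).pow_right
    refine hco.dvd_of_dvd_mul_right ?_
    have e : a ^ 6 * p ^ 5 = q * (a * p ^ 2 * (a + 2 * b) * (a ^ 2 * p + b ^ 2 * q) ^ 2 -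
        a ^ 2 * p ^ 3 * (b ^ 4 * q + 2 * a ^ 2 * b ^ 2 * p)) - cuspForm a b p q 1 := by
      simp only [cuspForm, Matrix.cons_val]; ring
    rw [e]
    exact dvd_sub (d1.mul_right _) d2
  · obtain ⟨x, y, hxy⟩ := hpq.pow (m := 5) (n := 5)
    set L := a ^ 2 * p + b ^ 2 * q with hL
    have d1 := gcd_dvd_right G L
    have d2 := (gcd_dvd_left G L).trans (hG 0)
    have d3 : gcd G L ∣ a * (a + b) ^ 6 * p ^ 2 * q ^ 3 := by
      have e : a * (a + b) ^ 6 * p ^ 2 * q ^ 3 = a * cuspForm a b p q 0 -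
          L * (a * q ^ 2 * ((L - 2 * (a + b) ^ 2 * p) * ((a + b) ^ 2 * q - L) -
            (a + b) ^ 4 * p ^ 2)) := by
        simp only [cuspForm, Matrix.cons_val, hL]; ring
      rw [e]
      exact dvd_sub (d2.mul_left _) (d1.mul_right _)
    -- Modulo L one has a²p ≡ -b²q, which trades p for q and conversely. Reaching both p⁵ and q⁵
    -- allows a Bézout relation to remove them.
    have d4 : gcd G L ∣ a ^ 7 * b ^ 6 * (a + b) ^ 6 * q ^ 5 := by
      have e : a ^ 7 * b ^ 6 * (a + b) ^ 6 * q ^ 5 =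
          a ^ 6 * b ^ 2 * (a ^ 4 * (a * (a + b) ^ 6 * p ^ 2 * q ^ 3) -
            L * (a * (a + b) ^ 6 * q ^ 3 * (L - 2 * b ^ 2 * q))) := by
        rw [hL]; ring
      rw [e]
      exact (dvd_sub (d3.mul_left _) (d1.mul_right _)).mul_left _
    have d5 : gcd G L ∣ a ^ 7 * b ^ 6 * (a + b) ^ 6 * p ^ 5 := by
      have e : a ^ 7 * b ^ 6 * (a + b) ^ 6 * p ^ 5 =
          b ^ 6 * (L * (a * (a + b) ^ 6 * p ^ 2 * (L ^ 2 - 3 * L * a ^ 2 * p + 3 * a ^ 4 * p ^ 2)) -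
            b ^ 6 * (a * (a + b) ^ 6 * p ^ 2 * q ^ 3)) := by
        rw [hL]; ring
      rw [e]
      exact (dvd_sub (d1.mul_right _) (d3.mul_left _)).mul_left _
    have e : a ^ 7 * b ^ 6 * (a + b) ^ 6 = a ^ 7 * b ^ 6 * (a + b) ^ 6 * p ^ 5 * x +
        a ^ 7 * b ^ 6 * (a + b) ^ 6 * q ^ 5 * y := by
      linear_combination (-(a ^ 7 * b ^ 6 * (a + b) ^ 6)) * hxy
    rw [e]
    exact dvd_add (d5.mul_right _) (d4.mul_right _)

/-! ### Unimodular coordinates on the parameters -/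

/-- The point of the cuspidal curve with unimodular coordinates `k`, `l`, where `a d + b c = 1`;
it tends to the cusp when `k` is fixed and `l` tends to infinity. -/
def latPt (a b c d k l : ℤ) : Y3 := cuspPt a b (d * k + b * l) (a * l - c * k)

/-- The greatest common divisor of the sections at the parameters `k`, `l`. -/
def latGcd (a b c d k l : ℤ) : ℤ := cuspGcd a b (d * k + b * l) (a * l - c * k)

/-- The parameters `k`, `l` are coprime, normalized, and define a point of the chart. -/
def IsLatParam (a b c d k l : ℤ) : Prop :=
  1 ≤ l ∧ IsCoprime k l ∧ IsRegularParam a b (d * k + b * l) (a * l - c * k)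

section Lattice

variable {a b c d : ℤ}

theorem lat_k (h : a * d + b * c = 1) (k l : ℤ) :
    a * (d * k + b * l) - b * (a * l - c * k) = k := by
  linear_combination k * h

theorem IsLatParam.ne_zero (h : a * d + b * c = 1) {k l : ℤ} (hkl : IsLatParam a b c d k l) :
    k ≠ 0 := by
  have := hkl.2.2.2.2.2
  rwa [lat_k h] at this

theorem isCoprime_lat (h : a * d + b * c = 1) {k l : ℤ} (hkl : IsCoprime k l) :
    IsCoprime (d * k + b * l) (a * l - c * k) := by
  obtain ⟨x, y, hxy⟩ := hkl
  refine ⟨x * a + y * c, y * d - x * b, ?_⟩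
  linear_combination hxy + (x * k + y * l) * h

theorem latPt_inj (h : a * d + b * c = 1) {k l k' l' : ℤ} (h₁ : IsLatParam a b c d k l)
    (h₂ : IsLatParam a b c d k' l') (he : latPt a b c d k l = latPt a b c d k' l') :
    k = k' ∧ l = l' := by
  have e := cuspPt_inj h₁.2.2 h₂.2.2 he
  have e1 : k * l' = k' * l := by linear_combination e - (k * l' - k' * l) * h
  have d1 : l ∣ l' := h₁.2.1.symm.dvd_of_dvd_mul_left ⟨k', by linear_combination e1⟩
  have d2 : l' ∣ l := h₂.2.1.symm.dvd_of_dvd_mul_left ⟨k, by linear_combination -e1⟩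
  obtain rfl : l = l' := Int.dvd_antisymm (by linarith [h₁.1]) (by linarith [h₂.1]) d1 d2
  exact ⟨mul_right_cancel₀ (by linarith [h₁.1]) e1, rfl⟩

theorem cuspPt_neg (a b p q : ℤ) : cuspPt a b (-p) (-q) = cuspPt a b p q := by
  rw [cuspPt, cuspPt, pt_inj]
  push_cast
  constructor
  · congr 2 <;> ring
  · congr 2 <;> ring

theorem IsRegularParam.neg {a b p q : ℤ} (h : IsRegularParam a b p q) :
    IsRegularParam a b (-p) (-q) := by
  obtain ⟨h1, h2, h3, h4⟩ := h
  refine ⟨neg_ne_zero.2 h1, neg_ne_zero.2 h2, fun h => h3 ?_, fun h => h4 ?_⟩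
  · linear_combination -h
  · linear_combination -h

/-- The inverse unimodular substitution is k = ap - bq, l = cp + dq. Changing the sign of (p, q)
makes l ≥ 0; the case l = 0 is left to the size estimates. -/
theorem exists_latPt (h : a * d + b * c = 1) (hab : IsCuspidal a b) {P : Y3}
    (hP : P ∈ cuspCurve a b) (hc : P ∈ chart) (hQ : P ≠ Q) :
    ∃ k l : ℤ, 0 ≤ l ∧ IsCoprime k l ∧ IsRegularParam a b (d * k + b * l) (a * l - c * k) ∧
      P = latPt a b c d k l := by
  obtain ⟨p, q, hpq, hreg, rfl⟩ := exists_cuspPt hab hP hc hQ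
  have key : ∀ p q : ℤ, 0 ≤ c * p + d * q → IsCoprime p q → IsRegularParam a b p q →
      ∃ k l : ℤ, 0 ≤ l ∧ IsCoprime k l ∧ IsRegularParam a b (d * k + b * l) (a * l - c * k) ∧
        cuspPt a b p q = latPt a b c d k l := by
    intro p q hl hpq hreg
    have e1 : d * (a * p - b * q) + b * (c * p + d * q) = p := by linear_combination p * h
    have e2 : a * (c * p + d * q) - c * (a * p - b * q) = q := by linear_combination q * h
    refine ⟨a * p - b * q, c * p + d * q, hl, ?_, by rwa [e1, e2], by rw [latPt, e1, e2]⟩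
    obtain ⟨x, y, hxy⟩ := hpq
    exact ⟨x * d - y * c, x * b + y * a, by linear_combination hxy + (x * p + y * q) * h⟩
  rcases le_total 0 (c * p + d * q) with hl | hl
  · exact key p q hl hpq hreg
  · rw [← cuspPt_neg]
    exact key (-p) (-q) (by linarith) hpq.neg_neg hreg.neg

theorem latGcd_dvd (h : a * d + b * c = 1) {k l : ℤ} (hkl : IsCoprime k l) :
    latGcd a b c d k l ∣ cuspBound a b :=
  cuspGcd_dvd (isCoprime_lat h hkl)

/-- Sections at congruent l are congruent modulo `cuspBound a b`, a multiple of the gcd. So for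
fixed k the gcd is periodic in l on the values prime to k, which makes the count a Riemann sum in
each residue class. -/
theorem latGcd_dvd_of_modEq (h : a * d + b * c = 1) {k l l' : ℤ} (hkl : IsCoprime k l)
    (hl : l ≡ l' [ZMOD cuspBound a b]) : latGcd a b c d k l ∣ latGcd a b c d k l' := by
  change _ ∣ (Finset.univ : Finset (Fin 6)).gcd _
  refine Finset.dvd_gcd fun i _ => ?_
  have h1 : latGcd a b c d k l ∣ cuspForm a b (d * k + b * l) (a * l - c * k) i :=
    Finset.gcd_dvd (Finset.mem_univ i)
  have hp : d * k + b * l ≡ d * k + b * l' [ZMOD cuspBound a b] := by gcongr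
  have hq : a * l - c * k ≡ a * l' - c * k [ZMOD cuspBound a b] := by gcongr
  have h2 : cuspForm a b (d * k + b * l) (a * l - c * k) i ≡
      cuspForm a b (d * k + b * l') (a * l' - c * k) i [ZMOD cuspBound a b] := by
    fin_cases i <;> simp only [cuspForm] <;> dsimp <;> gcongr
  exact ((h2.of_dvd (latGcd_dvd h hkl)).dvd_iff).1 h1

theorem latGcd_eq_of_modEq (h : a * d + b * c = 1) {k l l' : ℤ} (hkl : IsCoprime k l)
    (hkl' : IsCoprime k l') (hl : l ≡ l' [ZMOD cuspBound a b]) :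
    latGcd a b c d k l = latGcd a b c d k l' :=
  Int.dvd_antisymm (cuspGcd_nonneg _ _ _ _) (cuspGcd_nonneg _ _ _ _)
    (latGcd_dvd_of_modEq h hkl hl) (latGcd_dvd_of_modEq h hkl' hl.symm)

theorem cuspBound_ne_zero (hab : IsCuspidal a b) : cuspBound a b ≠ 0 := by
  obtain ⟨-, ha, hb, hab⟩ := hab
  simp [cuspBound, ha, hb, hab]

theorem latGcd_pos (hab : IsCuspidal a b) (h : a * d + b * c = 1) {k l : ℤ} (hkl : IsCoprime k l) :
    0 < latGcd a b c d k l := by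
  refine lt_of_le_of_ne (cuspGcd_nonneg _ _ _ _) fun h0 => cuspBound_ne_zero hab ?_
  have := latGcd_dvd h hkl
  rw [← h0, zero_dvd_iff] at this
  exact this

theorem latGcd_le (hab : IsCuspidal a b) (h : a * d + b * c = 1) {k l : ℤ} (hkl : IsCoprime k l) :
    (latGcd a b c d k l : ℝ) ≤ (cuspBound a b).natAbs := by
  have := Int.le_of_dvd (abs_pos.2 (cuspBound_ne_zero hab)) ((dvd_abs _ _).2 (latGcd_dvd h hkl))
  rw [Nat.cast_natAbs]
  exact_mod_cast this

theorem one_le_abs_cast {n : ℤ} (h : n ≠ 0) : (1 : ℝ) ≤ |(n : ℝ)| := by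
  exact_mod_cast Int.one_le_abs h

theorem abs_lat_le {a b c d k l E m : ℝ} (hE : |a| + |b| + |c| + |d| ≤ E) (hk : |k| ≤ m)
    (hl : |l| ≤ m) : |d * k + b * l| ≤ E * m ∧ |a * l - c * k| ≤ E * m ∧
      |a ^ 2 * (d * k + b * l) + b ^ 2 * (a * l - c * k)| ≤ 2 * E ^ 3 * m := by
  have hm0 : 0 ≤ m := (abs_nonneg _).trans hk
  have ha0 := abs_nonneg a
  have hb0 := abs_nonneg b
  have hc0 := abs_nonneg c
  have hd0 := abs_nonneg d
  have h1 : |d * k + b * l| ≤ E * m := by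
    calc |d * k + b * l| ≤ |d| * |k| + |b| * |l| := by
          rw [← abs_mul, ← abs_mul]; exact abs_add_le _ _
      _ ≤ |d| * m + |b| * m := by gcongr
      _ = (|d| + |b|) * m := by ring
      _ ≤ E * m := by gcongr; linarith
  have h2 : |a * l - c * k| ≤ E * m := by
    calc |a * l - c * k| ≤ |a| * |l| + |c| * |k| := by
          rw [← abs_mul, ← abs_mul]; exact abs_sub _ _
      _ ≤ |a| * m + |c| * m := by gcongr
      _ = (|a| + |c|) * m := by ring
      _ ≤ E * m := by gcongr; linarith
  refine ⟨h1, h2, ?_⟩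
  have haE : |a| ≤ E := by linarith
  have hbE : |b| ≤ E := by linarith
  calc _ ≤ |a| ^ 2 * |d * k + b * l| + |b| ^ 2 * |a * l - c * k| := by
        rw [← abs_pow, ← abs_pow, ← abs_mul, ← abs_mul]; exact abs_add_le _ _
    _ ≤ E ^ 2 * (E * m) + E ^ 2 * (E * m) := by gcongr
    _ = _ := by ring

/-- As linear forms in k and l, the three quantities have l-coefficients b, a and ab(a + b), of
absolute value at least 1, and k-coefficients at most 2E³. So l dominates once |k| is small. -/
theorem half_le_abs_lat {a b c d k l E : ℝ} (hE : |a| + |b| + |c| + |d| ≤ E) (ha : 1 ≤ |a|)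
    (hb : 1 ≤ |b|) (hab : 1 ≤ |a + b|) (hl : 0 ≤ l) (hk : 4 * E ^ 3 * |k| ≤ l) :
    l / 2 ≤ |d * k + b * l| ∧ l / 2 ≤ |a * l - c * k| ∧
      l / 2 ≤ |a ^ 2 * (d * k + b * l) + b ^ 2 * (a * l - c * k)| := by
  have hc0 := abs_nonneg c
  have hd0 := abs_nonneg d
  have hk0 := abs_nonneg k
  have lower : ∀ x y : ℝ, 1 ≤ |y| → |x| ≤ 2 * E ^ 3 → l / 2 ≤ |x * k + y * l| := by
    intro x y hy hx
    have h1 := abs_sub_abs_le_abs_sub (y * l) (-(x * k))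
    rw [abs_neg, abs_mul, abs_mul, abs_of_nonneg hl, sub_neg_eq_add, add_comm (y * l)] at h1
    have h2 := mul_le_mul_of_nonneg_right hx hk0
    have h3 := mul_le_mul_of_nonneg_right hy hl
    linarith
  have hE1 : 1 ≤ E := by linarith
  have hE3 : E ≤ E ^ 3 := le_self_pow₀ hE1 (by norm_num)
  refine ⟨lower d b hb (by linarith), ?_, ?_⟩
  · have := lower (-c) a ha (by rw [abs_neg]; linarith)
    rwa [show -c * k + a * l = a * l - c * k by ring] at this
  · have := lower (a ^ 2 * d - b ^ 2 * c) (a * b * (a + b)) (by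
      rw [abs_mul, abs_mul]
      exact one_le_mul_of_one_le_of_one_le (one_le_mul_of_one_le_of_one_le ha hb) hab) (by
      have haE : |a| ≤ E := by linarith
      have hbE : |b| ≤ E := by linarith
      have hcE : |c| ≤ E := by linarith
      have hdE : |d| ≤ E := by linarith
      calc |a ^ 2 * d - b ^ 2 * c| ≤ |a| ^ 2 * |d| + |b| ^ 2 * |c| := by
            rw [← abs_pow, ← abs_pow, ← abs_mul, ← abs_mul]; exact abs_sub _ _
        _ ≤ E ^ 2 * E + E ^ 2 * E := by gcongr
        _ = _ := by ring)
    rwa [show (a ^ 2 * d - b ^ 2 * c) * k + a * b * (a + b) * l =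
      a ^ 2 * (d * k + b * l) + b ^ 2 * (a * l - c * k) by ring] at this

/-- If `k² / (p L)` is of order `T⁻²`, then `k` is small compared to `l`. -/
theorem small_of_sq_le {a b c d k l E ρ T : ℝ} (hE : |a| + |b| + |c| + |d| ≤ E) (hE1 : 1 ≤ E)
    (hρ : 1 ≤ ρ) (hl : 0 ≤ l) (hk : k ≠ 0) (hT1 : 1 ≤ T)
    (hT : ρ * (2 * E ^ 4) * (4 * E ^ 3) ^ 2 ≤ T)
    (h : T ^ 2 * k ^ 2 ≤ ρ *
      (|d * k + b * l| * |a ^ 2 * (d * k + b * l) + b ^ 2 * (a * l - c * k)|)) :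
    4 * E ^ 3 * |k| ≤ l ∧ T ^ 2 * k ^ 2 ≤ ρ * (2 * E ^ 4) * l ^ 2 := by
  set m := max |k| l with hm
  have hkm : |k| ≤ m := le_max_left _ _
  have hlm : |l| ≤ m := by rw [abs_of_nonneg hl]; exact le_max_right _ _
  have hm0 : 0 ≤ m := (abs_nonneg _).trans hkm
  obtain ⟨h1, -, h2⟩ := abs_lat_le hE hkm hlm
  have hkm2 : T ^ 2 * k ^ 2 ≤ ρ * (2 * E ^ 4) * m ^ 2 := by
    calc T ^ 2 * k ^ 2 ≤ _ := h
      _ ≤ ρ * ((E * m) * (2 * E ^ 3 * m)) := by gcongr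
      _ = _ := by ring
  have hTT : ρ * (2 * E ^ 4) * (4 * E ^ 3) ^ 2 ≤ T ^ 2 := hT.trans (le_self_pow₀ hT1 two_ne_zero)
  have hsmall : 4 * E ^ 3 * |k| ≤ m := by
    have h1 : ρ * (2 * E ^ 4) * ((4 * E ^ 3) ^ 2 * k ^ 2) ≤ ρ * (2 * E ^ 4) * m ^ 2 := by
      calc _ = ρ * (2 * E ^ 4) * (4 * E ^ 3) ^ 2 * k ^ 2 := by ring
        _ ≤ T ^ 2 * k ^ 2 := by gcongr
        _ ≤ _ := hkm2
    have h2 := le_of_mul_le_mul_left h1 (by positivity)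
    have h3 : (4 * E ^ 3 * |k|) ^ 2 ≤ m ^ 2 := by
      rw [mul_pow, sq_abs]; exact h2
    exact (pow_le_pow_iff_left₀ (by positivity) hm0 two_ne_zero).1 h3
  have hml : m = l := by
    rcases max_cases |k| l with ⟨h1, -⟩ | ⟨h1, -⟩
    · have hk0 : 0 < |k| := abs_pos.2 hk
      have hE3 : 1 ≤ E ^ 3 := one_le_pow₀ hE1
      rw [hm, h1] at hsmall
      nlinarith
    · rw [hm, h1]
  rw [hml] at hsmall hkm2
  exact ⟨hsmall, hkm2⟩

theorem sq_div_le_norm_latPt (h : a * d + b * c = 1) (k l : ℤ) :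
    (k : ℝ) ^ 2 / (|(d * k + b * l : ℝ)| *
      |(a ^ 2 * (d * k + b * l) + b ^ 2 * (a * l - c * k) : ℝ)|) ≤
      ‖toTangent (latPt a b c d k l)‖ := by
  refine le_trans (le_of_eq ?_) (norm_fst_le _)
  rw [latPt, cuspPt, toTangent_pt]
  have hk : (a : ℝ) * (d * k + b * l) - b * (a * l - c * k) = k := by exact_mod_cast lat_k h k l
  push_cast
  rw [hk, sub_sub_cancel_left, Real.norm_eq_abs, abs_neg, abs_div, abs_mul, abs_pow, sq_abs]

/-- The points of the curve that are counted have bounded `k` and `l = O(T)`. -/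
theorem lat_bounds (hab : IsCuspidal a b) (h : a * d + b * c = 1) (ρ : ℝ) :
    ∃ (K D : ℕ), ∀ᶠ T : ℝ in atTop, ∀ k l : ℤ, 0 ≤ l → IsCoprime k l →
      IsRegularParam a b (d * k + b * l) (a * l - c * k) →
      height (latPt a b c d k l) ≤ T ^ 5 → T ^ 2 * ‖toTangent (latPt a b c d k l)‖ ≤ ρ →
      1 ≤ l ∧ (l : ℝ) ≤ D * T ∧ |k| ≤ K := by
  obtain ⟨ρ', hρ', hρ1⟩ : ∃ ρ', ρ ≤ ρ' ∧ 1 ≤ ρ' := ⟨max ρ 1, le_max_left _ _, le_max_right _ _⟩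
  obtain ⟨E, hE⟩ : ∃ E : ℝ, |(a : ℝ)| + |(b : ℝ)| + |(c : ℝ)| + |(d : ℝ)| = E := ⟨_, rfl⟩
  have ha := one_le_abs_cast hab.2.1
  have hb := one_le_abs_cast hab.2.2.1
  have hab1 := one_le_abs_cast hab.2.2.2
  push_cast at hab1
  have hE1 : 1 ≤ E := by linarith [abs_nonneg (c : ℝ), abs_nonneg (d : ℝ)]
  obtain ⟨R, hR⟩ : ∃ R : ℝ, ((cuspBound a b).natAbs : ℝ) = R := ⟨_, rfl⟩
  have hR0 : 0 ≤ R := hR ▸ Nat.cast_nonneg _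
  obtain ⟨D, hD⟩ : ∃ D, 32 * R + 1 = D := ⟨_, rfl⟩
  obtain ⟨K, hK⟩ := exists_nat_ge (ρ' * (2 * E ^ 4) * D ^ 2)
  refine ⟨K, 32 * (cuspBound a b).natAbs + 1, ?_⟩
  filter_upwards [eventually_ge_atTop (1 : ℝ),
    eventually_ge_atTop (ρ' * (2 * E ^ 4) * (4 * E ^ 3) ^ 2)] with T hT1 hT k l hl hkl hreg hH hN
  have hnorm := height_cuspPt_mul hreg
  obtain ⟨hp, hq, hL, hk⟩ := hreg
  rw [lat_k h] at hk
  have hp0 : (0 : ℝ) < |(d * k + b * l : ℝ)| := abs_pos.2 (by exact_mod_cast hp)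
  have hL0 : (0 : ℝ) < |(a ^ 2 * (d * k + b * l) + b ^ 2 * (a * l - c * k) : ℝ)| :=
    abs_pos.2 (by exact_mod_cast hL)
  have hw := (mul_le_mul_of_nonneg_left (sq_div_le_norm_latPt h k l) (sq_nonneg T)).trans
    (hN.trans hρ')
  rw [← mul_div_assoc, div_le_iff₀ (mul_pos hp0 hL0)] at hw
  have hl0 : (0 : ℝ) ≤ l := by exact_mod_cast hl
  have hk1 := one_le_abs_cast hk
  obtain ⟨hsmall, hkm2⟩ := small_of_sq_le hE.le hE1 hρ1 hl0 (by exact_mod_cast hk) hT1 hT hw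
  obtain ⟨l1, l2, l3⟩ := half_le_abs_lat hE.le ha hb hab1 hl0 hsmall
  have hE3 : 1 ≤ E ^ 3 := one_le_pow₀ hE1
  have hl1 : (1 : ℝ) ≤ l := by nlinarith
  have hG := latGcd_le hab h hkl
  rw [hR] at hG
  -- The last section pqL³ alone has size at least (l/2)^5, while all sections are at most height
  -- times gcd, hence at most T^5 R. This explains D = 32R + 1.
  have hform : (l : ℝ) ^ 5 / 32 ≤ T ^ 5 * R := by
    have hH0 : 0 ≤ height (latPt a b c d k l) := by linarith [one_le_height (latPt a b c d k l)]
    have hG0 : (0 : ℝ) ≤ latGcd a b c d k l := by exact_mod_cast cuspGcd_nonneg _ _ _ _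
    calc (l : ℝ) ^ 5 / 32 = l / 2 * (l / 2) * (l / 2) ^ 3 := by ring
      _ ≤ |(d * k + b * l : ℝ)| * |(a * l - c * k : ℝ)| *
          |(a ^ 2 * (d * k + b * l) + b ^ 2 * (a * l - c * k) : ℝ)| ^ 3 := by gcongr
      _ = ‖cuspForm (a : ℝ) b (d * k + b * l) (a * l - c * k) 5‖ := by
        rw [Real.norm_eq_abs, ← abs_mul, ← abs_pow, ← abs_mul]
        rfl
      _ ≤ ‖cuspForm (a : ℝ) b (d * k + b * l) (a * l - c * k)‖ := norm_le_pi_norm _ 5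
      _ = height (latPt a b c d k l) * latGcd a b c d k l := by
        push_cast at hnorm
        exact hnorm.symm
      _ ≤ T ^ 5 * R := by gcongr
  have hD1 : 1 ≤ D := by linarith
  have hlT : (l : ℝ) ≤ D * T := by
    refine (pow_le_pow_iff_left₀ hl0 (by positivity) (by norm_num : 5 ≠ 0)).1 ?_
    have hD5 : D ≤ D ^ 5 := le_self_pow₀ hD1 (by norm_num)
    calc (l : ℝ) ^ 5 ≤ 32 * R * T ^ 5 := by linarith
      _ ≤ D ^ 5 * T ^ 5 := by gcongr; linarith
      _ = (D * T) ^ 5 := by ring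
  refine ⟨by exact_mod_cast hl1, by push_cast; rw [hR, hD]; exact hlT, ?_⟩
  have hk2 : (k : ℝ) ^ 2 ≤ K := by
    have : T ^ 2 * (k : ℝ) ^ 2 ≤ T ^ 2 * (ρ' * (2 * E ^ 4) * D ^ 2) := by
      calc T ^ 2 * (k : ℝ) ^ 2 ≤ ρ' * (2 * E ^ 4) * (l : ℝ) ^ 2 := hkm2
        _ ≤ ρ' * (2 * E ^ 4) * (D * T) ^ 2 := by gcongr
        _ = _ := by ring
    exact (le_of_mul_le_mul_left this (by positivity)).trans hK
  have hk3 : |(k : ℝ)| ≤ K := by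
    rw [← sq_abs] at hk2
    nlinarith
  exact_mod_cast hk3

end Lattice

/-! ### Integrals for sums of measures -/

/-- Only finitely many summands see f, so integrability against the whole sum follows from
integrability against those. -/
theorem integral_sum_eq_sum {ι : Type*} {μ : ι → Measure (ℝ × ℝ)} {f : ℝ × ℝ → ℝ}
    (hf : StronglyMeasurable f) (F : Finset ι) (hF : ∀ i ∈ F, Integrable f (μ i))
    (h0 : ∀ i ∉ F, f =ᵐ[μ i] 0) : ∫ v, f v ∂(Measure.sum μ) = ∑ i ∈ F, ∫ v, f v ∂(μ i) := by
  have hint : Integrable f (Measure.sum μ) := by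
    refine ⟨hf.aestronglyMeasurable, ?_⟩
    rw [HasFiniteIntegral, lintegral_sum_measure, tsum_eq_sum (s := F)]
    · exact ENNReal.sum_lt_top.2 fun i hi => (hF i hi).2
    · intro i hi
      rw [lintegral_congr_ae (g := 0)]
      · simp
      · filter_upwards [h0 i hi] with x hx
        simp [hx]
  rw [integral_sum_measure hint, tsum_eq_sum]
  intro i hi
  exact integral_eq_zero_of_ae (h0 i hi)

open Classical in
theorem integral_zoom {W : Set Y3} {B r : ℝ} {f : ℝ × ℝ → ℝ} (hf : Continuous f) (F : Finset Y3)
    (hF : ∀ P ∈ F, P ∈ W ∧ P ∈ chart ∧ height P ≤ B)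
    (h0 : ∀ P ∉ F, P ∈ W → P ∈ chart → height P ≤ B → f (B ^ (1 / r) • toTangent P) = 0) :
    ∫ v, f v ∂(zoom W B r) = ∑ P ∈ F, f (B ^ (1 / r) • toTangent P) := by
  rw [zoom, integral_sum_eq_sum hf.stronglyMeasurable
    (F.subtype fun P => P ∈ W ∧ P ∈ chart ∧ height P ≤ B)]
  · simp_rw [integral_dirac]
    rw [← Finset.sum_subtype_of_mem _ hF]
  · exact fun _ _ => integrable_dirac (by simp)
  · intro P hP
    rw [Finset.mem_subtype] at hP
    have := h0 P hP P.2.1 P.2.2.1 P.2.2.2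
    rw [EventuallyEq, ae_dirac_iff]
    · exact this
    · exact hf.measurable (measurableSet_singleton 0)

/-! ### The limit measure -/

/-- The direction of the tangent half-line. -/
noncomputable def rayDir (a b : ℤ) : ℝ × ℝ :=
  ((a * b ^ 2 * (a + b) : ℝ)⁻¹, (a ^ 2 * b * (a + b) : ℝ)⁻¹)

/-- The parametrization of the tangent half-line by `ξ > 0`. -/
noncomputable def rayMap (a b : ℤ) (ξ : ℝ) : ℝ × ℝ := -(ξ ^ 2)⁻¹ • rayDir a b

/-- The leading coefficient of the sections at the cusp. -/
noncomputable def cuspLead (a b : ℤ) : ℝ := |(a ^ 4 * b ^ 4 * (a + b) ^ 3 : ℝ)|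

/-- The range of the parameter of the half-line for the points with given `k` and residue class of
`l`. -/
def rayRange (a b c d : ℤ) (i : Σ _ : ℤ, ℕ) : Set ℝ :=
  {ξ | (i.1 ≠ 0 ∧ i.2 < (cuspBound a b).natAbs * i.1.natAbs ∧ IsCoprime i.1 (i.2 : ℤ)) ∧
    0 < ξ ∧ cuspLead a b * (|(i.1 : ℝ)| * ξ) ^ 5 < latGcd a b c d i.1 i.2}

/-- The contribution to the limit measure of the points with given `k` and residue class of `l`. -/
noncomputable def rayPiece (a b c d : ℤ) (i : Σ _ : ℤ, ℕ) : Measure (ℝ × ℝ) :=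
  ((cuspBound a b).natAbs : ℝ≥0∞)⁻¹ •
    (volume.restrict (rayRange a b c d i)).map (rayMap a b)

/-- The limit of the zoom measures of a cuspidal curve. -/
noncomputable def rayMeasure (a b c d : ℤ) : Measure (ℝ × ℝ) :=
  Measure.sum (rayPiece a b c d)

section Ray

variable {a b c d : ℤ}

theorem measurable_rayMap (a b : ℤ) : Measurable (rayMap a b) :=
  ((measurable_id.pow_const 2).inv.neg).smul_const _

theorem measurableSet_rayRange (a b c d : ℤ) (i : Σ _ : ℤ, ℕ) :
    MeasurableSet (rayRange a b c d i) := by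
  refine (MeasurableSet.const _).inter (measurableSet_Ioi.inter ?_)
  exact measurableSet_lt (f := fun ξ : ℝ => cuspLead a b * (|(i.1 : ℝ)| * ξ) ^ 5) (by fun_prop)
    measurable_const

theorem IsCuspidal.cast (hab : IsCuspidal a b) : (a : ℝ) ≠ 0 ∧ (b : ℝ) ≠ 0 ∧ (a + b : ℝ) ≠ 0 := by
  obtain ⟨-, h1, h2, h3⟩ := hab
  exact ⟨by exact_mod_cast h1, by exact_mod_cast h2, by exact_mod_cast h3⟩

theorem rayDir_fst_ne (hab : IsCuspidal a b) : (rayDir a b).1 ≠ 0 := by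
  obtain ⟨h1, h2, h3⟩ := hab.cast
  simp [rayDir, h1, h2, h3]

theorem norm_rayDir_pos (hab : IsCuspidal a b) : 0 < ‖rayDir a b‖ :=
  norm_pos_iff.2 fun h => rayDir_fst_ne hab (by rw [h]; rfl)

theorem cuspLead_pos (hab : IsCuspidal a b) : 0 < cuspLead a b := by
  obtain ⟨h1, h2, h3⟩ := hab.cast
  exact abs_pos.2 (by simp [h1, h2, h3])

theorem norm_rayMap (ξ : ℝ) : ‖rayMap a b ξ‖ = (ξ ^ 2)⁻¹ * ‖rayDir a b‖ := by
  rw [rayMap, norm_smul, norm_neg, norm_inv, norm_pow, Real.norm_eq_abs, sq_abs]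

/-- In a bounded region only finitely many pieces are present. -/
theorem rayRange_bound (hab : IsCuspidal a b) (h : a * d + b * c = 1) (ρ : ℝ) :
    ∃ K : ℕ, ∀ K' : ℕ, K ≤ K' → ∀ i : Σ _ : ℤ, ℕ, ∀ ξ ∈ rayRange a b c d i,
      ‖rayMap a b ξ‖ ≤ ρ → i ∈ (Finset.Icc (-(K' : ℤ)) K').sigma
        fun k => Finset.range ((cuspBound a b).natAbs * k.natAbs) := by
  obtain ⟨R, hR⟩ : ∃ R : ℝ, ((cuspBound a b).natAbs : ℝ) = R := ⟨_, rfl⟩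
  have hv := norm_rayDir_pos hab
  have h0 := cuspLead_pos hab
  obtain ⟨D, hD⟩ : ∃ D, max 1 (R / cuspLead a b) = D := ⟨_, rfl⟩
  have hD1 : 1 ≤ D := hD ▸ le_max_left _ _
  -- The height condition gives |k|ξ ≤ D, and ‖`rayMap a b ξ`‖ ≤ ρ bounds ξ from below by a multiple
  -- of ρ^(-1/2); together they bound |k|.
  obtain ⟨K, hK⟩ := exists_nat_ge (ρ * D ^ 2 / ‖rayDir a b‖)
  refine ⟨K, fun K' hKK' ⟨k, r⟩ ξ ⟨⟨hk, hr, hco⟩, hξ, hlt⟩ hnorm => ?_⟩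
  refine Finset.mem_sigma.2 ⟨?_, Finset.mem_range.2 hr⟩
  simp only at hk hr hco hlt ⊢
  have hG := latGcd_le hab h hco
  rw [hR] at hG
  have h1 : (|(k : ℝ)| * ξ) ^ 5 < D ^ 5 := by
    calc (|(k : ℝ)| * ξ) ^ 5 < R / cuspLead a b := by
          rw [lt_div_iff₀ h0, mul_comm]; exact hlt.trans_le hG
      _ ≤ D := hD ▸ le_max_right _ _
      _ ≤ D ^ 5 := le_self_pow₀ hD1 (by norm_num)
  have h2 : |(k : ℝ)| * ξ ≤ D := (lt_of_pow_lt_pow_left₀ 5 (by linarith) h1).le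
  rw [norm_rayMap, inv_mul_le_iff₀ (by positivity)] at hnorm
  have hρ : 0 ≤ ρ := by
    by_contra! hneg
    nlinarith [sq_nonneg ξ]
  have h3 : (k : ℝ) ^ 2 ≤ K := by
    refine le_trans ?_ hK
    rw [le_div_iff₀ hv]
    calc (k : ℝ) ^ 2 * ‖rayDir a b‖ ≤ (k : ℝ) ^ 2 * (ξ ^ 2 * ρ) := by gcongr
      _ = ρ * (|(k : ℝ)| * ξ) ^ 2 := by rw [mul_pow, sq_abs]; ring
      _ ≤ ρ * D ^ 2 := by gcongr
  have h4 : |(k : ℝ)| ≤ K := by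
    have := one_le_abs_cast hk
    rw [← sq_abs] at h3
    nlinarith
  have h5 : |k| ≤ K := by exact_mod_cast h4
  rw [Finset.mem_Icc]
  have := abs_le.1 h5
  omega

theorem rayPiece_apply {i : Σ _ : ℤ, ℕ} {A : Set (ℝ × ℝ)} (hA : MeasurableSet A) :
    rayPiece a b c d i A = ((cuspBound a b).natAbs : ℝ≥0∞)⁻¹ *
      volume (rayMap a b ⁻¹' A ∩ rayRange a b c d i) := by
  rw [rayPiece, Measure.smul_apply, Measure.map_apply (measurable_rayMap a b) hA,
    Measure.restrict_apply (measurable_rayMap a b hA), smul_eq_mul]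

theorem rayMeasure_eq_zero {A : Set (ℝ × ℝ)} (hA : MeasurableSet A)
    (h : volume (rayMap a b ⁻¹' A ∩ Set.Ioi 0) = 0) : rayMeasure a b c d A = 0 := by
  rw [rayMeasure, Measure.sum_apply _ hA, ENNReal.tsum_eq_zero]
  intro i
  rw [rayPiece_apply hA, measure_mono_null _ h, mul_zero]
  exact Set.inter_subset_inter_right _ fun ξ hξ => hξ.2.1

theorem volume_rayRange_lt_top (hab : IsCuspidal a b) {i : Σ _ : ℤ, ℕ} :
    volume (rayRange a b c d i) < ∞ := by
  obtain ⟨k, r⟩ := i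
  obtain ⟨g, hg⟩ : ∃ g : ℝ, (latGcd a b c d k r : ℝ) = g := ⟨_, rfl⟩
  have h0 := cuspLead_pos hab
  refine (measure_mono (t := Set.Icc 0 (max 1 (g / cuspLead a b))) ?_).trans_lt
    measure_Icc_lt_top
  rintro ξ ⟨⟨hk, -, -⟩, hξ, hlt⟩
  simp only at hk hlt
  rw [hg, mul_comm, ← lt_div_iff₀ h0] at hlt
  refine ⟨hξ.le, ?_⟩
  set D := max 1 (g / cuspLead a b)
  have hD1 : 1 ≤ D := le_max_left _ _
  have h1 : (|(k : ℝ)| * ξ) ^ 5 < D ^ 5 :=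
    (hlt.trans_le (le_max_right _ _)).trans_le (le_self_pow₀ hD1 (by norm_num))
  have h2 := (lt_of_pow_lt_pow_left₀ 5 (by linarith) h1).le
  exact (le_mul_of_one_le_left hξ.le (one_le_abs_cast hk)).trans h2

theorem inv_cuspBound_ne_top (hab : IsCuspidal a b) :
    ((cuspBound a b).natAbs : ℝ≥0∞)⁻¹ ≠ ∞ := by
  simp [cuspBound_ne_zero hab]

theorem isFiniteMeasure_rayPiece (hab : IsCuspidal a b) (i : Σ _ : ℤ, ℕ) :
    IsFiniteMeasure (rayPiece a b c d i) := by
  constructor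
  rw [rayPiece_apply MeasurableSet.univ]
  refine ENNReal.mul_lt_top (inv_cuspBound_ne_top hab).lt_top ?_
  exact (measure_mono Set.inter_subset_right).trans_lt (volume_rayRange_lt_top hab)

theorem isFiniteMeasureOnCompacts_rayMeasure (hab : IsCuspidal a b) (h : a * d + b * c = 1) :
    IsFiniteMeasureOnCompacts (rayMeasure a b c d) := by
  constructor
  intro K hK
  obtain ⟨ρ, hρ⟩ := hK.isBounded.subset_closedBall 0
  refine (measure_mono hρ).trans_lt ?_
  obtain ⟨N, hN⟩ := rayRange_bound hab h ρ
  rw [rayMeasure, Measure.sum_apply _ measurableSet_closedBall,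
    tsum_eq_sum (s := (Finset.Icc (-(N : ℤ)) N).sigma
      fun k => Finset.range ((cuspBound a b).natAbs * k.natAbs))]
  · refine ENNReal.sum_lt_top.2 fun i _ => ?_
    have := isFiniteMeasure_rayPiece (c := c) (d := d) hab i
    exact measure_lt_top _ _
  · intro i hi
    rw [rayPiece_apply measurableSet_closedBall]
    rw [show rayMap a b ⁻¹' Metric.closedBall 0 ρ ∩ rayRange a b c d i = ∅ from ?_]
    · simp
    rw [Set.eq_empty_iff_forall_notMem]
    rintro ξ ⟨h1, h2⟩
    exact hi (hN N le_rfl i ξ h2 (mem_closedBall_zero_iff.1 h1))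

theorem rayMap_mem_tangentRay (hab : IsCuspidal a b) (ξ : ℝ) :
    rayMap a b ξ ∈ tangentRay a b := by
  obtain ⟨h1, h2, h3⟩ := hab.cast
  constructor
  · simp only [rayMap, rayDir, Prod.smul_mk, smul_eq_mul]
    field_simp
  · have e : (rayMap a b ξ).1 + (rayMap a b ξ).2 = -((ξ ^ 2)⁻¹ * ((a * b : ℝ) ^ 2)⁻¹) := by
      simp only [rayMap, rayDir, Prod.smul_mk, smul_eq_mul]
      field_simp
      ring
    rw [e, neg_nonpos]
    positivity

theorem measurableSet_tangentRay (a b : ℤ) : MeasurableSet (tangentRay a b) :=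
  (measurableSet_eq_fun (f := fun v : ℝ × ℝ => (a : ℝ) * v.2) (g := fun v => b * v.1) (by fun_prop)
    (by fun_prop)).inter (measurableSet_le (f := fun v : ℝ × ℝ => v.1 + v.2) (by fun_prop)
    measurable_const)

theorem rayMeasure_compl_tangentRay (hab : IsCuspidal a b) :
    rayMeasure a b c d (tangentRay a b)ᶜ = 0 := by
  refine rayMeasure_eq_zero (measurableSet_tangentRay a b).compl ?_
  rw [show rayMap a b ⁻¹' (tangentRay a b)ᶜ ∩ Set.Ioi 0 = ∅ from ?_, measure_empty]
  rw [Set.eq_empty_iff_forall_notMem]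
  rintro ξ ⟨h, -⟩
  exact h (rayMap_mem_tangentRay hab ξ)

/-- The norm is injective along the half-line, so a sphere is hit at most once. Hence open and
closed balls have equal mass, as required for passing from test functions to balls. -/
theorem rayMeasure_sphere (hab : IsCuspidal a b) (ε : ℝ) :
    rayMeasure a b c d (Metric.sphere 0 ε) = 0 := by
  refine rayMeasure_eq_zero Metric.isClosed_sphere.measurableSet ?_
  refine Set.Subsingleton.measure_zero ?_ _
  rintro ξ ⟨h1, hξ⟩ η ⟨h2, hη⟩
  have hv := norm_rayDir_pos hab
  rw [Set.mem_preimage, mem_sphere_zero_iff_norm, norm_rayMap] at h1 h2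
  have h3 := mul_right_cancel₀ hv.ne' (h1.trans h2.symm)
  rw [inv_inj] at h3
  exact (pow_left_inj₀ (le_of_lt hξ) (le_of_lt hη) two_ne_zero).1 h3

theorem rayMeasure_ne_zero (hab : IsCuspidal a b) (h : a * d + b * c = 1) :
    rayMeasure a b c d ≠ 0 := by
  intro h0
  have h1 : rayPiece a b c d ⟨1, 0⟩ Set.univ = 0 := by
    refine le_antisymm ((Measure.le_sum (rayPiece a b c d) ⟨1, 0⟩ Set.univ).trans ?_) (zero_le)
    change rayMeasure a b c d Set.univ ≤ 0
    rw [h0]; simp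
  rw [rayPiece_apply MeasurableSet.univ, Set.preimage_univ, Set.univ_inter, mul_eq_zero] at h1
  have h2 := h1.resolve_left (by simp)
  have hco : IsCoprime (1 : ℤ) ((0 : ℕ) : ℤ) := isCoprime_one_left
  have hG : (1 : ℝ) ≤ latGcd a b c d 1 (0 : ℕ) := by exact_mod_cast latGcd_pos hab h hco
  have hl := cuspLead_pos hab
  set m := min 1 (1 / (2 * cuspLead a b))
  have hm : 0 < m := lt_min one_pos (by positivity)
  -- For k = 1 and residue 0 coprimality is automatic and the gcd is at least 1, so all small ξ
  -- satisfy the height condition.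
  have hsub : Set.Ioo 0 m ⊆ rayRange a b c d ⟨1, 0⟩ := by
    rintro ξ ⟨h1, h2⟩
    refine ⟨⟨one_ne_zero, ?_, hco⟩, h1, ?_⟩
    · simp [Int.natAbs_pos, cuspBound_ne_zero hab]
    · have h3 : ξ ≤ 1 := h2.le.trans (min_le_left _ _)
      have h4 : ξ < 1 / (2 * cuspLead a b) := h2.trans_le (min_le_right _ _)
      have h5 : ξ ^ 5 ≤ ξ := pow_le_of_le_one h1.le h3 (by norm_num)
      rw [lt_div_iff₀ (by positivity)] at h4
      have h6 : cuspLead a b * (|((1 : ℤ) : ℝ)| * ξ) ^ 5 < 1 := by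
        simp only [Int.cast_one, abs_one, one_mul]
        nlinarith
      exact h6.trans_le hG
  have := measure_mono_null hsub h2
  rw [Real.volume_Ioo, ENNReal.ofReal_eq_zero] at this
  linarith

theorem dimH_tangentRay_le (hab : IsCuspidal a b) : dimH (tangentRay a b) ≤ 1 := by
  obtain ⟨h1, h2, h3⟩ := hab.cast
  have hsub : tangentRay a b ⊆ Set.range fun t : ℝ => t • ((a : ℝ), (b : ℝ)) := by
    rintro ⟨x, y⟩ ⟨h, -⟩
    refine ⟨x / a, ?_⟩
    simp only at h
    simp only [Prod.smul_mk, smul_eq_mul, Prod.mk.injEq]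
    constructor
    · field_simp
    · field_simp; linarith
  refine (dimH_mono hsub).trans ?_
  have : ContDiff ℝ 1 fun t : ℝ => t • ((a : ℝ), (b : ℝ)) := by fun_prop
  simpa using this.dimH_range_le

/-- The preimage on the half-line of a set of dimension less than one is negligible. -/
theorem volume_preimage_rayMap (hab : IsCuspidal a b) {A : Set (ℝ × ℝ)} (hA : dimH A < 1) :
    volume (rayMap a b ⁻¹' A ∩ Set.Ioi 0) = 0 := by
  have hv := rayDir_fst_ne hab
  set e := (rayDir a b).1
  -- A left inverse of `rayMap a b` for ξ > 0, continuously differentiable on the convex half-plane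
  -- H; such maps do not raise Hausdorff dimension.
  let g : ℝ × ℝ → ℝ := fun v => (Real.sqrt (-v.1 / e))⁻¹
  let H : Set (ℝ × ℝ) := {v | 0 < -v.1 / e}
  have hconv : Convex ℝ H := by
    intro x hx y hy s t hs ht hst
    change 0 < -(s * x.1 + t * y.1) / e
    have : -(s * x.1 + t * y.1) / e = s * (-x.1 / e) + t * (-y.1 / e) := by ring
    rw [this]
    have hx' : 0 < -x.1 / e := hx
    have hy' : 0 < -y.1 / e := hy
    rcases hs.eq_or_lt with rfl | hs
    · rw [zero_add] at hst; subst hst; simpa using hy'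
    · have := mul_pos hs hx'
      have := mul_nonneg ht hy'.le
      linarith
  have hg : ContDiffOn ℝ 1 g H := by
    intro v hv
    have hv' : 0 < -v.1 / e := hv
    refine ContDiffAt.contDiffWithinAt (ContDiffAt.inv (ContDiffAt.sqrt ?_ hv'.ne') ?_)
    · fun_prop
    · exact (Real.sqrt_pos.2 hv').ne'
  have hsub : rayMap a b ⁻¹' A ∩ Set.Ioi 0 ⊆ g '' (A ∩ H) := by
    rintro ξ ⟨h1, hξ⟩
    have hξ' : 0 < ξ := hξ
    have e1 : -(rayMap a b ξ).1 / e = (ξ ^ 2)⁻¹ := by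
      change -(-(ξ ^ 2)⁻¹ * e) / e = _
      field_simp
    refine ⟨rayMap a b ξ, ⟨h1, ?_⟩, ?_⟩
    · change 0 < -(rayMap a b ξ).1 / e
      rw [e1]; positivity
    · change (Real.sqrt (-(rayMap a b ξ).1 / e))⁻¹ = ξ
      rw [e1, Real.sqrt_inv, Real.sqrt_sq hξ'.le, inv_inv]
  have hdim : dimH (rayMap a b ⁻¹' A ∩ Set.Ioi 0) < 1 :=
    ((dimH_mono hsub).trans ((hg.dimH_image_le hconv Set.inter_subset_right).trans
      (dimH_mono Set.inter_subset_left))).trans_lt hA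
  rw [← hausdorffMeasure_real]
  have := hausdorffMeasure_of_dimH_lt (d := 1) (by simpa using hdim)
  simpa using this

theorem rayMeasure_hasHausdorffDim (hab : IsCuspidal a b) (h : a * d + b * c = 1) :
    HasHausdorffDim (rayMeasure a b c d) 1 := by
  refine ⟨rayMeasure_ne_zero hab h, ⟨tangentRay a b, measurableSet_tangentRay a b,
    rayMeasure_compl_tangentRay hab, dimH_tangentRay_le hab⟩, fun A hA => ?_⟩
  by_contra! hlt
  -- A need not be measurable. Its measurable hull for the δ-dimensional Hausdorff measure, with
  -- dimH A < δ < 1, is still null for that measure, so its dimension is at most δ.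
  obtain ⟨δ, h1, h2⟩ := ENNReal.lt_iff_exists_nnreal_btwn.1 hlt
  have h3 := hausdorffMeasure_of_dimH_lt h1
  have h4 : dimH (toMeasurable (Measure.hausdorffMeasure (δ : ℝ)) A) ≤ δ := by
    refine dimH_le_of_hausdorffMeasure_ne_top ?_
    rw [measure_toMeasurable, h3]
    exact ENNReal.zero_ne_top
  refine hA (measure_mono_null (subset_toMeasurable (Measure.hausdorffMeasure (δ : ℝ)) A) ?_)
  exact rayMeasure_eq_zero (measurableSet_toMeasurable _ _)
    (volume_preimage_rayMap hab (h4.trans_lt h2))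

end Ray

/-! ### Riemann sums -/

theorem integral_floor (h : ℕ → ℝ) (M : ℕ) :
    ∫ x in (0 : ℝ)..M, h ⌊x⌋₊ = ∑ n ∈ Finset.range M, h n := by
  have key : ∀ n : ℕ, Set.EqOn (fun _ => h n) (fun x : ℝ => h ⌊x⌋₊) (Set.Ico (n : ℝ) (n + 1 : ℕ)) := by
    intro n x hx
    have : ⌊x⌋₊ = n := (Nat.floor_eq_iff ((Nat.cast_nonneg n).trans hx.1)).2
      ⟨hx.1, by have := hx.2; push_cast at this; exact this⟩
    simp only [this]
  have hint : ∀ n : ℕ, IntervalIntegrable (fun x : ℝ => h ⌊x⌋₊) volume (n : ℝ) (n + 1 : ℕ) := by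
    intro n
    rw [intervalIntegrable_iff_integrableOn_Ico_of_le (by push_cast; linarith)]
    exact (integrableOn_const measure_Ico_lt_top.ne).congr_fun (key n) measurableSet_Ico
  have := intervalIntegral.sum_integral_adjacent_intervals (a := fun n : ℕ => (n : ℝ)) (n := M)
    fun k _ => hint k
  rw [Nat.cast_zero] at this
  rw [← this]
  refine Finset.sum_congr rfl fun n _ => ?_
  rw [intervalIntegral.integral_of_le (by push_cast; linarith), ← integral_Ico_eq_integral_Ioc,
    ← setIntegral_congr_fun measurableSet_Ico (key n), setIntegral_const]
  simp

/-- Normalized sums become integrals of step functions, so dominated convergence can replace any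
regularity requirement on Riemann sums. -/
theorem integral_Ioi_floor_mul {h : ℕ → ℝ} {M : ℕ} (hM : ∀ n, M ≤ n → h n = 0) {T : ℝ}
    (hT : 0 < T) : ∫ x in Set.Ioi (0 : ℝ), h ⌊T * x⌋₊ = T⁻¹ * ∑ n ∈ Finset.range M, h n := by
  rw [integral_comp_mul_left_Ioi (fun x => h ⌊x⌋₊) 0 hT, mul_zero, smul_eq_mul, ← integral_floor,
    intervalIntegral.integral_of_le (Nat.cast_nonneg M)]
  congr 1
  refine (setIntegral_eq_of_subset_of_forall_sdiff_eq_zero (s := Set.Ioc (0 : ℝ) M)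
    (f := fun x : ℝ => h ⌊x⌋₊) measurableSet_Ioi Set.Ioc_subset_Ioi_self fun x hx => hM _ ?_)
  have h1 : 0 < x := hx.1
  have h2 : (M : ℝ) < x := by
    by_contra! h
    exact hx.2 ⟨h1, h⟩
  exact Nat.le_floor h2.le

theorem sum_range_mul (g : ℕ → ℝ) (N M : ℕ) :
    ∑ l ∈ Finset.range (N * M), g l =
      ∑ r ∈ Finset.range N, ∑ n ∈ Finset.range M, g (r + N * n) := by
  induction M with
  | zero => simp
  | succ M ih =>
    rw [Nat.mul_succ, Finset.sum_range_add, ih, ← Finset.sum_add_distrib]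
    refine Finset.sum_congr rfl fun r _ => ?_
    rw [Finset.sum_range_succ, add_comm (N * M) r]

/-! ### Points of the curve as `l` tends to infinity -/

/-- The position in the tangent plane of the point of the curve with `k = a p - b q`. -/
noncomputable def cuspPos (a b k p q : ℝ) : ℝ × ℝ :=
  (-(k ^ 2 / (p * (a ^ 2 * p + b ^ 2 * q))), -(k ^ 2 / (q * (a ^ 2 * p + b ^ 2 * q))))

/-- For fixed k the position is homogeneous of degree -2 in (p, q), and the sections have degree 5.
Rescaling (p, q) by T thus absorbs both the zoom factor T² and the height bound T^5. -/
theorem smul_cuspPos (T a b k p q : ℝ) :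
    T ^ 2 • cuspPos a b k p q = cuspPos a b k (p / T) (q / T) := by
  have e : a ^ 2 * (p / T) + b ^ 2 * (q / T) = (a ^ 2 * p + b ^ 2 * q) / T := by ring
  simp only [cuspPos, Prod.smul_mk, smul_eq_mul, e]
  rw [div_mul_div_comm, div_mul_div_comm, ← sq, div_div_eq_mul_div, div_div_eq_mul_div]
  refine Prod.ext ?_ ?_ <;> simp only <;> ring

theorem tendsto_cuspPos {ι : Type*} {F : Filter ι} {a b k p₀ q₀ : ℝ} {p q : ι → ℝ}
    (hp : Tendsto p F (𝓝 p₀)) (hq : Tendsto q F (𝓝 q₀)) (hp0 : p₀ ≠ 0) (hq0 : q₀ ≠ 0)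
    (hL0 : a ^ 2 * p₀ + b ^ 2 * q₀ ≠ 0) :
    Tendsto (fun x => cuspPos a b k (p x) (q x)) F (𝓝 (cuspPos a b k p₀ q₀)) := by
  have hL := (hp.const_mul (a ^ 2)).add (hq.const_mul (b ^ 2))
  have h1 : Tendsto (fun x => -(k ^ 2 / (p x * (a ^ 2 * p x + b ^ 2 * q x)))) F
      (𝓝 (-(k ^ 2 / (p₀ * (a ^ 2 * p₀ + b ^ 2 * q₀))))) :=
    (tendsto_const_nhds.div (hp.mul hL) (mul_ne_zero hp0 hL0)).neg
  have h2 : Tendsto (fun x => -(k ^ 2 / (q x * (a ^ 2 * p x + b ^ 2 * q x)))) F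
      (𝓝 (-(k ^ 2 / (q₀ * (a ^ 2 * p₀ + b ^ 2 * q₀))))) :=
    (tendsto_const_nhds.div (hq.mul hL) (mul_ne_zero hq0 hL0)).neg
  exact h1.prodMk_nhds h2

theorem norm_cuspForm_div {T : ℝ} (hT : 0 < T) (a b p q : ℝ) :
    ‖cuspForm a b (p / T) (q / T)‖ = ‖cuspForm a b p q‖ / T ^ 5 := by
  have e : cuspForm a b (p / T) (q / T) = (T ^ 5)⁻¹ • cuspForm a b p q := by
    ext i
    fin_cases i <;> simp [cuspForm] <;> field_simp
  rw [e, norm_smul, norm_inv, Real.norm_of_nonneg (by positivity), inv_mul_eq_div]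

theorem continuous_cuspForm (a b : ℝ) : Continuous fun v : ℝ × ℝ => cuspForm a b v.1 v.2 := by
  refine continuous_pi fun i => ?_
  fin_cases i <;> simp only [cuspForm] <;> dsimp <;> fun_prop

theorem tendsto_norm_cuspForm {ι : Type*} {F : Filter ι} {a b p₀ q₀ : ℝ} {p q : ι → ℝ}
    (hp : Tendsto p F (𝓝 p₀)) (hq : Tendsto q F (𝓝 q₀)) :
    Tendsto (fun x => ‖cuspForm a b (p x) (q x)‖) F (𝓝 ‖cuspForm a b p₀ q₀‖) := by
  obtain ⟨G, hc, hG⟩ : ∃ G : ℝ × ℝ → ℝ, Continuous G ∧ ∀ p q, G (p, q) = ‖cuspForm a b p q‖ :=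
    ⟨_, (continuous_cuspForm a b).norm, fun _ _ => rfl⟩
  simp only [← hG]
  exact (hc.tendsto _).comp (hp.prodMk_nhds hq)

section Limit

variable {a b c d : ℤ}

/-- The parameter [b : a] is the cusp `Q`, where all six sections coincide. -/
theorem norm_cuspForm_limit (a b : ℤ) {t : ℝ} (ht : 0 ≤ t) :
    ‖cuspForm (a : ℝ) b (b * t) (a * t)‖ = cuspLead a b * t ^ 5 := by
  have e : cuspForm (a : ℝ) b (b * t) (a * t) =
      fun _ => ((a : ℝ) ^ 4 * b ^ 4 * (a + b) ^ 3) * t ^ 5 := by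
    ext i
    fin_cases i <;> simp [cuspForm] <;> ring
  rw [e, pi_norm_const, Real.norm_eq_abs, abs_mul, abs_of_nonneg (by positivity : 0 ≤ t ^ 5),
    cuspLead]

theorem toTangent_latPt (h : a * d + b * c = 1) (k l : ℤ) :
    toTangent (latPt a b c d k l) = cuspPos a b k (d * k + b * l) (a * l - c * k) := by
  rw [latPt, cuspPt, toTangent_pt, cuspPos]
  have hk : (a : ℝ) * (d * k + b * l) - b * (a * l - c * k) = k := by exact_mod_cast lat_k h k l
  push_cast
  rw [hk, sub_sub_cancel_left, sub_sub_cancel_left]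

theorem height_latPt_le_iff (hab : IsCuspidal a b) (h : a * d + b * c = 1) {k l : ℤ}
    (hkl : IsLatParam a b c d k l) {T : ℝ} (hT : 0 < T) :
    height (latPt a b c d k l) ≤ T ^ 5 ↔
      ‖cuspForm (a : ℝ) b ((d * k + b * l) / T) ((a * l - c * k) / T)‖ ≤ latGcd a b c d k l := by
  have hG : (0 : ℝ) < latGcd a b c d k l := by exact_mod_cast latGcd_pos hab h hkl.2.1
  have hn := height_cuspPt_mul hkl.2.2
  push_cast at hn
  rw [norm_cuspForm_div hT, ← hn, div_le_iff₀ (by positivity), mul_comm]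
  exact (mul_le_mul_iff_right₀ hG).symm

open Classical in
/-- The contribution of the parameters `k`, `l` to the integral of `f`. -/
noncomputable def latTerm (a b c d : ℤ) (f : ℝ × ℝ → ℝ) (T : ℝ) (k l : ℤ) : ℝ :=
  if IsLatParam a b c d k l ∧ height (latPt a b c d k l) ≤ T ^ 5 then
    f (T ^ 2 • toTangent (latPt a b c d k l)) else 0

theorem rayMap_div (hab : IsCuspidal a b) {k t : ℝ} (hk : k ≠ 0) (ht : t ≠ 0) :
    rayMap a b (t / |k|) = cuspPos a b k (b * t) (a * t) := by
  obtain ⟨ha0, hb0, hab0⟩ := hab.cast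
  have e : (a : ℝ) ^ 2 * (b * t) + b ^ 2 * (a * t) = a * b * (a + b) * t := by ring
  simp only [rayMap, rayDir, cuspPos, Prod.smul_mk, smul_eq_mul, e, div_pow, sq_abs]
  refine Prod.ext ?_ ?_ <;> simp only <;> field_simp

/-- With k fixed and l/T → t, (p, q)/T tends to (bt, at), so the zoomed point tends to the half-line
point with ξ = t/|k|. The height condition tends to `cuspLead a b` · t^5 < g; equality is excluded
because there membership could oscillate. -/
theorem tendsto_latTerm (hab : IsCuspidal a b) (h : a * d + b * c = 1) {f : ℝ × ℝ → ℝ}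
    (hf : Continuous f) {k : ℤ} (hk : k ≠ 0) {l : ℝ → ℤ} {t g : ℝ} (ht : 0 < t)
    (hl : Tendsto (fun T => (l T : ℝ) / T) atTop (𝓝 t)) (hco : ∀ T, IsCoprime k (l T))
    (hg : ∀ T, (latGcd a b c d k (l T) : ℝ) = g) (hne : cuspLead a b * t ^ 5 ≠ g) :
    Tendsto (fun T => latTerm a b c d f T k (l T)) atTop
      (𝓝 (if cuspLead a b * t ^ 5 < g then f (rayMap a b (t / |(k : ℝ)|)) else 0)) := by
  obtain ⟨ha0, hb0, hab0⟩ := hab.cast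
  have hkT : Tendsto (fun T : ℝ => (k : ℝ) / T) atTop (𝓝 0) := tendsto_const_nhds.div_atTop tendsto_id
  have hp : Tendsto (fun T => ((d : ℝ) * k + b * l T) / T) atTop (𝓝 (b * t)) := by
    have := (hkT.const_mul (d : ℝ)).add (hl.const_mul (b : ℝ))
    rw [mul_zero, zero_add] at this
    exact this.congr fun T => by ring
  have hq : Tendsto (fun T => ((a : ℝ) * l T - c * k) / T) atTop (𝓝 (a * t)) := by
    have := (hl.const_mul (a : ℝ)).sub (hkT.const_mul (c : ℝ))
    rw [mul_zero, sub_zero] at this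
    exact this.congr fun T => by ring
  have hL := (hp.const_mul ((a : ℝ) ^ 2)).add (hq.const_mul ((b : ℝ) ^ 2))
  have hL0 : (a : ℝ) ^ 2 * (b * t) + b ^ 2 * (a * t) ≠ 0 := by
    rw [show (a : ℝ) ^ 2 * (b * t) + b ^ 2 * (a * t) = a * b * (a + b) * t by ring]
    simp [ha0, hb0, hab0, ht.ne']
  have hlpos : ∀ᶠ T in atTop, 1 ≤ l T := by
    filter_upwards [hl.eventually_const_lt ht, eventually_gt_atTop 0] with T h1 h2
    have : (0 : ℝ) < l T := by
      by_contra! h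
      exact absurd h1 (not_lt.2 (div_nonpos_of_nonpos_of_nonneg h h2.le))
    exact_mod_cast this
  have hpar : ∀ᶠ T in atTop, IsLatParam a b c d k (l T) := by
    filter_upwards [hlpos, hp.eventually_ne (mul_ne_zero hb0 ht.ne'),
      hq.eventually_ne (mul_ne_zero ha0 ht.ne'), hL.eventually_ne hL0] with T h1 h2 h3 h4
    refine ⟨h1, hco T, ?_, ?_, ?_, by rwa [lat_k h]⟩
    · intro h0
      apply h2
      have : (d : ℝ) * k + b * l T = 0 := by exact_mod_cast h0
      rw [this, zero_div]
    · intro h0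
      apply h3
      have : (a : ℝ) * l T - c * k = 0 := by exact_mod_cast h0
      rw [this, zero_div]
    · intro h0
      apply h4
      have : (a : ℝ) ^ 2 * (d * k + b * l T) + b ^ 2 * (a * l T - c * k) = 0 := by exact_mod_cast h0
      rw [← mul_div_assoc, ← mul_div_assoc, ← add_div, this, zero_div]
  have hnorm : Tendsto (fun T => ‖cuspForm (a : ℝ) b ((d * k + b * l T) / T)
      ((a * l T - c * k) / T)‖) atTop (𝓝 (cuspLead a b * t ^ 5)) := by
    rw [← norm_cuspForm_limit a b ht.le]
    exact tendsto_norm_cuspForm hp hq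
  split_ifs with hlt
  · have hpos : Tendsto (fun T => cuspPos a b k ((d * k + b * l T) / T) ((a * l T - c * k) / T))
        atTop (𝓝 (rayMap a b (t / |(k : ℝ)|))) := by
      have hk0 : (k : ℝ) ≠ 0 := by exact_mod_cast hk
      rw [rayMap_div hab hk0 ht.ne']
      exact tendsto_cuspPos hp hq (mul_ne_zero hb0 ht.ne') (mul_ne_zero ha0 ht.ne') hL0
    refine ((hf.tendsto _).comp hpos).congr' ?_
    filter_upwards [hpar, hnorm.eventually_lt_const hlt, eventually_gt_atTop 0] with T h1 h2 h3
    rw [latTerm, if_pos ⟨h1, (height_latPt_le_iff hab h h1 h3).2 (by rw [hg]; exact h2.le)⟩,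
      toTangent_latPt h, smul_cuspPos]
    rfl
  · refine tendsto_const_nhds.congr' ?_
    have hgt : g < cuspLead a b * t ^ 5 := lt_of_le_of_ne (not_lt.1 hlt) (Ne.symm hne)
    filter_upwards [hpar, hnorm.eventually_const_lt hgt, eventually_gt_atTop 0] with T h1 h2 h3
    rw [latTerm, if_neg]
    rintro ⟨-, h4⟩
    rw [height_latPt_le_iff hab h h1 h3, hg] at h4
    linarith

end Limit

section Limit

variable {a b c d : ℤ}

theorem latTerm_ne_zero {f : ℝ × ℝ → ℝ} {T : ℝ} {k l : ℤ} (h : latTerm a b c d f T k l ≠ 0) :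
    IsLatParam a b c d k l ∧ height (latPt a b c d k l) ≤ T ^ 5 ∧
      f (T ^ 2 • toTangent (latPt a b c d k l)) ≠ 0 := by
  rw [latTerm] at h
  split_ifs at h with h1
  · exact ⟨h1.1, h1.2, h⟩
  · exact absurd rfl h

theorem abs_latTerm_le {f : ℝ × ℝ → ℝ} {C : ℝ} (hC : ∀ v, |f v| ≤ C) (T : ℝ) (k l : ℤ) :
    |latTerm a b c d f T k l| ≤ C := by
  rw [latTerm]
  split_ifs
  · exact hC _
  · rw [abs_zero]; exact (abs_nonneg _).trans (hC 0)

theorem integral_rayPiece (hab : IsCuspidal a b) {f : ℝ × ℝ → ℝ} (hf : Continuous f)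
    (i : Σ _ : ℤ, ℕ) : ∫ v, f v ∂(rayPiece a b c d i) =
      ∫ x in Set.Ioi (0 : ℝ), (rayRange a b c d i).indicator (fun ξ => f (rayMap a b ξ))
        (((cuspBound a b).natAbs : ℝ) * x) := by
  have hR : (0 : ℝ) < (cuspBound a b).natAbs := by
    exact_mod_cast Int.natAbs_pos.2 (cuspBound_ne_zero hab)
  have hsub : rayRange a b c d i ⊆ Set.Ioi 0 := fun ξ hξ => hξ.2.1
  rw [rayPiece, integral_smul_measure, integral_map (measurable_rayMap a b).aemeasurable
    hf.aestronglyMeasurable, integral_comp_mul_left_Ioi _ 0 hR, mul_zero,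
    setIntegral_indicator (measurableSet_rayRange a b c d i),
    Set.inter_eq_right.2 hsub]
  simp

open Classical in
-- Along a residue class l = r + Nn, with N = |`cuspBound a b`|·|k|, the normalized sum is the
-- integral over x > 0 of the term with n = ⌊Tx⌋. Its integrand converges almost everywhere, with ξ
-- = |`cuspBound a b`|·x, and is bounded by C with support in x ≤ D + 1.
theorem tendsto_sum_latTerm (hab : IsCuspidal a b) (h : a * d + b * c = 1) {f : ℝ × ℝ → ℝ}
    (hf : Continuous f) {C : ℝ} (hC : ∀ v, |f v| ≤ C) {D : ℕ}
    (hD : ∀ᶠ T : ℝ in atTop, ∀ k l : ℤ, latTerm a b c d f T k l ≠ 0 → (l : ℝ) ≤ D * T)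
    {k : ℤ} (hk : k ≠ 0) {r : ℕ} (hr : r < (cuspBound a b).natAbs * k.natAbs) :
    Tendsto (fun T : ℝ => T⁻¹ * ∑ n ∈ Finset.range (⌊D * T⌋₊ + 1),
        latTerm a b c d f T k (r + (cuspBound a b).natAbs * k.natAbs * n : ℕ)) atTop
      (𝓝 (∫ v, f v ∂(rayPiece a b c d ⟨k, r⟩))) := by
  have hR0 : (0 : ℝ) < (cuspBound a b).natAbs := by
    exact_mod_cast Int.natAbs_pos.2 (cuspBound_ne_zero hab)
  obtain ⟨N, hN⟩ : ∃ N : ℕ, (cuspBound a b).natAbs * k.natAbs = N := ⟨_, rfl⟩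
  have hkabs : (0 : ℝ) < |(k : ℝ)| := abs_pos.2 (by exact_mod_cast hk)
  have hNR : (N : ℝ) = (cuspBound a b).natAbs * |(k : ℝ)| := by
    rw [← hN]; push_cast; rw [Nat.cast_natAbs, Nat.cast_natAbs, Int.cast_abs, Int.cast_abs]
  have hN0 : (0 : ℝ) < N := by rw [hNR]; positivity
  have hN1 : 1 ≤ N := by exact_mod_cast hN0
  rw [integral_rayPiece hab hf]
  have hzero : ∀ᶠ T : ℝ in atTop, ∀ n : ℕ, ⌊D * T⌋₊ + 1 ≤ n →
      latTerm a b c d f T k (r + N * n : ℕ) = 0 := by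
    filter_upwards [hD] with T hT n hn
    by_contra hne
    have h1 := hT k _ hne
    have h2 : n ≤ r + N * n := (Nat.le_mul_of_pos_left n hN1).trans (Nat.le_add_left _ _)
    have h3 : (n : ℝ) ≤ D * T := by
      refine le_trans ?_ h1
      exact_mod_cast h2
    have := Nat.le_floor h3
    omega
  have hint : Tendsto (fun T : ℝ => ∫ x in Set.Ioi (0 : ℝ),
      latTerm a b c d f T k (r + N * ⌊T * x⌋₊ : ℕ)) atTop
      (𝓝 (∫ x in Set.Ioi (0 : ℝ), (rayRange a b c d ⟨k, r⟩).indicator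
        (fun ξ => f (rayMap a b ξ)) (((cuspBound a b).natAbs : ℝ) * x))) := by
    refine tendsto_integral_filter_of_dominated_convergence
      ((Set.Iic ((D : ℝ) + 1)).indicator fun _ => C) ?_ ?_ ?_ ?_
    · refine Eventually.of_forall fun T => Measurable.aestronglyMeasurable ?_
      exact (measurable_from_nat (f := fun n => latTerm a b c d f T k (r + N * n : ℕ))).comp
        (Nat.measurable_floor.comp (measurable_const_mul T))
    · filter_upwards [hzero, eventually_ge_atTop 1] with T hT hT1
      refine (ae_restrict_iff' measurableSet_Ioi).2 (Eventually.of_forall fun x hx => ?_)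
      by_cases hxD : x ≤ D + 1
      · rw [Set.indicator_of_mem (show x ∈ Set.Iic ((D : ℝ) + 1) from hxD), Real.norm_eq_abs]
        exact abs_latTerm_le hC _ _ _
      · rw [Set.indicator_of_notMem (show x ∉ Set.Iic ((D : ℝ) + 1) from hxD), hT, norm_zero]
        refine Nat.le_floor ?_
        push_cast
        have h1 : (⌊D * T⌋₊ : ℝ) ≤ D * T := Nat.floor_le (by positivity)
        have h2 : (D : ℝ) + 1 < x := not_le.1 hxD
        nlinarith
    · rw [integrable_indicator_iff measurableSet_Iic, IntegrableOn,
        Measure.restrict_restrict measurableSet_Iic]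
      refine (integrableOn_const (s := Set.Ioc (0 : ℝ) (D + 1)) measure_Ioc_lt_top.ne).mono_set ?_
      exact fun x hx => ⟨hx.2, hx.1⟩
    · have hbad : volume {x : ℝ | 0 < x ∧
          cuspLead a b * (N * x) ^ 5 = latGcd a b c d k r} = 0 := by
        refine Set.Subsingleton.measure_zero ?_ _
        rintro x ⟨hx, hx'⟩ y ⟨hy, hy'⟩
        have h1 := mul_left_cancel₀ (cuspLead_pos hab).ne' (hx'.trans hy'.symm)
        have h2 := (pow_left_inj₀ (by positivity) (by positivity) (by norm_num)).1 h1
        exact mul_left_cancel₀ hN0.ne' h2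
      refine (ae_restrict_iff' measurableSet_Ioi).2 ?_
      filter_upwards [measure_eq_zero_iff_ae_notMem.1 hbad] with x hx hx0
      have hx0' : 0 < x := hx0
      -- The step N is a multiple of k, so coprimality of k and l is constant on the class; it is
      -- also a multiple of `cuspBound a b`, so the gcd of the sections is constant.
      have hcong : ∀ n : ℕ, ((r + N * n : ℕ) : ℤ) =
          (r : ℤ) + k * (k.sign * (cuspBound a b).natAbs * n) := by
        intro n
        rw [← hN]
        push_cast [Int.natCast_natAbs]
        rw [← Int.sign_mul_self_eq_abs k]
        ring
      by_cases hco : IsCoprime k (r : ℤ)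
      · have hco' : ∀ n : ℕ, IsCoprime k ((r + N * n : ℕ) : ℤ) := fun n => by
          rw [hcong]; exact hco.add_mul_left_right _
        have hgcd : ∀ n : ℕ, latGcd a b c d k ((r + N * n : ℕ) : ℤ) = latGcd a b c d k r := by
          intro n
          refine latGcd_eq_of_modEq h (hco' n) hco ?_
          refine (Int.modEq_iff_dvd.2 ?_).symm
          refine Int.natAbs_dvd.1 ?_
          rw [← hN]
          push_cast
          exact ⟨k.natAbs * n, by push_cast; ring⟩
        have hl : Tendsto (fun T : ℝ => (((r + N * ⌊T * x⌋₊ : ℕ) : ℤ) : ℝ) / T) atTop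
            (𝓝 (N * x)) := by
          have h1 : Tendsto (fun T : ℝ => (r : ℝ) / T) atTop (𝓝 0) :=
            tendsto_const_nhds.div_atTop tendsto_id
          have h2 := (tendsto_nat_floor_mul_div_atTop (R := ℝ) hx0'.le).const_mul (N : ℝ)
          have h3 := h1.add h2
          rw [zero_add] at h3
          refine h3.congr fun T => ?_
          push_cast
          rw [mul_comm x T]
          ring
        have := tendsto_latTerm hab h hf hk (mul_pos hN0 hx0') hl (fun T => hco' _)
          (g := latGcd a b c d k r) (fun T => by rw [hgcd]) (fun he => hx ⟨hx0', he⟩)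
        convert this using 2
        have e : (N : ℝ) * x = |(k : ℝ)| * ((cuspBound a b).natAbs * x) := by rw [hNR]; ring
        rw [Set.indicator_apply, e, mul_div_cancel_left₀ _ hkabs.ne']
        refine if_congr ⟨fun hm => hm.2.2, fun hm => ⟨⟨hk, hr, hco⟩, by positivity, hm⟩⟩ rfl rfl
      · rw [Set.indicator_of_notMem (fun hm => hco hm.1.2.2)]
        refine tendsto_const_nhds.congr fun T => ?_
        by_contra hne
        have h1 := (latTerm_ne_zero (Ne.symm hne)).1.2.1
        rw [hcong, IsCoprime.add_mul_left_right_iff] at h1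
        exact hco h1
  refine hint.congr' ?_
  filter_upwards [hzero, eventually_gt_atTop 0] with T h1 h2
  rw [hN]
  exact integral_Ioi_floor_mul (h := fun n => latTerm a b c d f T k (r + N * n : ℕ)) h1 h2

/-- The integral of `f` for the zoom measure of a cuspidal curve, as a sum over `k` and `l`. -/
theorem integral_zoom_cuspCurve (hab : IsCuspidal a b) (h : a * d + b * c = 1)
    {f : ℝ × ℝ → ℝ} (hf : Continuous f) {ρ : ℝ} (hρ : ∀ v, f v ≠ 0 → ‖v‖ ≤ ρ) :
    ∃ K D : ℕ, (∀ᶠ T : ℝ in atTop, ∀ k l : ℤ, latTerm a b c d f T k l ≠ 0 → (l : ℝ) ≤ D * T) ∧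
      ∀ K' : ℕ, K ≤ K' → ∀ᶠ B : ℝ in atTop,
        ∫ v, f v ∂(zoom (cuspCurve a b) B (5 / 2)) = f 0 +
          ∑ k ∈ Finset.Icc (-(K' : ℤ)) K',
            ∑ l ∈ Finset.range ((cuspBound a b).natAbs * k.natAbs * (⌊D * B ^ (1 / 5 : ℝ)⌋₊ + 1)),
              latTerm a b c d f (B ^ (1 / 5 : ℝ)) k (l : ℕ) := by
  classical
  obtain ⟨K, D, hKD⟩ := lat_bounds hab h ρ
  have hnorm : ∀ (T : ℝ) (P : Y3), f (T ^ 2 • toTangent P) ≠ 0 → T ^ 2 * ‖toTangent P‖ ≤ ρ := by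
    intro T P hP
    have := hρ _ hP
    rwa [norm_smul, Real.norm_of_nonneg (sq_nonneg T)] at this
  refine ⟨K, D, ?_, fun K' hK' => ?_⟩
  · filter_upwards [hKD] with T hT k l hne
    obtain ⟨h1, h2, h3⟩ := latTerm_ne_zero hne
    exact (hT k l (by linarith [h1.1]) h1.2.1 h1.2.2 h2 (hnorm T _ h3)).2.1
  filter_upwards [tendsto_rpow_one_fifth.eventually hKD, eventually_ge_atTop 0,
    eventually_ge_atTop (height Q)] with B hB hB0 hBQ
  obtain ⟨T, hT⟩ : ∃ T : ℝ, B ^ (1 / 5 : ℝ) = T := ⟨_, rfl⟩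
  have hT5 : T ^ 5 = B := by rw [← hT]; exact rpow_one_fifth_pow hB0
  have hT2 : B ^ (1 / (5 / 2) : ℝ) = T ^ 2 := by rw [← hT]; exact rpow_two_fifths hB0
  have hTn : 0 ≤ T := hT ▸ Real.rpow_nonneg hB0 _
  rw [hT] at hB ⊢
  -- The range for l is longer than necessary, but its length is a multiple of the period, so it
  -- later splits evenly into residue classes.
  set S : Finset (Σ _ : ℤ, ℕ) := (Finset.Icc (-(K' : ℤ)) K').sigma fun k =>
    Finset.range ((cuspBound a b).natAbs * k.natAbs * (⌊D * T⌋₊ + 1)) with hS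
  set A : Finset (Σ _ : ℤ, ℕ) := S.filter fun i => IsLatParam a b c d i.1 (i.2 : ℕ) ∧
    height (latPt a b c d i.1 (i.2 : ℕ)) ≤ T ^ 5 with hA
  set pts : Finset Y3 := A.image fun i => latPt a b c d i.1 (i.2 : ℕ) with hpts
  have hQ : Q ∉ pts := by
    intro hmem
    obtain ⟨i, hi, he⟩ := Finset.mem_image.1 hmem
    exact cuspPt_ne_Q (Finset.mem_filter.1 hi).2.1.2.2 he
  have hinj : Set.InjOn (fun i : Σ _ : ℤ, ℕ => latPt a b c d i.1 (i.2 : ℕ)) A := by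
    rintro ⟨k, l⟩ hi ⟨k', l'⟩ hj he
    obtain ⟨h1, h2⟩ := latPt_inj h (Finset.mem_filter.1 hi).2.1 (Finset.mem_filter.1 hj).2.1 he
    simp only at h1 h2
    obtain rfl := h1
    obtain rfl : l = l' := by exact_mod_cast h2
    rfl
  -- The cusp itself is a rational point of the curve without parameters (k, l); it accounts for the
  -- term f 0, which disappears after division by T.
  rw [integral_zoom hf (insert Q pts), Finset.sum_insert hQ]
  · congr 1
    · rw [Q_eq_pt, toTangent_pt]
      congr 1
      simp
    · rw [hpts, Finset.sum_image hinj, hA, Finset.sum_filter, hS, Finset.sum_sigma]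
      refine Finset.sum_congr rfl fun k _ => Finset.sum_congr rfl fun l _ => ?_
      rw [hT2]
      rfl
  · intro P hP
    rcases Finset.mem_insert.1 hP with rfl | hP
    · refine ⟨?_, ?_, hBQ⟩
      · rw [Q_eq_pt, pt_mem_cuspCurve]; ring
      · rw [Q_eq_pt]; exact pt_mem_chart _ _
    · obtain ⟨i, hi, rfl⟩ := Finset.mem_image.1 hP
      obtain ⟨-, h1, h2⟩ := Finset.mem_filter.1 hi
      exact ⟨cuspPt_mem h1.2.2, pt_mem_chart _ _, hT5 ▸ h2⟩
  · intro P hP hPC hPc hPH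
    by_contra hne
    rw [hT2] at hne
    have hPQ : P ≠ Q := fun h => hP (by rw [h]; exact Finset.mem_insert_self _ _)
    obtain ⟨k, l, hl, hkl, hreg, rfl⟩ := exists_latPt h hab hPC hPc hPQ
    obtain ⟨h1, h2, h3⟩ := hB k l hl hkl hreg (hT5 ▸ hPH) (hnorm T _ hne)
    refine hP (Finset.mem_insert_of_mem (Finset.mem_image.2 ⟨⟨k, l.toNat⟩, ?_, ?_⟩))
    · have hk : k ≠ 0 := IsLatParam.ne_zero h ⟨h1, hkl, hreg⟩
      rw [hA, Finset.mem_filter]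
      simp only [Int.toNat_of_nonneg hl]
      refine ⟨Finset.mem_sigma.2 ⟨?_, ?_⟩, ⟨h1, hkl, hreg⟩, hT5 ▸ hPH⟩
      · rw [Finset.mem_Icc]
        have := abs_le.1 h3
        constructor <;> simp only <;> omega
      · rw [Finset.mem_range]
        have h4 : l.toNat < ⌊D * T⌋₊ + 1 := by
          refine Nat.lt_succ_of_le (Nat.le_floor ?_)
          have : ((l.toNat : ℤ) : ℝ) = l := by rw [Int.toNat_of_nonneg hl]
          rw [← Int.cast_natCast, this]
          exact h2
        refine h4.trans_le (Nat.le_mul_of_pos_left _ ?_)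
        exact Nat.mul_pos (Int.natAbs_pos.2 (cuspBound_ne_zero hab)) (Int.natAbs_pos.2 hk)
    · simp only [Int.toNat_of_nonneg hl]

theorem integral_rayMeasure (hab : IsCuspidal a b) (h : a * d + b * c = 1)
    {f : ℝ × ℝ → ℝ} (hf : Continuous f) {C : ℝ} (hC : ∀ v, |f v| ≤ C) {ρ : ℝ}
    (hρ : ∀ v, f v ≠ 0 → ‖v‖ ≤ ρ) : ∃ K : ℕ, ∀ K' : ℕ, K ≤ K' →
      ∫ v, f v ∂(rayMeasure a b c d) = ∑ k ∈ Finset.Icc (-(K' : ℤ)) K',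
        ∑ r ∈ Finset.range ((cuspBound a b).natAbs * k.natAbs),
          ∫ v, f v ∂(rayPiece a b c d ⟨k, r⟩) := by
  obtain ⟨K, hK⟩ := rayRange_bound (c := c) (d := d) hab h ρ
  refine ⟨K, fun K' hK' => ?_⟩
  rw [rayMeasure, integral_sum_eq_sum hf.stronglyMeasurable
    ((Finset.Icc (-(K' : ℤ)) K').sigma fun k => Finset.range ((cuspBound a b).natAbs * k.natAbs)),
    Finset.sum_sigma]
  · intro i _
    have := isFiniteMeasure_rayPiece (c := c) (d := d) hab i
    exact Integrable.of_bound hf.aestronglyMeasurable C (Eventually.of_forall hC)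
  · intro i hi
    have hmeas : MeasurableSet {v | f v = (0 : ℝ × ℝ → ℝ) v} :=
      hf.measurable (measurableSet_singleton 0)
    refine Measure.ae_smul_measure ?_ _
    change ∀ᵐ v ∂_, f v = (0 : ℝ × ℝ → ℝ) v
    rw [ae_map_iff (measurable_rayMap a b).aemeasurable hmeas,
      ae_restrict_iff' (measurableSet_rayRange a b c d i)]
    refine Eventually.of_forall fun ξ hξ => ?_
    by_contra hne
    exact hi (hK K' hK' i ξ hξ (hρ _ hne))

/-- The zoom measures of a cuspidal curve converge vaguely. -/
theorem tendsto_zoom_cuspCurve (hab : IsCuspidal a b) (h : a * d + b * c = 1)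
    {f : ℝ × ℝ → ℝ} (hf : Continuous f) (hfc : HasCompactSupport f) :
    Tendsto (fun B : ℝ => (B ^ (1 / 5 : ℝ))⁻¹ * ∫ v, f v ∂(zoom (cuspCurve a b) B (5 / 2)))
      atTop (𝓝 (∫ v, f v ∂(rayMeasure a b c d))) := by
  obtain ⟨C, hC⟩ := hf.bounded_above_of_compact_support hfc
  obtain ⟨ρ, hρ⟩ := (hfc.isCompact.isBounded).subset_closedBall 0
  have hρ' : ∀ v, f v ≠ 0 → ‖v‖ ≤ ρ := fun v hv =>
    mem_closedBall_zero_iff.1 (hρ (subset_tsupport f hv))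
  obtain ⟨K₁, hK₁⟩ := integral_rayMeasure (c := c) (d := d) hab h hf hC hρ'
  obtain ⟨K₂, D, hD, hK₂⟩ := integral_zoom_cuspCurve hab h hf hρ'
  rw [hK₁ (max K₁ K₂) (le_max_left _ _)]
  have hmain : Tendsto (fun T : ℝ => T⁻¹ * f 0 + ∑ k ∈ Finset.Icc (-((max K₁ K₂ : ℕ) : ℤ))
      (max K₁ K₂ : ℕ), ∑ r ∈ Finset.range ((cuspBound a b).natAbs * k.natAbs),
        T⁻¹ * ∑ n ∈ Finset.range (⌊D * T⌋₊ + 1),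
          latTerm a b c d f T k (r + (cuspBound a b).natAbs * k.natAbs * n : ℕ)) atTop
      (𝓝 (0 * f 0 + ∑ k ∈ Finset.Icc (-((max K₁ K₂ : ℕ) : ℤ)) (max K₁ K₂ : ℕ),
        ∑ r ∈ Finset.range ((cuspBound a b).natAbs * k.natAbs),
          ∫ v, f v ∂(rayPiece a b c d ⟨k, r⟩))) := by
    refine (tendsto_inv_atTop_zero.mul_const _).add ?_
    refine tendsto_finsetSum _ fun k _ => tendsto_finsetSum _ fun r hr => ?_
    rw [Finset.mem_range] at hr
    have hk : k ≠ 0 := by rintro rfl; simp at hr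
    exact tendsto_sum_latTerm hab h hf hC hD hk hr
  rw [zero_mul, zero_add] at hmain
  refine (hmain.comp tendsto_rpow_one_fifth).congr' ?_
  filter_upwards [hK₂ (max K₁ K₂) (le_max_right _ _)] with B hB
  rw [hB, mul_add, Finset.mul_sum]
  simp only [Function.comp]
  congr 1
  refine Finset.sum_congr rfl fun k _ => ?_
  rw [sum_range_mul (fun l => latTerm a b c d f (B ^ (1 / 5 : ℝ)) k (l : ℕ)), Finset.mul_sum]

end Limit

/-! ### Comparison of `M` with a single cuspidal curve -/

theorem encard_zoomSet_cuspCurve_le {a b : ℤ} (hab : IsCuspidal a b) (T ε : ℝ) :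
    ((zoomSet (cuspCurve a b) T ε).encard : ℝ≥0∞) ≤ (zoomSet M T ε).encard + 1 := by
  have hsub : zoomSet (cuspCurve a b) T ε ⊆ insert Q (zoomSet M T ε) := by
    rintro P ⟨h1, h2⟩
    by_cases hQ : P = Q
    · exact Or.inl hQ
    · exact Or.inr ⟨⟨hQ, a, b, hab, h1⟩, h2⟩
  have := (Set.encard_le_encard hsub).trans (Set.encard_insert_le _ _)
  exact_mod_cast this

theorem ofReal_integral_le_measure {ν : Measure (ℝ × ℝ)} {f : ℝ × ℝ → ℝ} (hf : Continuous f)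
    {A : Set (ℝ × ℝ)} (hA : MeasurableSet A) (h0 : ∀ v, 0 ≤ f v) (h1 : ∀ v, f v ≤ 1)
    (hfA : ∀ v ∉ A, f v = 0) : ENNReal.ofReal (∫ v, f v ∂ν) ≤ ν A := by
  rw [integral_eq_lintegral_of_nonneg_ae (Eventually.of_forall h0) hf.aestronglyMeasurable]
  refine ENNReal.ofReal_toReal_le.trans ?_
  rw [← lintegral_indicator_one hA]
  refine lintegral_mono fun v => ?_
  by_cases hv : v ∈ A
  · rw [Set.indicator_of_mem hv]
    exact ENNReal.ofReal_le_one.2 (h1 v)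
  · rw [hfA v hv]; simp

/-- Vague convergence of the zoom measures of a cuspidal curve bounds `M` from below. -/
theorem le_zoom_M {a b : ℤ} (hab : IsCuspidal a b) {μ : Measure (ℝ × ℝ)}
    [IsFiniteMeasureOnCompacts μ]
    (hμ : ∀ f : ℝ × ℝ → ℝ, Continuous f → HasCompactSupport f → Tendsto
      (fun B : ℝ => (B ^ (1 / 5 : ℝ))⁻¹ * ∫ v, f v ∂(zoom (cuspCurve a b) B (5 / 2)))
      atTop (𝓝 (∫ v, f v ∂μ)))
    {ε : ℝ} (hs : μ (Metric.sphere 0 ε) = 0) : ∀ᶠ B : ℝ in atTop,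
      ENNReal.ofReal (1 / 2 * B ^ (1 / 5 : ℝ)) * μ (Metric.closedBall 0 ε) ≤
        zoom M B (5 / 2) (Metric.closedBall 0 ε) := by
  have hfin : μ (Metric.closedBall 0 ε) ≠ ∞ := (isCompact_closedBall _ _).measure_lt_top.ne
  have hball : μ (Metric.ball 0 ε) = μ (Metric.closedBall 0 ε) := by
    refine le_antisymm (measure_mono Metric.ball_subset_closedBall) ?_
    rw [← Metric.ball_union_sphere]
    refine (measure_union_le _ _).trans ?_
    rw [hs, add_zero]
  obtain ⟨m, hm⟩ : ∃ m : ℝ, (μ (Metric.closedBall 0 ε)).toReal = m := ⟨_, rfl⟩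
  have hm' : μ (Metric.closedBall 0 ε) = ENNReal.ofReal m := by
    rw [← hm, ENNReal.ofReal_toReal hfin]
  rcases (hm ▸ ENNReal.toReal_nonneg : 0 ≤ m).eq_or_lt with rfl | hm0
  · rw [hm']
    exact Eventually.of_forall fun B => by simp
  have hlt : ENNReal.ofReal (3 / 4 * m) < μ (Metric.ball 0 ε) := by
    rw [hball, hm']
    exact (ENNReal.ofReal_lt_ofReal_iff hm0).2 (by linarith)
  -- Inner regularity: a test function equal to 1 on K and vanishing off the ball has integral above
  -- three quarters of the mass of the ball.
  obtain ⟨K, hKsub, hK, hKlt⟩ := Metric.isOpen_ball.exists_lt_isCompact hlt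
  obtain ⟨f, hf1, hf0, hfc, hf01⟩ := exists_continuous_one_zero_of_isCompact hK
    Metric.isOpen_ball.isClosed_compl (Set.disjoint_compl_right_iff_subset.2 hKsub)
  have hI : 3 / 4 * m < ∫ v, f v ∂μ := by
    have h1 : μ.real K ≤ ∫ v, f v ∂μ := by
      rw [← integral_indicator_one hK.measurableSet]
      refine integral_mono ?_ (f.continuous.integrable_of_hasCompactSupport hfc) fun v => ?_
      · exact (integrable_indicator_iff hK.measurableSet).2
          (integrableOn_const hK.measure_lt_top.ne)
      · by_cases hv : v ∈ K
        · rw [Set.indicator_of_mem hv, hf1 hv]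
        · rw [Set.indicator_of_notMem hv]; exact (hf01 v).1
    refine lt_of_lt_of_le ?_ h1
    rw [Measure.real]
    exact (ENNReal.ofReal_lt_iff_lt_toReal (by positivity) hK.measure_lt_top.ne).1 hKlt
  -- For T ≥ 4/m the margin between 3/4 and 1/2 of mT is at least 1, which pays for the point `Q`,
  -- on the curve but not in `M`.
  filter_upwards [(hμ f f.continuous hfc).eventually_const_lt hI,
    tendsto_rpow_one_fifth.eventually_ge_atTop (max 1 (4 / m)), eventually_ge_atTop 0] with B h1 h2 h3
  have hT1 := (le_max_left _ _).trans h2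
  have hT2 := (le_max_right _ _).trans h2
  have hle := ofReal_integral_le_measure (ν := zoom (cuspCurve a b) B (5 / 2)) f.continuous
    (A := Metric.closedBall 0 ε) measurableSet_closedBall (fun v => (hf01 v).1)
    (fun v => (hf01 v).2) (fun v hv => hf0 fun hv' => hv (Metric.ball_subset_closedBall hv'))
  have hC := hle.trans (le_of_eq (zoom_closedBall _ h3 _))
  rw [zoom_closedBall _ h3, hm']
  obtain ⟨T, hT⟩ : ∃ T : ℝ, B ^ (1 / 5 : ℝ) = T := ⟨_, rfl⟩
  rw [hT] at hC h1 hT1 hT2 ⊢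
  rw [lt_inv_mul_iff₀ (by linarith)] at h1
  rw [div_le_iff₀ hm0] at hT2
  rw [← ENNReal.ofReal_mul (by linarith)]
  refine (ENNReal.add_le_add_iff_right ENNReal.one_ne_top).1 (le_trans ?_
    (hC.trans (encard_zoomSet_cuspCurve_le hab T ε)))
  rw [← ENNReal.ofReal_one, ← ENNReal.ofReal_add (by nlinarith) zero_le_one]
  exact ENNReal.ofReal_le_ofReal (by nlinarith)

/-- The limit measure of a cuspidal curve. -/
theorem exists_limit_measure {a b : ℤ} (hab : IsCuspidal a b) :
    ∃ μ : Measure (ℝ × ℝ), IsFiniteMeasureOnCompacts μ ∧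
      (∀ f : ℝ × ℝ → ℝ, Continuous f → HasCompactSupport f →
        Tendsto (fun B : ℝ => (B ^ (1 / 5 : ℝ))⁻¹ * ∫ v, f v ∂(zoom (cuspCurve a b) B (5 / 2)))
          atTop (𝓝 (∫ v, f v ∂μ))) ∧
      HasHausdorffDim μ 1 ∧ μ (tangentRay a b)ᶜ = 0 ∧
      ∀ ε : ℝ, 0 < ε → ∀ᶠ B : ℝ in atTop,
        ENNReal.ofReal (1 / 2 * B ^ (1 / 5 : ℝ)) * μ (Metric.closedBall 0 ε) ≤
          zoom M B (5 / 2) (Metric.closedBall 0 ε) := by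
  obtain ⟨d, c, hdc⟩ := hab.1
  have h : a * d + b * c = 1 := by linarith
  have := isFiniteMeasureOnCompacts_rayMeasure hab h
  exact ⟨rayMeasure a b c d, this, fun f => tendsto_zoom_cuspCurve hab h,
    rayMeasure_hasHausdorffDim hab h, rayMeasure_compl_tangentRay hab,
    fun ε _ => le_zoom_M hab (fun f => tendsto_zoom_cuspCurve hab h) (rayMeasure_sphere hab ε)⟩

end ToricY3

theorem mainTheorem3 :
    -- description of `M` by a square condition
    (∀ P ∈ ToricY3.chart, ToricY3.wCoord P * ToricY3.zCoord P ≠ 0 →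
      (1 + ToricY3.wCoord P) * (1 + ToricY3.zCoord P) ≠ 0 →
      (P ∈ ToricY3.M ↔ ∃ q : ℚ, q ≠ 0 ∧
        -ToricY3.wCoord P - ToricY3.zCoord P - ToricY3.wCoord P * ToricY3.zCoord P = q ^ 2)) ∧
    -- lower bound by the limit measure of every cuspidal curve
    (∃ c : ℝ, 0 < c ∧ ∀ a b : ℤ, ToricY3.IsCuspidal a b →
      ∃ μ : Measure (ℝ × ℝ), IsFiniteMeasureOnCompacts μ ∧
        (∀ f : ℝ × ℝ → ℝ, Continuous f → HasCompactSupport f →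
          Tendsto
            (fun B : ℝ => (B ^ (1 / 5 : ℝ))⁻¹ *
              ∫ v, f v ∂(ToricY3.zoom (ToricY3.cuspCurve a b) B (5 / 2)))
            atTop (𝓝 (∫ v, f v ∂μ))) ∧
        ToricY3.HasHausdorffDim μ 1 ∧ μ (ToricY3.tangentRay a b)ᶜ = 0 ∧
        ∀ ε : ℝ, 0 < ε → ∀ᶠ B : ℝ in atTop,
          ENNReal.ofReal (c * B ^ (1 / 5 : ℝ)) * μ (Metric.closedBall 0 ε) ≤
            ToricY3.zoom ToricY3.M B (5 / 2) (Metric.closedBall 0 ε)) ∧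
    -- the exact order of magnitude
    (∃ ε₀ : ℝ, 0 < ε₀ ∧ ∀ ε : ℝ, ε₀ ≤ ε → ∃ c C : ℝ, 0 < c ∧ 0 < C ∧ ∀ᶠ B : ℝ in atTop,
      ENNReal.ofReal (c * (B ^ (1 / 5 : ℝ) * Real.log B)) ≤
        ToricY3.zoom ToricY3.M B (5 / 2) (Metric.closedBall 0 ε) ∧
      ToricY3.zoom ToricY3.M B (5 / 2) (Metric.closedBall 0 ε) ≤
        ENNReal.ofReal (C * (B ^ (1 / 5 : ℝ) * Real.log B))) ∧
    -- weak accumulation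
    ToricY3.LocallyWeaklyAccumulating ToricY3.M := by
  exact ⟨fun P hP h h' => ToricY3.mem_M_iff_of_mem_chart hP h h',
    ⟨1 / 2, by norm_num, fun a b hab => ToricY3.exists_limit_measure hab⟩,
    ⟨16, by norm_num, fun ε hε => ToricY3.zoom_M_order hε⟩, ToricY3.locallyWeaklyAccumulating_M⟩
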